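/- Let $(\xi_n)_{n\in\mathbb Z}$ be a stationary Markov chain on a probability space $(\Omega,\mathcal F,\mathbb P)$ with values in a measurable space $(S,\mathcal A)$ and marginal distribution $\pi$. Assume that there is a Markov kernel $Q(x,A)$ which is a regular version of $\mathbb P(\xi_{n+1}\in A\mid \xi_n=x)$, and denote also by $Q$ the transition operator $(Qg)(x)=\int_S g(s)\,Q(x,ds)$ on $L^2_0(\pi)=\{g:\int g^2\,d\pi<\infty,\ \int g\,d\pi=0\}$ (complexified where spectral theory requires it). Assume that $Q$ is normal, i.e. $QQ^*=Q^*Q$. Let $g\in L^2_0(\pi)$ be real-valued, and put $X_i=g(\xi_i)$ and $S_n=X_1+\dots+X_n$. Let $\nu=\nu_g$ be the spectral measure of $Q$ with respect to $g$, i.e. the finite measure on the closed unit disk, carried by the spectrum of $Q$, such that $\langle g,\varphi(Q)g\rangle=\int\varphi\,d\nu$ for every continuous $\varphi$; in particular $\mathrm{cov}(X_0,X_n)=\langle g,Q^ng\rangle=\int z^n\,\nu(dz)$ for $n\ge 0$. Let $\nu_0$ and $\nu_\Gamma$ be the restrictions of $\nu$ to the open unit disk $D_0$ and to the unit circle $\Gamma$;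 the latter is viewed as a measure on $[0,2\pi)$ through $t\mapsto e^{it}$. Let $F$ be the spectral distribution function $$F(x)=\nu_\Gamma([0,x])+\int_0^x f(t)\,dt,\qquad f(t)=\frac1{2\pi}\int_{D_0}\frac{1-|z|^2}{|1-ze^{it}|^2}\,\nu_0(dz),\qquad 0\le x\le 2\pi.$$ Let $\alpha\in(0,2)$, let $C(\alpha)=\dfrac{\Gamma(1+\alpha)\sin(\alpha\pi/2)}{\pi(2-\alpha)}$ (here $\Gamma$ is the Gamma function), and let $h:(0,\infty)\to(0,\infty)$ be continuous and slowly varying at infinity, i.e. $h(st)/h(t)\to1$ as $t\to\infty$ for every $s>0$. Then $$\mathrm{var}(S_n)\sim n^\alpha h(n)\ \text{ as } n\to\infty\quad\Longleftrightarrow\quad F(x)\sim\tfrac12\,C(\alpha)\,x^{2-\alpha}h(1/x)\ \text{ as } x\to0^+,$$ where $a\sim b$ means that $a/b\to1$. -/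

import Mathlib

open MeasureTheory ProbabilityTheory Filter Topology Set
open scoped ENNReal InnerProductSpace CompactlySupported

noncomputable section

namespace NormalChain

/-! ### Slowly varying functions and the constant -/

/-- `h : (0, ∞) → (0, ∞)` is continuous and slowly varying at infinity. The values of `h` outside
`(0, ∞)` are irrelevant. -/
structure IsSlowlyVarying (h : ℝ → ℝ) : Prop where
  pos : ∀ t, 0 < t → 0 < h t
  continuousOn : ContinuousOn h (Ioi 0)
  tendsto_div : ∀ s, 0 < s → Tendsto (fun t : ℝ => h (s * t) / h t) atTop (𝓝 1)

/-- `C(α) = Γ(1 + α) sin(απ / 2) / (π (2 - α))`. -/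
def varianceConst (α : ℝ) : ℝ :=
  Real.Gamma (1 + α) * Real.sin (α * Real.pi / 2) / (Real.pi * (2 - α))

/-! ### The transition operator on centred square-integrable functions -/

section Operator

variable {S : Type*} [MeasurableSpace S]

lemma ae_ae_of_invariant {P : Kernel S S} {π : Measure S} (hP : P.Invariant π)
    {p : S → Prop} (h : ∀ᵐ s ∂π, p s) : ∀ᵐ x ∂π, ∀ᵐ s ∂(P x), p s := by
  rw [← hP.def] at h
  exact Measure.ae_ae_of_ae_bind P.aemeasurable h

lemma lintegral_of_invariant {P : Kernel S S} {π : Measure S} (hP : P.Invariant π)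
    {u : S → ℝ≥0∞} (hu : Measurable u) : ∫⁻ x, ∫⁻ s, u s ∂(P x) ∂π = ∫⁻ s, u s ∂π := by
  conv_rhs => rw [← hP.def]
  exact (Measure.lintegral_bind P.aemeasurable hu.aemeasurable).symm

lemma memLp_ae_of_invariant {P : Kernel S S} {π : Measure S} (hP : P.Invariant π)
    (f : Lp ℂ 2 π) : ∀ᵐ x ∂π, MemLp f 2 (P x) := by
  have hf := Lp.memLp f
  have hsm := Lp.stronglyMeasurable f
  have h1 : ∫⁻ s, ‖f s‖ₑ ^ 2 ∂π < ∞ := by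
    have := (eLpNorm_lt_top_iff_lintegral_rpow_enorm_lt_top (by norm_num) (by norm_num)).1 hf.2
    simpa using this
  rw [← lintegral_of_invariant hP (by fun_prop)] at h1
  filter_upwards [ae_lt_top ((Measurable.lintegral_kernel (by fun_prop))) h1.ne] with x hx
  refine ⟨hsm.aestronglyMeasurable, ?_⟩
  rw [eLpNorm_lt_top_iff_lintegral_rpow_enorm_lt_top (by norm_num) (by norm_num)]
  simpa using hx

lemma eLpNorm_kernelIntegral_le {P : Kernel S S} [IsMarkovKernel P] {π : Measure S}
    (hP : P.Invariant π) (f : Lp ℂ 2 π) :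
    eLpNorm (fun x => ∫ s, f s ∂(P x)) 2 π ≤ eLpNorm f 2 π := by
  have hsm := Lp.stronglyMeasurable f
  have key : ∀ x, ‖∫ s, f s ∂(P x)‖ₑ ^ (2 : ℝ) ≤ ∫⁻ s, ‖f s‖ₑ ^ (2 : ℝ) ∂(P x) := by
    intro x
    have h1 : ‖∫ s, f s ∂(P x)‖ₑ ≤ eLpNorm f 2 (P x) := by
      refine (enorm_integral_le_lintegral_enorm _).trans ?_
      rw [← eLpNorm_one_eq_lintegral_enorm]
      exact eLpNorm_le_eLpNorm_of_exponent_le (by norm_num) hsm.aestronglyMeasurable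
    rw [eLpNorm_eq_lintegral_rpow_enorm_toReal (by norm_num) (by norm_num)] at h1
    calc _ ≤ _ := ENNReal.rpow_le_rpow h1 (by norm_num)
      _ = _ := by rw [← ENNReal.rpow_mul]; simp
  rw [eLpNorm_eq_lintegral_rpow_enorm_toReal (by norm_num) (by norm_num),
    eLpNorm_eq_lintegral_rpow_enorm_toReal (by norm_num) (by norm_num)]
  refine ENNReal.rpow_le_rpow ?_ (by norm_num)
  rw [← lintegral_of_invariant hP (u := fun s => ‖f s‖ₑ ^ (2 : ℝ≥0∞).toReal) (by fun_prop)]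
  exact lintegral_mono fun x => by simpa using key x

lemma memLp_kernelIntegral {P : Kernel S S} [IsMarkovKernel P] {π : Measure S}
    (hP : P.Invariant π) (f : Lp ℂ 2 π) : MemLp (fun x => ∫ s, f s ∂(P x)) 2 π :=
  ⟨((Lp.stronglyMeasurable f).integral_kernel).aestronglyMeasurable,
    (eLpNorm_kernelIntegral_le hP f).trans_lt (Lp.memLp f).2⟩

/-- `(Qf)(x) = ∫ f(s) Q(x, ds)` as a bounded operator on complex `L²(π)`, for a Markov kernel `Q`
with invariant measure `π`. -/
def kernelOperator (P : Kernel S S) [IsMarkovKernel P] (π : Measure S) (hP : P.Invariant π) :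
    Lp ℂ 2 π →L[ℂ] Lp ℂ 2 π :=
  LinearMap.mkContinuous
    { toFun := fun f => (memLp_kernelIntegral hP f).toLp _
      map_add' := fun f g => by
        rw [← MemLp.toLp_add, MemLp.toLp_eq_toLp_iff]
        filter_upwards [memLp_ae_of_invariant hP f, memLp_ae_of_invariant hP g,
          ae_ae_of_invariant hP (Lp.coeFn_add f g)] with x hf hg hfg
        rw [integral_congr_ae hfg]
        exact integral_add (hf.integrable (by norm_num)) (hg.integrable (by norm_num))
      map_smul' := fun c f => by
        rw [RingHom.id_apply, ← MemLp.toLp_const_smul, MemLp.toLp_eq_toLp_iff]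
        filter_upwards [ae_ae_of_invariant hP (Lp.coeFn_smul c f)] with x hf
        rw [integral_congr_ae hf]
        exact integral_smul c _ }
    1 (fun f => by
      rw [one_mul]
      change ‖(memLp_kernelIntegral hP f).toLp _‖ ≤ _
      rw [Lp.norm_toLp, Lp.norm_def]
      exact ENNReal.toReal_mono (Lp.memLp f).2.ne (eLpNorm_kernelIntegral_le hP f))

lemma coeFn_kernelOperator (P : Kernel S S) [IsMarkovKernel P] (π : Measure S)
    (hP : P.Invariant π) (f : Lp ℂ 2 π) :
    kernelOperator P π hP f =ᵐ[π] fun x => ∫ s, f s ∂(P x) :=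
  MemLp.coeFn_toLp (memLp_kernelIntegral hP f)

/-- The space `L²₀(π)` of (complex) square-integrable functions with mean zero. -/
def L20 (π : Measure S) [IsProbabilityMeasure π] : Submodule ℂ (Lp ℂ 2 π) where
  carrier := {f | ∫ x, f x ∂π = 0}
  zero_mem' := by
    change ∫ x, (0 : Lp ℂ 2 π) x ∂π = 0
    rw [integral_congr_ae (Lp.coeFn_zero ℂ 2 π)]
    simp
  add_mem' := fun {f g} hf hg => by
    change ∫ x, (f + g : Lp ℂ 2 π) x ∂π = 0
    rw [integral_congr_ae (Lp.coeFn_add f g)]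
    have := integral_add ((Lp.memLp f).integrable (by norm_num))
      ((Lp.memLp g).integrable (by norm_num))
    simp only [Pi.add_apply]
    rw [this, show ∫ x, f x ∂π = 0 from hf, show ∫ x, g x ∂π = 0 from hg, add_zero]
  smul_mem' := fun c f hf => by
    change ∫ x, (c • f : Lp ℂ 2 π) x ∂π = 0
    rw [integral_congr_ae (Lp.coeFn_smul c f)]
    simp only [Pi.smul_apply]
    rw [integral_smul, show ∫ x, f x ∂π = 0 from hf, smul_zero]

lemma isClosed_L20 (π : Measure S) [IsProbabilityMeasure π] :
    IsClosed (L20 π : Set (Lp ℂ 2 π)) := by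
  have h : ∀ f : Lp ℂ 2 π, ∫ x, f x ∂π = ⟪indicatorConstLp 2 MeasurableSet.univ
      (measure_ne_top π univ) (1 : ℂ), f⟫_ℂ := fun f => by
    rw [L2.inner_indicatorConstLp_one]; simp
  have h2 : (L20 π : Set (Lp ℂ 2 π)) = {f | ⟪indicatorConstLp 2 MeasurableSet.univ
      (measure_ne_top π univ) (1 : ℂ), f⟫_ℂ = 0} := by
    ext f
    rw [mem_ofPred_eq, ← h f]
    rfl
  rw [h2]
  exact isClosed_eq (by fun_prop) continuous_const

instance (π : Measure S) [IsProbabilityMeasure π] : CompleteSpace (L20 π) :=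
  (isClosed_L20 π).completeSpace_coe

lemma kernelOperator_mem_L20 (P : Kernel S S) [IsMarkovKernel P] (π : Measure S)
    [IsProbabilityMeasure π] (hP : P.Invariant π) (f : Lp ℂ 2 π) (hf : f ∈ L20 π) :
    kernelOperator P π hP f ∈ L20 π := by
  change ∫ x, kernelOperator P π hP f x ∂π = 0
  rw [integral_congr_ae (coeFn_kernelOperator P π hP f)]
  have hi : Integrable f (π.bind P) := by
    rw [hP.def]; exact (Lp.memLp f).integrable (by norm_num)
  have h := Kernel.integral_comp (κ := Kernel.const Unit π) (η := P) (a := ()) (f := f)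
    (by rw [Kernel.comp_const, Kernel.const_apply]; exact hi)
  rw [Kernel.comp_const, Kernel.const_apply, Kernel.const_apply, hP.def] at h
  rw [← h]
  exact hf

/-- The transition operator `Q` on `L²₀(π)`. -/
def transitionOperator (P : Kernel S S) [IsMarkovKernel P] (π : Measure S)
    [IsProbabilityMeasure π] (hP : P.Invariant π) : L20 π →L[ℂ] L20 π :=
  (kernelOperator P π hP).restrict (kernelOperator_mem_L20 P π hP)

/-- A real function `g` with `∫ g² dπ < ∞` and `∫ g dπ = 0`, as an element of `L²₀(π)`. -/
def toL20 (π : Measure S) [IsProbabilityMeasure π] (g : S → ℝ) (hg : MemLp g 2 π)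
    (hg0 : ∫ x, g x ∂π = 0) : L20 π :=
  ⟨MemLp.toLp (fun x => (g x : ℂ)) hg.ofReal, by
    change ∫ x, (MemLp.toLp (fun x => (g x : ℂ)) hg.ofReal) x ∂π = 0
    rw [integral_congr_ae (MemLp.coeFn_toLp _), integral_complex_ofReal, hg0,
      Complex.ofReal_zero]⟩

end Operator

/-! ### The spectral measure of a normal operator -/

section Spectral

variable {H : Type*} [NormedAddCommGroup H] [InnerProductSpace ℂ H] [CompleteSpace H]

/-- A real function on the spectrum of `T`, regarded as a complex function. -/
def complexify {T : H →L[ℂ] H} (f : C_c(spectrum ℂ T, ℝ)) : C(spectrum ℂ T, ℂ) :=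
  ⟨fun z => (f z : ℂ), by fun_prop⟩

/-- The positive linear functional `f ↦ ⟨g, f(T) g⟩` on continuous functions on the spectrum of a
normal operator `T`, where `f(T)` is given by the continuous functional calculus. -/
def spectralFunctional (T : H →L[ℂ] H) (hT : IsStarNormal T) (g : H) :
    C_c(spectrum ℂ T, ℝ) →ₚ[ℝ] ℝ :=
  PositiveLinearMap.mk₀
    { toFun := fun f => (⟪g, cfcHom hT (complexify f) g⟫_ℂ).re
      map_add' := fun f₁ f₂ => by
        have : complexify (f₁ + f₂) = complexify f₁ + complexify f₂ := by
          ext z; simp [complexify]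
        rw [this, map_add, add_apply, inner_add_right, Complex.add_re]
      map_smul' := fun c f => by
        have : complexify (c • f) = (c : ℂ) • complexify f := by
          ext z; simp [complexify]
        rw [this, map_smul, smul_apply, inner_smul_right]
        simp }
    (fun f hf => by
      let r : C(spectrum ℂ T, ℂ) := ⟨fun z => (Real.sqrt (f z) : ℂ), by fun_prop⟩
      have h : complexify f = star r * r := by
        ext z
        have : 0 ≤ f z := hf z
        simp [complexify, r, ← Complex.ofReal_mul, Real.mul_self_sqrt this]
      change 0 ≤ (⟪g, cfcHom hT (complexify f) g⟫_ℂ).re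
      rw [h, map_mul, map_star, mul_apply_eq_comp,
        ContinuousLinearMap.star_eq_adjoint, ContinuousLinearMap.adjoint_inner_right]
      exact inner_self_nonneg (𝕜 := ℂ))

/-- The spectral measure `ν_g` of a normal operator `T` at `g`: the measure on `ℂ`, carried by the
spectrum of `T`, with `⟨g, f(T) g⟩ = ∫ f dν_g` for continuous `f`. -/
def spectralMeasure (T : H →L[ℂ] H) (hT : IsStarNormal T) (g : H) : Measure ℂ :=
  (RealRMK.rieszMeasure (spectralFunctional T hT g)).map Subtype.val

end Spectral

/-! ### The spectral distribution function -/

/-- The argument of `z` in `[0, 2π)`. -/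
def angle (z : ℂ) : ℝ := if 0 ≤ z.arg then z.arg else z.arg + 2 * Real.pi

lemma measurable_angle : Measurable angle :=
  Measurable.ite (measurableSet_le measurable_const Complex.measurable_arg)
    Complex.measurable_arg (Complex.measurable_arg.add_const _)

/-- `f(t) = (1 / 2π) ∫_{|z| < 1} (1 - |z|²) / |1 - z e^{it}|² ν(dz)`, with values in `[0, ∞]`. -/
def spectralDensity (ν : Measure ℂ) (t : ℝ) : ℝ≥0∞ :=
  ENNReal.ofReal (1 / (2 * Real.pi)) * ∫⁻ z in {z : ℂ | ‖z‖ < 1},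
    ENNReal.ofReal ((1 - ‖z‖ ^ 2) / ‖1 - z * Complex.exp (Complex.I * t)‖ ^ 2) ∂ν

/-- The measure `F(dt) = ν_Γ(dt) + f(t) dt` on `[0, 2π]`, where `ν_Γ` is the restriction of `ν` to
the unit circle, parametrized by the angle in `[0, 2π)`. -/
def spectralDistribution (ν : Measure ℂ) : Measure ℝ :=
  (ν.restrict {z : ℂ | ‖z‖ = 1}).map angle +
    (volume.restrict (Icc 0 (2 * Real.pi))).withDensity (spectralDensity ν)

/-- The distribution function `F(x) = F([0, x])`. -/
def spectralDistributionFunction (ν : Measure ℂ) (x : ℝ) : ℝ :=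
  (spectralDistribution ν).real (Icc 0 x)

/-! ### Stationary Markov chains indexed by the integers -/

section Chain

variable {Ω S : Type*} [MeasurableSpace Ω] [MeasurableSpace S]

/-- `(ξ_n)_{n ∈ ℤ}` is a stationary Markov chain, and `Q` is a regular version of the conditional
distribution of `ξ_{n+1}` given `ξ_n`. -/
structure IsStationaryMarkovChain (μ : Measure Ω) (Q : Kernel S S) (ξ : ℤ → Ω → S) : Prop where
  measurable : ∀ n, Measurable (ξ n)
  stationary : μ.map (fun ω (n : ℤ) => ξ (n + 1) ω) = μ.map (fun ω (n : ℤ) => ξ n ω)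
  markov : ∀ (n : ℤ) (A : Set S), MeasurableSet A →
    μ[(ξ (n + 1) ⁻¹' A).indicator (fun _ => (1 : ℝ)) |
      ⨆ i ≤ n, MeasurableSpace.comap (ξ i) inferInstance] =ᵐ[μ] fun ω => (Q (ξ n ω)).real A

/-- The marginal distribution `π` of the chain. -/
def marginal (μ : Measure Ω) (ξ : ℤ → Ω → S) : Measure S := μ.map (ξ 0)

namespace IsStationaryMarkovChain

variable {μ : Measure Ω} [IsProbabilityMeasure μ] {Q : Kernel S S} {ξ : ℤ → Ω → S}

lemma isProbabilityMeasure_marginal (hξ : IsStationaryMarkovChain μ Q ξ) :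
    IsProbabilityMeasure (marginal μ ξ) :=
  Measure.isProbabilityMeasure_map (hξ.measurable 0).aemeasurable

variable [IsMarkovKernel Q]

lemma invariant (hξ : IsStationaryMarkovChain μ Q ξ) : Q.Invariant (marginal μ ξ) := by
  have hm : ∀ k : ℤ, Measurable (fun ω (n : ℤ) => ξ (n + k) ω) := fun k =>
    measurable_pi_lambda _ fun n => hξ.measurable _
  have hm0 : Measurable (fun ω (n : ℤ) => ξ n ω) := measurable_pi_lambda _ hξ.measurable
  have h01 : μ.map (ξ 1) = μ.map (ξ 0) := by
    have := congrArg (fun m : Measure (ℤ → S) => m.map (fun x => x 0)) hξ.stationary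
    change (Measure.map _ _).map _ = (Measure.map _ _).map _ at this
    rw [Measure.map_map (measurable_pi_apply 0) (hm 1),
      Measure.map_map (measurable_pi_apply 0) hm0] at this
    exact this
  have hle : (⨆ i ≤ (0 : ℤ), MeasurableSpace.comap (ξ i) inferInstance) ≤
      (inferInstance : MeasurableSpace Ω) :=
    iSup₂_le fun i _ => (hξ.measurable i).comap_le
  ext A hA
  have hmA : MeasurableSet (ξ 1 ⁻¹' A) := hξ.measurable 1 hA
  have h1 : ∫ ω, (Q (ξ 0 ω)).real A ∂μ = μ.real (ξ 1 ⁻¹' A) := by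
    rw [← integral_congr_ae (hξ.markov 0 A hA), integral_condExp hle, zero_add]
    simp [integral_indicator hmA]
  have h2 : ∫⁻ ω, Q (ξ 0 ω) A ∂μ = μ (ξ 1 ⁻¹' A) := by
    rw [← ENNReal.toReal_eq_toReal_iff' _ (measure_ne_top _ _)]
    · rw [← integral_toReal]
      · exact h1
      · exact ((Q.measurable_coe hA).comp (hξ.measurable 0)).aemeasurable
      · exact ae_of_all _ fun ω => measure_lt_top _ _
    · refine ne_top_of_le_ne_top ENNReal.one_ne_top ?_
      calc ∫⁻ ω, Q (ξ 0 ω) A ∂μ ≤ ∫⁻ _, 1 ∂μ := lintegral_mono fun ω => prob_le_one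
        _ = 1 := by simp
  rw [Measure.bind_apply hA Q.aemeasurable, marginal,
    lintegral_map (Q.measurable_coe hA) (hξ.measurable 0), h2,
    ← Measure.map_apply (hξ.measurable 1) hA, h01]

/-- The transition operator of the chain on `L²₀(π)`. -/
def operator (hξ : IsStationaryMarkovChain μ Q ξ) :
    haveI := hξ.isProbabilityMeasure_marginal
    L20 (marginal μ ξ) →L[ℂ] L20 (marginal μ ξ) :=
  haveI := hξ.isProbabilityMeasure_marginal
  transitionOperator Q (marginal μ ξ) hξ.invariant

/-- The chain is normal: `Q Q* = Q* Q` on `L²₀(π)`. -/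
def IsNormal (hξ : IsStationaryMarkovChain μ Q ξ) : Prop :=
  haveI := hξ.isProbabilityMeasure_marginal
  IsStarNormal hξ.operator

/-- The transition spectral measure `ν = ν_g` of a normal chain. -/
def transitionSpectralMeasure (hξ : IsStationaryMarkovChain μ Q ξ) (hQ : hξ.IsNormal)
    (g : S → ℝ) (hg : MemLp g 2 (marginal μ ξ)) (hg0 : ∫ x, g x ∂(marginal μ ξ) = 0) :
    Measure ℂ :=
  haveI := hξ.isProbabilityMeasure_marginal
  spectralMeasure hξ.operator hQ (toL20 (marginal μ ξ) g hg hg0)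

end IsStationaryMarkovChain

/-- `S_n = g(ξ_1) + ⋯ + g(ξ_n)`. -/
def partialSum (ξ : ℤ → Ω → S) (g : S → ℝ) (n : ℕ) (ω : Ω) : ℝ :=
  ∑ i ∈ Finset.Icc 1 n, g (ξ i ω)

end Chain

end NormalChain

end

/-! The covariances are the cosine coefficients of `F`: the Poisson kernel of an interior point `z`
integrates `cos (m t)` to `Re z ^ m`, and on the circle this is immediate, so `cov(X_0, X_m) = ∫ Re
z ^ m dν = ∫ cos (m t) F(dt)`. Hence `var(S_n) = ∫ (sin (n t / 2) / sin (t / 2))² F(dt)`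
(`variance_partialSum`). Since `g` is real and `Q` preserves real functions, all `⟨Q^m g, Q^n g⟩`
are real. Such mixed moments determine `ν`, so `ν` is invariant under conjugation and `F` is
symmetric under `t ↦ 2π - t`, apart from the endpoint.

Fold `F` to a symmetric measure on `[-π, π]` and multiply it by `(t / 2)² / sin² (t / 2)`, a density
continuous at `0` with value `1`. The result `σ` (`weightedFold`) satisfies `var(S_n) = V(n)` with
`V(y) = ∫ y² fejer(y t) σ(dt)`, and it behaves at `0` like the folded measure. Moving from integer
to real `y` is harmless because the square root of the integrand is `1`-Lipschitz in `y`. It remains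
to compare `V(y)` with `σ([-1/y, 1/y])`.

Tauberian half (`tendsto_measure_of_tendsto_fejerVariance`): let `u = y t` be distributed according
to `y² fejer(y t) σ(dt) / V(y)`. As `y² fejer(y t) = 2 (1 - cos (y t)) / t²`, the characteristic
function of `u` at `s` is `(V((s+1)y) + V((s-1)y) - 2 V(s y)) / (2 V(y))`. If `V` varies regularly
with index `α`, it converges to the same expression with `V(s y) / V(y)` replaced by `|s| ^ α`. That
limit belongs to the explicit `modelMeasure`, whose `V` is exactly `|y| ^ α`. By Lévy's continuity
theorem the laws converge weakly, and integrating `1 / fejer` over `[-1, 1]` gives `y² σ([-1/y,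
1/y]) / V(y) → C(α)`.

Abelian half (`tendsto_fejerVariance_of_tendsto_measure`): on `|y t| ≤ K` the rescaled measures
converge weakly to the model measure, and a Potter bound makes the contribution of `|y t| > K` small
uniformly in large `y`.

Finally, the folded mass of `[-x, x]` is `2 F(x) - F({0})`. Either asymptotic relation forces
`F({0}) = 0`, because `x ^ (2 - α) h(1/x) → 0`; this explains the factor `1/2`. -/

namespace NormalChain

open scoped BoundedContinuousFunction ComplexConjugate

/-! ### Slowly varying functions -/

namespace IsSlowlyVarying

variable {h : ℝ → ℝ}

lemma inv (hh : IsSlowlyVarying h) : IsSlowlyVarying (fun t => (h t)⁻¹) where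
  pos t ht := inv_pos.2 (hh.pos t ht)
  continuousOn := hh.continuousOn.inv₀ fun t ht => (hh.pos t ht).ne'
  tendsto_div s hs := by
    have := (hh.tendsto_div s hs).inv₀ one_ne_zero
    simp only [inv_one] at this
    refine this.congr fun t => ?_
    rw [inv_div, div_eq_mul_inv, div_eq_mul_inv, inv_inv, mul_comm]

/-- `h` in logarithmic coordinates. -/
lemma continuous_log_exp (hh : IsSlowlyVarying h) :
    Continuous fun x => Real.log (h (Real.exp x)) := by
  have h1 : Continuous fun x => h (Real.exp x) :=
    hh.continuousOn.comp_continuous Real.continuous_exp fun x => Real.exp_pos x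
  exact h1.log fun x => (hh.pos _ (Real.exp_pos x)).ne'

lemma tendsto_log_exp (hh : IsSlowlyVarying h) (u : ℝ) :
    Tendsto (fun x => Real.log (h (Real.exp (x + u))) - Real.log (h (Real.exp x))) atTop (𝓝 0) := by
  have h1 := ((hh.tendsto_div _ (Real.exp_pos u)).comp Real.tendsto_exp_atTop).log one_ne_zero
  rw [Real.log_one] at h1
  refine h1.congr fun x => ?_
  simp only [Function.comp_apply]
  rw [← Real.exp_add, add_comm u, Real.log_div (hh.pos _ (Real.exp_pos _)).ne'
    (hh.pos _ (Real.exp_pos _)).ne']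

/-- Local uniformity of the convergence, in logarithmic coordinates. -/
lemma exists_uniform_log (hh : IsSlowlyVarying h) {ε : ℝ} (hε : 0 < ε) :
    ∃ δ > 0, ∃ X, ∀ x ≥ X, ∀ v ∈ Icc 0 δ,
      |Real.log (h (Real.exp (x + v))) - Real.log (h (Real.exp x))| ≤ ε := by
  set k : ℝ → ℝ := fun x => Real.log (h (Real.exp x)) with hk
  have hkc : Continuous k := hh.continuous_log_exp
  -- Baire category: the closed sets `A N` of shifts that are harmless from `N` on cover the line,
  -- so one of them contains a ball around some `a`. A small shift `v` at `x` is then the difference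
  -- of the shifts `a + v` and `a` at `x - a`, each costing `ε / 2`.
  let A : ℕ → Set ℝ := fun N => {u | ∀ x ≥ (N : ℝ), |k (x + u) - k x| ≤ ε / 2}
  have hA : ∀ N, IsClosed (A N) := fun N => by
    have : A N = ⋂ x ≥ (N : ℝ), {u | |k (x + u) - k x| ≤ ε / 2} := by
      ext u; simp [A]
    rw [this]
    exact isClosed_biInter fun x _ => isClosed_le (by fun_prop) continuous_const
  have hU : ⋃ N, A N = univ := by
    refine eq_univ_of_forall fun u => mem_iUnion.2 ?_
    have := (hh.tendsto_log_exp u).abs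
    rw [abs_zero] at this
    obtain ⟨X, hX⟩ := eventually_atTop.1 (this.eventually_le_const (half_pos hε))
    obtain ⟨N, hN⟩ := exists_nat_ge X
    exact ⟨N, fun x hx => hX x (hN.trans hx)⟩
  obtain ⟨N, a, ha⟩ := nonempty_interior_of_iUnion_of_closed hA hU
  obtain ⟨r, hr, hball⟩ := Metric.isOpen_iff.1 isOpen_interior a ha
  refine ⟨r / 2, half_pos hr, N + a, fun x hx v hv => ?_⟩
  have h1 : a + v ∈ A N := interior_subset (hball (by
    rw [Metric.mem_ball, Real.dist_eq, add_sub_cancel_left, abs_of_nonneg hv.1]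
    linarith [hv.2]))
  have h2 : a ∈ A N := interior_subset ha
  have h3 := h1 (x - a) (by linarith)
  have h4 := h2 (x - a) (by linarith)
  rw [show x - a + (a + v) = x + v by ring] at h3
  rw [show x - a + a = x by ring] at h4
  change |k (x + v) - k x| ≤ ε
  rw [abs_le] at *
  constructor <;> linarith [h3.1, h3.2, h4.1, h4.2]

/-- The ratio `y / ⌊y⌋` depends on `y`, so pointwise slow variation does not suffice; as its
logarithm tends to `0`, the local uniformity does. -/
lemma tendsto_floor_div (hh : IsSlowlyVarying h) :
    Tendsto (fun y : ℝ => h (⌊y⌋₊ : ℝ) / h y) atTop (𝓝 1) := by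
  have key : Tendsto (fun y : ℝ => Real.log (h (⌊y⌋₊ : ℝ)) - Real.log (h y)) atTop (𝓝 0) := by
    rw [Metric.tendsto_nhds]
    intro ε hε
    obtain ⟨δ, hδ, X, hX⟩ := hh.exists_uniform_log (half_pos hε)
    have h1 : Tendsto (fun y : ℝ => Real.log y - Real.log (⌊y⌋₊ : ℝ)) atTop (𝓝 0) := by
      have := (tendsto_nat_floor_div_atTop (R := ℝ)).log one_ne_zero
      rw [Real.log_one] at this
      have := this.neg
      rw [neg_zero] at this
      refine this.congr' ?_
      filter_upwards [eventually_ge_atTop 1] with y hy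
      have h2 : 0 < (⌊y⌋₊ : ℝ) := by exact_mod_cast Nat.floor_pos.2 hy
      rw [Real.log_div h2.ne' (by positivity), neg_sub]
    filter_upwards [h1.eventually_le_const hδ, eventually_ge_atTop 1,
      (Real.tendsto_log_atTop.comp (tendsto_natCast_atTop_atTop.comp
        (tendsto_nat_floor_atTop (α := ℝ)))).eventually_ge_atTop X] with y hy hy1 hyX
    have h2 : 0 < (⌊y⌋₊ : ℝ) := by exact_mod_cast Nat.floor_pos.2 hy1
    have h3 : (⌊y⌋₊ : ℝ) ≤ y := Nat.floor_le (by linarith)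
    have h4 := hX _ hyX (Real.log y - Real.log (⌊y⌋₊ : ℝ))
      ⟨sub_nonneg.2 (Real.log_le_log h2 h3), hy⟩
    simp only [Function.comp_apply] at h4
    rw [add_sub_cancel (Real.log (⌊y⌋₊ : ℝ)), Real.exp_log h2, Real.exp_log (by linarith)] at h4
    rw [Real.dist_eq, sub_zero, abs_sub_comm]
    linarith
  have h5 := (Real.continuous_exp.tendsto 0).comp key
  rw [Real.exp_zero] at h5
  refine h5.congr' ?_
  filter_upwards [eventually_ge_atTop 1] with y hy
  have h2 : 0 < (⌊y⌋₊ : ℝ) := by exact_mod_cast Nat.floor_pos.2 hy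
  simp only [Function.comp_apply]
  rw [Real.exp_sub, Real.exp_log (hh.pos _ h2), Real.exp_log (hh.pos _ (by linarith))]

/-- A Potter type bound. -/
lemma exists_rpow_mul_le (hh : IsSlowlyVarying h) {β : ℝ} (hβ : 0 < β) :
    ∃ X > 0, ∀ x ≥ X, ∀ y ≥ x, x ^ β * h x ≤ 2 * (y ^ β * h y) := by
  obtain ⟨δ, hδ, X₁, hX₁⟩ := hh.exists_uniform_log (Real.log_pos one_lt_two)
  obtain ⟨X₂, hX₂⟩ := eventually_atTop.1
    ((hh.tendsto_log_exp δ).eventually_const_le (u := -(β * δ)) (by nlinarith))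
  set k : ℝ → ℝ := fun x => Real.log (h (Real.exp x)) with hk
  set X := max X₁ X₂
  -- Over a full block of length `δ` the function `k` drops by at most `β δ`, which the growth of `β
  -- x` absorbs. Only the last, incomplete block costs `log 2`, whence the factor `2`.
  have hstep : ∀ n : ℕ, ∀ x ≥ X, k x ≤ β * (n * δ) + k (x + n * δ) := by
    intro n
    induction n with
    | zero => intro x _; simp
    | succ n ih =>
      intro x hx
      have h1 := ih x hx
      have h2 := hX₂ (x + n * δ) (((le_max_right _ _).trans hx).trans (by
        have : 0 ≤ n * δ := by positivity
        linarith))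
      change -(β * δ) ≤ k (x + n * δ + δ) - k (x + n * δ) at h2
      push_cast
      rw [show x + (n + 1) * δ = x + n * δ + δ by ring]
      linarith
  have hlog : ∀ x ≥ X, ∀ y ≥ x, β * x + k x ≤ Real.log 2 + (β * y + k y) := by
    intro x hx y hy
    set n := ⌊(y - x) / δ⌋₊
    have hn0 : 0 ≤ (y - x) / δ := div_nonneg (by linarith) hδ.le
    have hn1 : n * δ ≤ y - x := (le_div_iff₀ hδ).1 (Nat.floor_le hn0)
    have hn2 : y - x < (n + 1) * δ := (div_lt_iff₀ hδ).1 (Nat.lt_floor_add_one _)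
    have hnδ : 0 ≤ n * δ := by positivity
    have h1 := hstep n x hx
    have h2 := hX₁ (x + n * δ) (((le_max_left _ _).trans hx).trans (by linarith))
      (y - x - n * δ) ⟨by linarith, by linarith⟩
    rw [show x + n * δ + (y - x - n * δ) = y by ring] at h2
    change |k y - k (x + n * δ)| ≤ _ at h2
    have h3 := (abs_le.1 h2).1
    have h4 := mul_le_mul_of_nonneg_left hn1 hβ.le
    linarith
  refine ⟨Real.exp X, Real.exp_pos X, fun x hx y hy => ?_⟩
  have hx0 : 0 < x := (Real.exp_pos X).trans_le hx
  have hy0 : 0 < y := hx0.trans_le hy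
  have h1 := hlog (Real.log x) ((Real.le_log_iff_exp_le hx0).2 hx) (Real.log y)
    (Real.log_le_log hx0 hy)
  simp only [hk, Real.exp_log hx0, Real.exp_log hy0] at h1
  have h2 := Real.exp_le_exp.2 h1
  rwa [Real.exp_add, Real.exp_add, Real.exp_add, Real.exp_log (hh.pos x hx0),
    Real.exp_log (hh.pos y hy0), Real.exp_log two_pos, mul_comm β, mul_comm β,
    ← Real.rpow_def_of_pos hx0, ← Real.rpow_def_of_pos hy0] at h2

/-- Half of the exponent pays for the Potter bound; the other half tends to infinity. -/
lemma tendsto_rpow_mul_atTop (hh : IsSlowlyVarying h) {β : ℝ} (hβ : 0 < β) :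
    Tendsto (fun y => y ^ β * h y) atTop atTop := by
  obtain ⟨X, hX, hb⟩ := hh.exists_rpow_mul_le (half_pos hβ)
  have h1 : Tendsto (fun y : ℝ => X ^ (β / 2) * h X / 2 * y ^ (β / 2)) atTop atTop :=
    (tendsto_rpow_atTop (half_pos hβ)).const_mul_atTop (by
      have := hh.pos X hX
      positivity)
  refine tendsto_atTop_mono' _ ?_ h1
  filter_upwards [eventually_ge_atTop X] with y hy
  have hy0 : 0 < y := hX.trans_le hy
  have h2 := hb X le_rfl y hy
  calc _ ≤ (y ^ (β / 2) * h y) * y ^ (β / 2) := by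
        gcongr
        linarith
    _ = y ^ β * h y := by
        rw [mul_right_comm, ← Real.rpow_add hy0, add_halves]

end IsSlowlyVarying

/-! ### The Fejér kernel -/

/-- `fejer u = (sin (u / 2) / (u / 2))² = 2 (1 - cos u) / u²`. -/
noncomputable def fejer (u : ℝ) : ℝ := Real.sinc (u / 2) ^ 2

@[fun_prop] lemma continuous_fejer : Continuous fejer := by
  have := Real.continuous_sinc
  unfold fejer
  fun_prop

@[simp] lemma fejer_zero : fejer 0 = 1 := by simp [fejer]

@[simp] lemma fejer_neg (u : ℝ) : fejer (-u) = fejer u := by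
  rw [fejer, neg_div, Real.sinc_neg, fejer]

lemma fejer_abs (u : ℝ) : fejer |u| = fejer u := by
  rcases abs_choice u with h | h <;> rw [h]
  exact fejer_neg u

lemma fejer_nonneg (u : ℝ) : 0 ≤ fejer u := sq_nonneg _

lemma fejer_le_one (u : ℝ) : fejer u ≤ 1 :=
  (sq_le_one_iff_abs_le_one _).2 (Real.abs_sinc_le_one _)

lemma sq_mul_fejer (u : ℝ) : u ^ 2 * fejer u = 2 * (1 - Real.cos u) := by
  rcases eq_or_ne u 0 with rfl | hu
  · simp
  have h1 : Real.cos u = 1 - 2 * Real.sin (u / 2) ^ 2 := by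
    have := Real.cos_sq' (u / 2)
    have h2 := Real.cos_two_mul (u / 2)
    rw [mul_div_cancel₀ u two_ne_zero] at h2
    linarith
  rw [fejer, Real.sinc_of_ne_zero (by simpa using hu), h1]
  field_simp
  ring

lemma fejer_le_four_div_sq (u : ℝ) (hu : u ≠ 0) : fejer u ≤ 4 / u ^ 2 := by
  rw [le_div_iff₀ (by positivity), mul_comm, sq_mul_fejer]
  linarith [Real.neg_one_le_cos u]

lemma four_div_pi_sq_le_fejer {u : ℝ} (hu : |u| ≤ Real.pi) : 4 / Real.pi ^ 2 ≤ fejer u := by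
  rw [← fejer_abs]
  rcases (abs_nonneg u).eq_or_lt with h | h
  · rw [← h, fejer_zero, div_le_one (by positivity)]
    nlinarith [Real.pi_gt_three]
  · have h1 := Real.mul_le_sin (x := |u| / 2) (by positivity) (by linarith)
    have h2 : 2 / Real.pi ≤ Real.sinc (|u| / 2) := by
      rw [Real.sinc_of_ne_zero (by positivity), le_div_iff₀ (by positivity)]
      exact h1
    calc 4 / Real.pi ^ 2 = (2 / Real.pi) ^ 2 := by ring
      _ ≤ _ := pow_le_pow_left₀ (by positivity) h2 2

/-- Product-to-sum formula for `cos (s u) (1 - cos u)` with `u = y t`. It expresses the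
characteristic functions of the Fejér-weighted laws through variances alone. -/
lemma cos_mul_sq_mul_fejer (s y t : ℝ) :
    Real.cos (s * (y * t)) * (y ^ 2 * fejer (y * t)) =
      1 / 2 * (((s + 1) * y) ^ 2 * fejer ((s + 1) * y * t)) +
        1 / 2 * (((s - 1) * y) ^ 2 * fejer ((s - 1) * y * t)) -
          (s * y) ^ 2 * fejer (s * y * t) := by
  rcases eq_or_ne t 0 with rfl | ht
  · simp; ring
  have key : ∀ a : ℝ, a ^ 2 * fejer (a * t) = 2 * (1 - Real.cos (a * t)) / t ^ 2 := fun a => by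
    rw [← sq_mul_fejer, mul_pow]
    field_simp
  rw [key, key, key, key, show (s + 1) * y * t = s * y * t + y * t by ring,
    show (s - 1) * y * t = s * y * t - y * t by ring, Real.cos_add, Real.cos_sub, ← mul_assoc s]
  field_simp
  ring

/-- `∫ y² fejer(y t) σ(dt)`. -/
noncomputable def fejerVariance (σ : Measure ℝ) (y : ℝ) : ℝ := ∫ t, y ^ 2 * fejer (y * t) ∂σ

@[simp] lemma fejerVariance_zero (σ : Measure ℝ) : fejerVariance σ 0 = 0 := by
  simp [fejerVariance]

lemma fejerVariance_neg (σ : Measure ℝ) (y : ℝ) : fejerVariance σ (-y) = fejerVariance σ y := by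
  simp [fejerVariance]

lemma fejerVariance_abs (σ : Measure ℝ) (y : ℝ) : fejerVariance σ |y| = fejerVariance σ y := by
  rcases abs_choice y with h | h <;> rw [h]
  exact fejerVariance_neg σ y

lemma integrable_fejer (σ : Measure ℝ) [IsFiniteMeasure σ] (y : ℝ) :
    Integrable (fun t => y ^ 2 * fejer (y * t)) σ := by
  refine (Integrable.of_bound (f := fun t => fejer (y * t))
    (by fun_prop : Continuous _).aestronglyMeasurable 1 (ae_of_all _ fun t => ?_)).const_mul _
  rw [Real.norm_of_nonneg (fejer_nonneg _)]
  exact fejer_le_one _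

lemma integral_cos_mul_fejer (σ : Measure ℝ)
    (hσ : ∀ y, Integrable (fun t => y ^ 2 * fejer (y * t)) σ) (s y : ℝ) :
    ∫ t, Real.cos (s * (y * t)) * (y ^ 2 * fejer (y * t)) ∂σ =
      1 / 2 * fejerVariance σ ((s + 1) * y) + 1 / 2 * fejerVariance σ ((s - 1) * y) -
        fejerVariance σ (s * y) := by
  simp_rw [cos_mul_sq_mul_fejer]
  have h1 := ((hσ ((s + 1) * y)).const_mul (1 / 2)).add ((hσ ((s - 1) * y)).const_mul (1 / 2))
  rw [integral_sub (by exact h1) (hσ _), integral_add ((hσ _).const_mul _) ((hσ _).const_mul _),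
    integral_const_mul (1 / 2), integral_const_mul (1 / 2)]
  rfl

/-! ### The integral of `(1 - cos u) u ^ (-1 - α)` -/

/-- The Bochner integral of a non-integrable function is `0` by convention, so a nonzero closed form
already certifies integrability. -/
lemma integrable_of_integral_ne_zero {X : Type*} [MeasurableSpace X] {m : Measure X} {f : X → ℝ}
    (h : ∫ x, f x ∂m ≠ 0) : Integrable f m :=
  not_imp_comm.1 integral_undef h

lemma lintegral_Ioi_ofReal {f : ℝ → ℝ} {c : ℝ} (h0 : ∀ x, 0 < x → 0 ≤ f x)
    (hI : ∫ x in Ioi 0, f x = c) (hc : c ≠ 0) :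
    ∫⁻ x in Ioi 0, ENNReal.ofReal (f x) = ENNReal.ofReal c := by
  rw [← hI, ofReal_integral_eq_lintegral_ofReal (integrable_of_integral_ne_zero (hI ▸ hc))]
  exact (ae_restrict_iff' measurableSet_Ioi).2 (ae_of_all _ fun x hx => h0 x hx)

lemma lintegral_one_sub_cos_mul_exp {s : ℝ} (hs : 0 < s) :
    ∫⁻ u in Ioi 0, ENNReal.ofReal ((1 - Real.cos u) * Real.exp (-(u * s))) =
      ENNReal.ofReal (1 / (s * (1 + s ^ 2))) := by
  have hs2 : 1 + s ^ 2 ≠ 0 := by positivity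
  -- The antiderivative of `(1 - cos u) exp (-u s)` that vanishes at infinity.
  let Φ : ℝ → ℝ := fun u => -(Real.exp (-(u * s)) *
    (1 / s + (Real.sin u - s * Real.cos u) / (1 + s ^ 2)))
  refine lintegral_Ioi_ofReal (fun x _ => mul_nonneg (by linarith [Real.cos_le_one x])
    (Real.exp_pos _).le) ?_ (by positivity)
  have hderiv : ∀ u ∈ Ici (0 : ℝ),
      HasDerivAt Φ ((1 - Real.cos u) * Real.exp (-(u * s))) u := fun u _ => by
    have h1 : HasDerivAt (fun u => Real.exp (-(u * s))) (Real.exp (-(u * s)) * -(1 * s)) u :=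
      (((hasDerivAt_id u).mul_const s).neg).exp
    have h2 : HasDerivAt (fun u => 1 / s + (Real.sin u - s * Real.cos u) / (1 + s ^ 2))
        ((Real.cos u - s * -Real.sin u) / (1 + s ^ 2)) u :=
      (((Real.hasDerivAt_sin u).sub ((Real.hasDerivAt_cos u).const_mul s)).div_const _).const_add _
    refine (h1.mul h2).neg.congr_deriv ?_
    field_simp
    ring
  have hlim : Tendsto Φ atTop (𝓝 0) := by
    have h1 : Tendsto (fun u : ℝ => Real.exp (-(u * s))) atTop (𝓝 0) :=
      Real.tendsto_exp_neg_atTop_nhds_zero.comp (tendsto_id.atTop_mul_const hs)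
    have h2 : Tendsto (fun u : ℝ => (1 / s + (Real.sin u - s * Real.cos u) / (1 + s ^ 2)) *
        Real.exp (-(u * s))) atTop (𝓝 0) := by
      refine bdd_le_mul_tendsto_zero' (1 / s + (1 + s) / (1 + s ^ 2)) (Eventually.of_forall
        fun u => ?_) h1
      refine (abs_add_le _ _).trans ?_
      rw [abs_of_pos (by positivity : 0 < 1 / s), abs_div, abs_of_pos (by positivity : 0 < 1 + s ^ 2)]
      gcongr
      refine (abs_sub _ _).trans ?_
      rw [abs_mul, abs_of_pos hs]
      have := Real.abs_sin_le_one u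
      have := mul_le_mul_of_nonneg_left (Real.abs_cos_le_one u) hs.le
      linarith
    have := h2.neg
    rw [neg_zero] at this
    refine this.congr fun u => ?_
    simp only [Φ]
    ring
  rw [integral_Ioi_of_hasDerivAt_of_nonneg' hderiv (fun x _ => mul_nonneg
    (by linarith [Real.cos_le_one x]) (Real.exp_pos _).le) hlim]
  simp only [Φ]
  simp
  field_simp
  ring

/-- Write `1 / (1 + s²)` as `∫ exp (-w (1 + s²)) dw` and exchange by Tonelli; two Gamma integrals
produce `Γ(α/2) Γ(1 - α/2) / 2`, and the reflection formula concludes. -/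
lemma lintegral_rpow_div_one_add_sq {α : ℝ} (hα : α ∈ Ioo (0 : ℝ) 2) :
    ∫⁻ s in Ioi 0, ENNReal.ofReal (s ^ (α - 1) / (1 + s ^ 2)) =
      ENNReal.ofReal (Real.pi / (2 * Real.sin (α * Real.pi / 2))) := by
  have h1 : ∀ s : ℝ, 0 < s → ENNReal.ofReal (s ^ (α - 1) / (1 + s ^ 2)) =
      ∫⁻ w in Ioi 0, ENNReal.ofReal (s ^ (α - 1) * Real.exp (-w * s ^ 2) * Real.exp (-w)) := by
    intro s hs
    refine (lintegral_Ioi_ofReal (fun x _ => by positivity) ?_ (by positivity)).symm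
    have := integral_exp_mul_Ioi (a := -(1 + s ^ 2)) (by nlinarith) 0
    simp only [mul_zero, Real.exp_zero] at this
    rw [div_eq_mul_inv, ← one_div (1 + s ^ 2), show 1 / (1 + s ^ 2) = -1 / -(1 + s ^ 2) by
      rw [neg_div_neg_eq], ← this, ← integral_const_mul]
    refine integral_congr_ae (ae_of_all _ fun w => ?_)
    simp only
    rw [mul_assoc, ← Real.exp_add]
    ring_nf
  have h2 : ∀ w : ℝ, 0 < w →
      ∫⁻ s in Ioi 0, ENNReal.ofReal (s ^ (α - 1) * Real.exp (-w * s ^ 2) * Real.exp (-w)) =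
        ENNReal.ofReal (1 / 2 * Real.Gamma (α / 2) * (Real.exp (-w) * w ^ (1 - α / 2 - 1))) := by
    intro w hw
    have hG := Real.Gamma_pos_of_pos (half_pos hα.1)
    refine lintegral_Ioi_ofReal (fun x hx => by positivity) ?_ (by positivity)
    rw [integral_mul_const]
    have := integral_rpow_mul_exp_neg_mul_rpow (p := 2) (q := α - 1) (b := w) two_pos
      (by linarith [hα.1]) hw
    simp only [Real.rpow_two] at this
    rw [this]
    simp only [sub_add_cancel]
    rw [show -α / 2 = 1 - α / 2 - 1 by ring]
    ring
  have hΓ := Real.Gamma_pos_of_pos (half_pos hα.1)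
  have hΓ' : 0 < Real.Gamma (1 - α / 2) := Real.Gamma_pos_of_pos (by linarith [hα.2])
  calc ∫⁻ s in Ioi 0, ENNReal.ofReal (s ^ (α - 1) / (1 + s ^ 2))
      = ∫⁻ s in Ioi 0, ∫⁻ w in Ioi 0,
          ENNReal.ofReal (s ^ (α - 1) * Real.exp (-w * s ^ 2) * Real.exp (-w)) :=
        setLIntegral_congr_fun measurableSet_Ioi fun s hs => h1 s hs
    _ = ∫⁻ w in Ioi 0, ∫⁻ s in Ioi 0,
          ENNReal.ofReal (s ^ (α - 1) * Real.exp (-w * s ^ 2) * Real.exp (-w)) :=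
        lintegral_lintegral_swap (by fun_prop)
    _ = ∫⁻ w in Ioi 0,
          ENNReal.ofReal (1 / 2 * Real.Gamma (α / 2) * (Real.exp (-w) * w ^ (1 - α / 2 - 1))) :=
        setLIntegral_congr_fun measurableSet_Ioi fun w hw => h2 w hw
    _ = ENNReal.ofReal (1 / 2 * Real.Gamma (α / 2) * Real.Gamma (1 - α / 2)) := by
        refine lintegral_Ioi_ofReal (fun x hx => by positivity) ?_ (by positivity)
        rw [integral_const_mul, ← Real.Gamma_eq_integral (by linarith [hα.2])]
    _ = _ := by
        rw [mul_assoc, Real.Gamma_mul_Gamma_one_sub, show Real.pi * (α / 2) = α * Real.pi / 2 by ring]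
        congr 1
        ring

lemma sin_half_pos {α : ℝ} (hα : α ∈ Ioo (0 : ℝ) 2) : 0 < Real.sin (α * Real.pi / 2) := by
  have := Real.pi_pos
  refine Real.sin_pos_of_pos_of_lt_pi ?_ ?_
  · have := hα.1; positivity
  · nlinarith [hα.2]

lemma varianceConst_pos {α : ℝ} (hα : α ∈ Ioo (0 : ℝ) 2) : 0 < varianceConst α := by
  have h1 := sin_half_pos hα
  have h2 : 0 < Real.Gamma (1 + α) := Real.Gamma_pos_of_pos (by linarith [hα.1])
  have h3 : 0 < 2 - α := by linarith [hα.2]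
  have := Real.pi_pos
  unfold varianceConst
  positivity

/-- Write `u ^ (-1 - α)` as `Γ(1 + α)⁻¹ ∫ s ^ α exp (-u s) ds` and exchange; the integral over `u`
is then elementary. This is the origin of `Γ(1 + α)` and of the sine in `varianceConst`. -/
lemma lintegral_one_sub_cos_mul_rpow {α : ℝ} (hα : α ∈ Ioo (0 : ℝ) 2) :
    ∫⁻ u in Ioi 0, ENNReal.ofReal ((1 - Real.cos u) * u ^ (-1 - α)) =
      ENNReal.ofReal (1 / (2 * (varianceConst α * (2 - α)))) := by
  have hΓ : 0 < Real.Gamma (1 + α) := Real.Gamma_pos_of_pos (by linarith [hα.1])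
  have hsin := sin_half_pos hα
  have hα2 : 0 < 2 - α := by linarith [hα.2]
  have h1 : ∀ u : ℝ, 0 < u → ENNReal.ofReal ((1 - Real.cos u) * u ^ (-1 - α)) =
      ENNReal.ofReal (Real.Gamma (1 + α))⁻¹ * ∫⁻ s in Ioi 0,
        ENNReal.ofReal (s ^ α * ((1 - Real.cos u) * Real.exp (-(u * s)))) := by
    intro u hu
    have hc : 0 ≤ 1 - Real.cos u := by linarith [Real.cos_le_one u]
    rw [← lintegral_const_mul' _ _ ENNReal.ofReal_ne_top]
    have h2 := lintegral_Ioi_ofReal (f := fun s => s ^ (1 + α - 1) * Real.exp (-(u * s)))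
      (fun x hx => by positivity)
      (Real.integral_rpow_mul_exp_neg_mul_Ioi (a := 1 + α) (by linarith [hα.1]) hu) (by positivity)
    have h3 : ENNReal.ofReal ((1 - Real.cos u) * u ^ (-1 - α)) =
        ENNReal.ofReal ((1 - Real.cos u) * (Real.Gamma (1 + α))⁻¹) *
          ENNReal.ofReal ((1 / u) ^ (1 + α) * Real.Gamma (1 + α)) := by
      rw [← ENNReal.ofReal_mul (by positivity), one_div, Real.inv_rpow hu.le, ← Real.rpow_neg hu.le,
        show -(1 + α) = -1 - α by ring]
      congr 1
      field_simp
    rw [h3, ← h2, ← lintegral_const_mul' _ _ ENNReal.ofReal_ne_top]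
    refine lintegral_congr fun s => ?_
    rw [← ENNReal.ofReal_mul (by positivity), ← ENNReal.ofReal_mul (by positivity),
      show 1 + α - 1 = α by ring]
    congr 1
    ring
  calc ∫⁻ u in Ioi 0, ENNReal.ofReal ((1 - Real.cos u) * u ^ (-1 - α))
      = ENNReal.ofReal (Real.Gamma (1 + α))⁻¹ * ∫⁻ u in Ioi 0, ∫⁻ s in Ioi 0,
          ENNReal.ofReal (s ^ α * ((1 - Real.cos u) * Real.exp (-(u * s)))) := by
        rw [← lintegral_const_mul' _ _ ENNReal.ofReal_ne_top]
        exact setLIntegral_congr_fun measurableSet_Ioi fun u hu => h1 u hu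
    _ = ENNReal.ofReal (Real.Gamma (1 + α))⁻¹ * ∫⁻ s in Ioi 0, ∫⁻ u in Ioi 0,
          ENNReal.ofReal (s ^ α * ((1 - Real.cos u) * Real.exp (-(u * s)))) := by
        rw [lintegral_lintegral_swap]
        fun_prop
    _ = ENNReal.ofReal (Real.Gamma (1 + α))⁻¹ *
          ∫⁻ s in Ioi 0, ENNReal.ofReal (s ^ (α - 1) / (1 + s ^ 2)) := by
        congr 1
        refine setLIntegral_congr_fun measurableSet_Ioi fun s (hs : 0 < s) => ?_
        simp_rw [ENNReal.ofReal_mul (Real.rpow_nonneg hs.le α)]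
        rw [lintegral_const_mul' _ _ ENNReal.ofReal_ne_top, lintegral_one_sub_cos_mul_exp hs,
          ← ENNReal.ofReal_mul (by positivity), Real.rpow_sub_one hs.ne']
        congr 1
        field_simp
    _ = _ := by
        rw [lintegral_rpow_div_one_add_sq hα, ← ENNReal.ofReal_mul (by positivity)]
        congr 1
        unfold varianceConst
        have := Real.pi_pos
        field_simp

/-! ### The model measure -/

/-- The measure with density `(2 - α) C(α) / 2 |u| ^ (1 - α)` on the line. -/
noncomputable def modelMeasure (α : ℝ) : Measure ℝ :=
  volume.withDensity fun u => ENNReal.ofReal (varianceConst α * (2 - α) / 2 * |u| ^ (1 - α))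

lemma integral_modelMeasure {α : ℝ} (hα : α ∈ Ioo (0 : ℝ) 2) (f : ℝ → ℝ) :
    ∫ u, f u ∂(modelMeasure α) =
      varianceConst α * (2 - α) / 2 * ∫ u, f u * |u| ^ (1 - α) := by
  have hC := varianceConst_pos hα
  have hα2 : 0 < 2 - α := by linarith [hα.2]
  rw [modelMeasure, integral_withDensity_eq_integral_toReal_smul (by fun_prop)
    (ae_of_all _ fun _ => ENNReal.ofReal_lt_top), ← integral_const_mul]
  refine integral_congr_ae (ae_of_all _ fun u => ?_)
  simp only [smul_eq_mul]
  rw [ENNReal.toReal_ofReal (by positivity)]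
  ring

lemma integral_fejer_mul_rpow {α : ℝ} (hα : α ∈ Ioo (0 : ℝ) 2) :
    ∫ u, fejer u * |u| ^ (1 - α) = 2 / (varianceConst α * (2 - α)) := by
  have hC := varianceConst_pos hα
  have hα2 : 0 < 2 - α := by linarith [hα.2]
  have h0 : ∀ u : ℝ, 0 < u →
      fejer u * u ^ (1 - α) = 2 * ((1 - Real.cos u) * u ^ (-1 - α)) := fun u hu => by
    have := sq_mul_fejer u
    rw [← mul_assoc, ← this, show 1 - α = 2 + (-1 - α) by ring, Real.rpow_add hu, Real.rpow_two]
    ring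
  have h1 : ∫ u in Ioi (0 : ℝ), (1 - Real.cos u) * u ^ (-1 - α) =
      1 / (2 * (varianceConst α * (2 - α))) := by
    rw [integral_eq_lintegral_of_nonneg_ae, lintegral_one_sub_cos_mul_rpow hα,
      ENNReal.toReal_ofReal (by positivity)]
    · refine (ae_restrict_iff' measurableSet_Ioi).2 (ae_of_all _ fun u (hu : 0 < u) => ?_)
      exact mul_nonneg (by linarith [Real.cos_le_one u]) (by positivity)
    · exact (by fun_prop : Measurable _).aestronglyMeasurable
  have h2 : ∫ u, fejer u * |u| ^ (1 - α) = ∫ u, fejer |u| * |u| ^ (1 - α) := by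
    simp_rw [fejer_abs]
  rw [h2, integral_comp_abs (f := fun u => fejer u * u ^ (1 - α)),
    setIntegral_congr_fun measurableSet_Ioi fun u hu => h0 u hu, integral_const_mul, h1]
  field_simp

/-- Scaling gives a multiple of `|y| ^ α`; the constant in the density of `modelMeasure` is chosen
to make the factor `1`. -/
lemma fejerVariance_modelMeasure {α : ℝ} (hα : α ∈ Ioo (0 : ℝ) 2) (y : ℝ) :
    fejerVariance (modelMeasure α) y = |y| ^ α := by
  have hC := varianceConst_pos hα
  have hα2 : 0 < 2 - α := by linarith [hα.2]
  rcases eq_or_ne y 0 with rfl | hy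
  · simp [Real.zero_rpow hα.1.ne']
  have hy' : 0 < |y| := abs_pos.2 hy
  have h1 : ∫ u, y ^ 2 * fejer (y * u) * |u| ^ (1 - α) =
      |y| ^ (1 + α) * ∫ u, fejer (y * u) * |y * u| ^ (1 - α) := by
    rw [← integral_const_mul]
    refine integral_congr_ae (ae_of_all _ fun u => ?_)
    simp only
    rw [abs_mul, Real.mul_rpow (abs_nonneg _) (abs_nonneg _), ← sq_abs y, ← Real.rpow_two,
      show (2 : ℝ) = (1 + α) + (1 - α) by ring, Real.rpow_add hy']
    ring
  rw [fejerVariance, integral_modelMeasure hα, h1,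
    Measure.integral_comp_mul_left (fun u => fejer u * |u| ^ (1 - α)), integral_fejer_mul_rpow hα,
    smul_eq_mul, abs_inv, Real.rpow_add hy', Real.rpow_one]
  field_simp

lemma integrable_fejer_modelMeasure {α : ℝ} (hα : α ∈ Ioo (0 : ℝ) 2) (y : ℝ) :
    Integrable (fun t => y ^ 2 * fejer (y * t)) (modelMeasure α) := by
  rcases eq_or_ne y 0 with rfl | hy
  · simp
  refine integrable_of_integral_ne_zero ?_
  have := fejerVariance_modelMeasure hα y
  rw [fejerVariance] at this
  rw [this]
  exact (Real.rpow_pos_of_pos (abs_pos.2 hy) _).ne'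

lemma modelMeasure_Icc {α : ℝ} (hα : α ∈ Ioo (0 : ℝ) 2) {r : ℝ} (hr : 0 ≤ r) :
    modelMeasure α (Icc (-r) r) = ENNReal.ofReal (varianceConst α * r ^ (2 - α)) := by
  have hC := varianceConst_pos hα
  have hα2 : 0 < 2 - α := by linarith [hα.2]
  have h1 : IntervalIntegrable (fun u : ℝ => u ^ (1 - α)) volume 0 r :=
    intervalIntegral.intervalIntegrable_rpow' (by linarith)
  have h2 : IntervalIntegrable (fun u : ℝ => |u| ^ (1 - α)) volume 0 r :=
    h1.congr_uIoo fun u hu => by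
      rw [uIoo_of_le hr] at hu
      simp only
      rw [abs_of_pos hu.1]
  have h3 : IntervalIntegrable (fun u : ℝ => |u| ^ (1 - α)) volume (-r) 0 := by
    have := (IntervalIntegrable.iff_comp_neg).1 h2
    simpa using this.symm
  have h4 : ∫ u in (0 : ℝ)..r, |u| ^ (1 - α) = r ^ (2 - α) / (2 - α) := by
    rw [intervalIntegral.integral_congr (g := fun u => u ^ (1 - α)) fun u hu => by
      rw [uIcc_of_le hr] at hu
      simp only
      rw [abs_of_nonneg hu.1], integral_rpow (Or.inl (by linarith)),
      show 1 - α + 1 = 2 - α by ring, Real.zero_rpow hα2.ne', sub_zero]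
  have h5 : ∫ u in (-r)..0, |u| ^ (1 - α) = r ^ (2 - α) / (2 - α) := by
    have := intervalIntegral.integral_comp_neg (a := 0) (b := r) fun u : ℝ => |u| ^ (1 - α)
    simpa [h4] using this.symm
  have h6 := (h3.trans h2).const_mul (varianceConst α * (2 - α) / 2)
  rw [intervalIntegrable_iff_integrableOn_Icc_of_le (by linarith)] at h6
  rw [modelMeasure, withDensity_apply _ measurableSet_Icc,
    ← ofReal_integral_eq_lintegral_ofReal h6 (ae_of_all _ fun u => by positivity),
    integral_Icc_eq_integral_Ioc, ← intervalIntegral.integral_of_le (by linarith),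
    intervalIntegral.integral_const_mul, ← intervalIntegral.integral_add_adjacent_intervals h3 h2,
    h4, h5]
  congr 1
  field_simp
  ring

/-! ### Weak convergence with a continuous weight on a set with null boundary -/

/-- Multiplication by the bounded continuous density `w` preserves weak convergence, and the
portmanteau theorem applies to the normalized weighted measures. Positivity of `w` keeps the limit
nonzero, so that it can be normalized. -/
lemma tendsto_setIntegral_of_null_frontier {X ι : Type*} [TopologicalSpace X] [MeasurableSpace X]
    [BorelSpace X] [Nonempty X] [HasOuterApproxClosed X] {l : Filter ι} {P : ι → ProbabilityMeasure X}
    {ρ : ProbabilityMeasure X} (hP : Tendsto P l (𝓝 ρ)) (w : X →ᵇ ℝ) (hw : ∀ u, 0 < w u)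
    {E : Set X} (hE : MeasurableSet E) (hfr : (ρ : Measure X) (frontier E) = 0) :
    Tendsto (fun i => ∫ u in E, w u ∂(P i : Measure X)) l (𝓝 (∫ u in E, w u ∂(ρ : Measure X))) := by
  let d : X → ℝ≥0∞ := fun u => ENNReal.ofReal (w u)
  have hd : Measurable d := w.continuous.measurable.ennreal_ofReal
  let m : ProbabilityMeasure X → FiniteMeasure X := fun Q =>
    ⟨(Q : Measure X).withDensity d, isFiniteMeasure_withDensity_ofReal (w.integrable _).2⟩
  have hint : ∀ (Q : ProbabilityMeasure X) (f : X → ℝ),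
      ∫ u, f u ∂(m Q : Measure X) = ∫ u, w u * f u ∂(Q : Measure X) := fun Q f => by
    change ∫ u, f u ∂((Q : Measure X).withDensity d) = _
    rw [integral_withDensity_eq_integral_toReal_smul hd
      (ae_of_all _ fun _ => ENNReal.ofReal_lt_top)]
    refine integral_congr_ae (ae_of_all _ fun u => ?_)
    simp only [d, smul_eq_mul]
    rw [ENNReal.toReal_ofReal (hw u).le]
  have hm : Tendsto (fun i => m (P i)) l (𝓝 (m ρ)) := by
    rw [FiniteMeasure.tendsto_iff_forall_integral_tendsto]
    intro f
    simp_rw [hint]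
    exact (ProbabilityMeasure.tendsto_iff_forall_integral_tendsto.1 hP) (w * f)
  have hreal : ∀ Q : ProbabilityMeasure X,
      ∫ u in E, w u ∂(Q : Measure X) = ((m Q E : NNReal) : ℝ) := fun Q => by
    have h1 := hint Q (E.indicator 1)
    rw [integral_indicator_one hE] at h1
    change ∫ u in E, w u ∂(Q : Measure X) = (m Q : Measure X).real E
    rw [h1, ← integral_indicator hE]
    refine integral_congr_ae (ae_of_all _ fun u => ?_)
    by_cases hu : u ∈ E <;> simp [hu]
  have hne : m ρ ≠ 0 := by
    intro h0
    have h1 := hint ρ (fun _ => 1)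
    rw [h0] at h1
    simp only [FiniteMeasure.toMeasure_zero, integral_zero_measure, mul_one] at h1
    have h2 : 0 < ∫ u, w u ∂(ρ : Measure X) := by
      rw [integral_pos_iff_support_of_nonneg (fun u => (hw u).le) (w.integrable _)]
      have : Function.support w = univ := eq_univ_of_forall fun u => (hw u).ne'
      rw [this]
      simp
    linarith
  have hnorm := FiniteMeasure.tendsto_normalize_of_tendsto hm hne
  have hfr' : (m ρ).normalize (frontier E) = 0 := by
    rw [FiniteMeasure.normalize_eq_of_nonzero _ hne]
    have : (m ρ : Measure X) (frontier E) = 0 := withDensity_absolutelyContinuous _ _ hfr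
    rw [(FiniteMeasure.null_iff_toMeasure_null _ _).2 this, mul_zero]
  have h1 := ProbabilityMeasure.tendsto_measure_of_null_frontier_of_tendsto hnorm hfr'
  have h2 := hm.mass.mul h1
  simp_rw [hreal, FiniteMeasure.self_eq_mass_mul_normalize]
  exact (NNReal.continuous_coe.tendsto _).comp h2

/-! ### The law of the rescaled spectral parameter, weighted by the Fejér kernel -/

/-- The image under `t ↦ y t` of `y² fejer(y t) σ(dt)`, normalized. -/
noncomputable def fejerLaw (σ : Measure ℝ) (y : ℝ) : Measure ℝ :=
  (ENNReal.ofReal (fejerVariance σ y))⁻¹ •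
    (σ.withDensity fun t => ENNReal.ofReal (y ^ 2 * fejer (y * t))).map (fun t => y * t)

lemma integral_fejerLaw {σ : Measure ℝ} {y : ℝ} (hV : 0 < fejerVariance σ y) {f : ℝ → ℝ}
    (hf : Measurable f) :
    ∫ u, f u ∂(fejerLaw σ y) =
      (fejerVariance σ y)⁻¹ * ∫ t, f (y * t) * (y ^ 2 * fejer (y * t)) ∂σ := by
  rw [fejerLaw, integral_smul_measure, integral_map (by fun_prop) hf.aestronglyMeasurable,
    integral_withDensity_eq_integral_toReal_smul (by fun_prop)
      (ae_of_all _ fun _ => ENNReal.ofReal_lt_top), ENNReal.toReal_inv,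
    ENNReal.toReal_ofReal hV.le, smul_eq_mul]
  congr 1
  refine integral_congr_ae (ae_of_all _ fun t => ?_)
  have := fejer_nonneg (y * t)
  simp only [smul_eq_mul]
  rw [ENNReal.toReal_ofReal (by positivity), mul_comm]

lemma isProbabilityMeasure_fejerLaw {σ : Measure ℝ} {y : ℝ} (hV : 0 < fejerVariance σ y) :
    IsProbabilityMeasure (fejerLaw σ y) where
  measure_univ := by
    rw [fejerLaw, Measure.smul_apply, Measure.map_apply (by fun_prop) MeasurableSet.univ,
      preimage_univ, withDensity_apply _ MeasurableSet.univ, Measure.restrict_univ,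
      ← ofReal_integral_eq_lintegral_ofReal (integrable_of_integral_ne_zero hV.ne')
        (ae_of_all _ fun t => mul_nonneg (sq_nonneg _) (fejer_nonneg _)), smul_eq_mul]
    exact ENNReal.inv_mul_cancel (by simpa using hV) ENNReal.ofReal_ne_top

/-- The sine part vanishes by symmetry of `σ`; the cosine part is `integral_cos_mul_fejer`. -/
lemma charFun_fejerLaw {σ : Measure ℝ} (hσ : σ.map Neg.neg = σ)
    (hint : ∀ y, Integrable (fun t => y ^ 2 * fejer (y * t)) σ) {y : ℝ}
    (hV : 0 < fejerVariance σ y) (s : ℝ) :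
    charFun (fejerLaw σ y) s = (((1 / 2 * fejerVariance σ ((s + 1) * y) +
      1 / 2 * fejerVariance σ ((s - 1) * y) - fejerVariance σ (s * y)) / fejerVariance σ y : ℝ) : ℂ)
      := by
  have := isProbabilityMeasure_fejerLaw hV
  have hc : Integrable (fun u => Real.cos (s * u)) (fejerLaw σ y) :=
    Integrable.of_bound (by fun_prop : Continuous _).aestronglyMeasurable 1
      (ae_of_all _ fun u => Real.abs_cos_le_one _)
  have hs : Integrable (fun u => Real.sin (s * u)) (fejerLaw σ y) :=
    Integrable.of_bound (by fun_prop : Continuous _).aestronglyMeasurable 1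
      (ae_of_all _ fun u => Real.abs_sin_le_one _)
  have hodd : ∫ t, Real.sin (s * (y * t)) * (y ^ 2 * fejer (y * t)) ∂σ = 0 := by
    have h1 : ∫ t, Real.sin (s * (y * t)) * (y ^ 2 * fejer (y * t)) ∂σ =
        ∫ t, Real.sin (s * (y * -t)) * (y ^ 2 * fejer (y * -t)) ∂σ := by
      conv_lhs => rw [← hσ]
      exact integral_map measurable_neg.aemeasurable
        (by fun_prop : Continuous _).aestronglyMeasurable
    have h2 : ∀ t, Real.sin (s * (y * -t)) * (y ^ 2 * fejer (y * -t)) =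
        -(Real.sin (s * (y * t)) * (y ^ 2 * fejer (y * t))) := fun t => by
      rw [mul_neg, mul_neg, Real.sin_neg, fejer_neg]
      ring
    simp_rw [h2, integral_neg] at h1
    linarith
  have h1 : ∀ u : ℝ, Complex.exp (s * u * Complex.I) =
      (Real.cos (s * u) : ℂ) + (Real.sin (s * u) : ℂ) * Complex.I := fun u => by
    rw [Complex.exp_mul_I]
    push_cast
    rfl
  rw [charFun_apply_real]
  simp_rw [h1]
  rw [integral_add hc.ofReal (hs.ofReal.mul_const _), integral_mul_const, integral_complex_ofReal,
    integral_complex_ofReal, integral_fejerLaw hV (by fun_prop), integral_fejerLaw hV (by fun_prop),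
    hodd, integral_cos_mul_fejer σ hint]
  simp only [mul_zero, Complex.ofReal_zero, zero_mul, add_zero]
  congr 1
  ring

/-- A bounded weight that agrees with `1 / fejer` on `[-1, 1]`. -/
noncomputable def fejerWeight : ℝ →ᵇ ℝ :=
  BoundedContinuousFunction.ofNormedAddCommGroup
    (fun u => (max (fejer u) (4 / Real.pi ^ 2))⁻¹)
    ((by fun_prop : Continuous fun u => max (fejer u) (4 / Real.pi ^ 2)).inv₀ fun u =>
      (lt_max_of_lt_right (by positivity)).ne') (4 / Real.pi ^ 2)⁻¹ fun u => by
    have h : 0 < 4 / Real.pi ^ 2 := by positivity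
    rw [norm_inv, Real.norm_of_nonneg (h.le.trans (le_max_right _ _))]
    exact inv_anti₀ h (le_max_right _ _)

lemma fejerWeight_apply (u : ℝ) : fejerWeight u = (max (fejer u) (4 / Real.pi ^ 2))⁻¹ := rfl

lemma fejerWeight_pos (u : ℝ) : 0 < fejerWeight u := by
  rw [fejerWeight_apply]
  exact inv_pos.2 (lt_max_of_lt_right (by positivity))

/-- By Jordan's inequality the truncation at `4 / π²` is inactive on all of `[-π, π]`. The Tauberian
half needs this only on `[-1, 1]`, the folding of the circle on the whole interval. -/
lemma fejerWeight_mul_fejer {u : ℝ} (hu : |u| ≤ Real.pi) : fejerWeight u * fejer u = 1 := by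
  have h1 := four_div_pi_sq_le_fejer hu
  have h2 : 0 < 4 / Real.pi ^ 2 := by positivity
  rw [fejerWeight_apply, max_eq_left h1]
  exact inv_mul_cancel₀ (h2.trans_le h1).ne'

/-- The weight cancels `fejer` on `[-1, 1]`, which recovers the unweighted mass of `σ` near `0` from
the law. -/
lemma setIntegral_fejerWeight {σ : Measure ℝ} {y : ℝ} (hy : 0 < y) (hV : 0 < fejerVariance σ y) :
    ∫ u in Icc (-1) 1, fejerWeight u ∂(fejerLaw σ y) =
      y ^ 2 * σ.real (Icc (-y⁻¹) y⁻¹) / fejerVariance σ y := by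
  have hreal : σ.real (Icc (-y⁻¹) y⁻¹) = ∫ t, (Icc (-y⁻¹) y⁻¹).indicator 1 t ∂σ :=
    (integral_indicator_one measurableSet_Icc).symm
  rw [← integral_indicator measurableSet_Icc, integral_fejerLaw hV
    (fejerWeight.continuous.measurable.indicator measurableSet_Icc), div_eq_inv_mul,
    hreal, ← integral_const_mul (y ^ 2)]
  congr 1
  refine integral_congr_ae (ae_of_all _ fun t => ?_)
  have hiff : y * t ∈ Icc (-1) 1 ↔ t ∈ Icc (-y⁻¹) y⁻¹ := by
    rw [mem_Icc, mem_Icc, ← abs_le, ← abs_le, abs_mul, abs_of_pos hy, ← one_div, le_div_iff₀' hy]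
  by_cases ht : t ∈ Icc (-y⁻¹) y⁻¹
  · have h1 := hiff.2 ht
    simp only [indicator_of_mem h1, indicator_of_mem ht, Pi.one_apply]
    rw [mul_left_comm, fejerWeight_mul_fejer ((abs_le.2 h1).trans (by linarith [Real.pi_gt_three]))]
  · simp only [indicator_of_notMem (mt hiff.1 ht), indicator_of_notMem ht]
    simp

lemma modelMeasure_map_neg (α : ℝ) : (modelMeasure α).map Neg.neg = modelMeasure α := by
  ext s hs
  rw [Measure.map_apply measurable_neg hs, modelMeasure, withDensity_apply _ (measurable_neg hs),
    withDensity_apply _ hs, ← (Measure.measurePreserving_neg (volume : Measure ℝ)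
      ).setLIntegral_comp_preimage hs (by fun_prop)]
  simp

instance (α : ℝ) : NullSingletonClass (modelMeasure α) :=
  ⟨fun x => withDensity_absolutelyContinuous _ _ (measure_singleton x)⟩

lemma fejerLaw_singleton {σ : Measure ℝ} [NullSingletonClass σ] {y : ℝ} (hy : y ≠ 0) (a : ℝ) :
    fejerLaw σ y {a} = 0 := by
  rw [fejerLaw, Measure.smul_apply, Measure.map_apply (by fun_prop) (measurableSet_singleton a)]
  have h1 : (fun t => y * t) ⁻¹' {a} = {a / y} := by
    ext t
    simp [eq_div_iff hy, mul_comm]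
  rw [h1, withDensity_absolutelyContinuous _ _ (measure_singleton (a / y)), smul_zero]

/-- The Tauberian half: asymptotics of the variances yield asymptotics of the measure at `0`. -/
theorem tendsto_measure_of_tendsto_fejerVariance {σ : Measure ℝ} [IsFiniteMeasure σ]
    (hσ : σ.map Neg.neg = σ) {α : ℝ} (hα : α ∈ Ioo (0 : ℝ) 2) {h : ℝ → ℝ}
    (hh : IsSlowlyVarying h)
    (hv : Tendsto (fun y => fejerVariance σ y / (y ^ α * h y)) atTop (𝓝 1)) :
    Tendsto (fun y => σ.real (Icc (-y⁻¹) y⁻¹) / (y ^ (α - 2) * h y)) atTop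
      (𝓝 (varianceConst α)) := by
  have hVpos : ∀ᶠ y in atTop, 0 < fejerVariance σ y := by
    filter_upwards [hv.eventually_const_lt one_pos, eventually_gt_atTop 0] with y h1 h2
    have : 0 < y ^ α * h y := mul_pos (by positivity) (hh.pos y h2)
    exact (div_pos_iff_of_pos_right this).1 h1
  have hratio : ∀ s : ℝ,
      Tendsto (fun y => fejerVariance σ (s * y) / fejerVariance σ y) atTop (𝓝 (|s| ^ α)) := by
    intro s
    rcases eq_or_ne s 0 with rfl | hs
    · simp [Real.zero_rpow hα.1.ne']
    have hs' : 0 < |s| := abs_pos.2 hs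
    have h1 := (hv.comp (tendsto_id.const_mul_atTop hs')).mul
      ((hh.tendsto_div _ hs').const_mul (|s| ^ α))
    have h2 := h1.mul (hv.inv₀ one_ne_zero)
    simp only [mul_one, inv_one, one_mul] at h2
    refine h2.congr' ?_
    filter_upwards [hVpos, eventually_gt_atTop 0] with y hy hy0
    have h3 := hh.pos y hy0
    have h4 := hh.pos (|s| * y) (by positivity)
    have h5 : 0 < y ^ α := by positivity
    have h6 : 0 < |s| ^ α := by positivity
    have h7 : fejerVariance σ (|s| * y) = fejerVariance σ (s * y) := by
      rw [← fejerVariance_abs σ (s * y), abs_mul, abs_of_pos hy0]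
    simp only [Function.comp_apply, id_eq]
    rw [h7, Real.mul_rpow hs'.le hy0.le]
    generalize h (|s| * y) = H at *
    field_simp
  have hV1 : fejerVariance (modelMeasure α) 1 = 1 := by
    rw [fejerVariance_modelMeasure hα]; simp
  have hV1pos : 0 < fejerVariance (modelMeasure α) 1 := by rw [hV1]; exact one_pos
  let ρ : ProbabilityMeasure ℝ :=
    ⟨fejerLaw (modelMeasure α) 1, isProbabilityMeasure_fejerLaw hV1pos⟩
  have hmain : Tendsto (fun y => y ^ 2 * σ.real (Icc (-y⁻¹) y⁻¹) / fejerVariance σ y) atTop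
      (𝓝 (varianceConst α)) := by
    refine tendsto_of_seq_tendsto fun x hx => ?_
    classical
    let P : ℕ → ProbabilityMeasure ℝ := fun n =>
      if hn : 0 < fejerVariance σ (x n) then ⟨fejerLaw σ (x n), isProbabilityMeasure_fejerLaw hn⟩
      else ρ
    have hPeq : ∀ᶠ n in atTop, 0 < fejerVariance σ (x n) ∧ 0 < x n ∧
        (P n : Measure ℝ) = fejerLaw σ (x n) := by
      filter_upwards [hx.eventually hVpos, hx.eventually (eventually_gt_atTop 0)] with n hn hn0
      refine ⟨hn, hn0, ?_⟩
      have : P n = ⟨fejerLaw σ (x n), isProbabilityMeasure_fejerLaw hn⟩ := dif_pos hn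
      rw [this]
      rfl
    have hP : Tendsto P atTop (𝓝 ρ) := by
      -- Lévy's continuity theorem: the limit of the characteristic functions is that of the model
      -- law `ρ`.
      refine ProbabilityMeasure.tendsto_of_tendsto_charFun fun s => ?_
      have h1 : charFun (ρ : Measure ℝ) s =
          ((1 / 2 * |s + 1| ^ α + 1 / 2 * |s - 1| ^ α - |s| ^ α : ℝ) : ℂ) := by
        change charFun (fejerLaw (modelMeasure α) 1) s = _
        rw [charFun_fejerLaw (modelMeasure_map_neg α) (integrable_fejer_modelMeasure hα) hV1pos]
        simp only [fejerVariance_modelMeasure hα, mul_one, abs_one, Real.one_rpow, div_one]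
      rw [h1]
      have h2 := ((((hratio (s + 1)).const_mul (1 / 2)).add
        ((hratio (s - 1)).const_mul (1 / 2))).sub (hratio s)).comp hx
      refine ((Complex.continuous_ofReal.tendsto _).comp h2).congr' ?_
      filter_upwards [hPeq] with n ⟨hn, _, hPn⟩
      rw [hPn, charFun_fejerLaw hσ (integrable_fejer σ) hn]
      simp only [Function.comp_apply]
      congr 1
      ring
    have hfr : (ρ : Measure ℝ) (frontier (Icc (-1 : ℝ) 1)) = 0 := by
      rw [frontier_Icc (by norm_num), ← union_singleton]
      exact measure_union_null (fejerLaw_singleton one_ne_zero _) (fejerLaw_singleton one_ne_zero _)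
    have h3 := tendsto_setIntegral_of_null_frontier hP fejerWeight fejerWeight_pos
      measurableSet_Icc hfr
    have h4 : ∫ u in Icc (-1) 1, fejerWeight u ∂(ρ : Measure ℝ) = varianceConst α := by
      change ∫ u in Icc (-1) 1, fejerWeight u ∂(fejerLaw (modelMeasure α) 1) = _
      rw [setIntegral_fejerWeight one_pos hV1pos, hV1, inv_one, measureReal_def,
        modelMeasure_Icc hα zero_le_one, ENNReal.toReal_ofReal (by
          have := varianceConst_pos hα
          positivity)]
      simp
    rw [h4] at h3
    refine h3.congr' ?_
    filter_upwards [hPeq] with n ⟨hn, hn0, hPn⟩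
    rw [hPn, setIntegral_fejerWeight hn0 hn]
    rfl
  have h5 := hmain.mul hv
  rw [mul_one] at h5
  refine h5.congr' ?_
  filter_upwards [hVpos, eventually_gt_atTop 0] with y hy hy0
  have h6 := hh.pos y hy0
  have h7 : 0 < y ^ (α - 2) := by positivity
  have h8 : y ^ α = y ^ 2 * y ^ (α - 2) := by
    rw [← Real.rpow_two, ← Real.rpow_add hy0]
    congr 1
    ring
  rw [h8]
  field_simp

/-! ### Weak convergence from convergence of distribution functions -/

/-- The intervals `(a, b]` with nonzero endpoints form a π-system containing small neighbourhoods of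
every point, so convergence on them gives weak convergence after normalization. The endpoint `0` is
left out because in the application the asymptotics at `r` are available only for `r > 0`, and
trivial for `r < 0`. -/
lemma tendsto_integral_of_tendsto_Iic {ι : Type*} {l : Filter ι} [l.IsCountablyGenerated]
    {m : ι → Measure ℝ} [∀ i, IsFiniteMeasure (m i)] {m₀ : Measure ℝ} [IsFiniteMeasure m₀]
    (hne : m₀ ≠ 0) (huniv : Tendsto (fun i => (m i).real univ) l (𝓝 (m₀.real univ)))
    (hIic : ∀ r ≠ 0, Tendsto (fun i => (m i).real (Iic r)) l (𝓝 (m₀.real (Iic r))))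
    (f : ℝ →ᵇ ℝ) : Tendsto (fun i => ∫ u, f u ∂(m i)) l (𝓝 (∫ u, f u ∂m₀)) := by
  let M : ι → FiniteMeasure ℝ := fun i => ⟨m i, inferInstance⟩
  let M₀ : FiniteMeasure ℝ := ⟨m₀, inferInstance⟩
  have hM₀ : M₀ ≠ 0 := fun h => hne (congrArg Subtype.val h)
  have hmass : Tendsto (fun i => (M i).mass) l (𝓝 M₀.mass) := NNReal.tendsto_coe.1 huniv
  have hmass0 : M₀.mass ≠ 0 := (FiniteMeasure.mass_nonzero_iff _).2 hM₀
  have hIoc : ∀ a b, a ≠ 0 → b ≠ 0 → a < b →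
      Tendsto (fun i => M i (Ioc a b)) l (𝓝 (M₀ (Ioc a b))) := by
    intro a b ha hb hab
    refine NNReal.tendsto_coe.1 ?_
    have hd : ∀ (q : Measure ℝ) [IsFiniteMeasure q],
        q.real (Ioc a b) = q.real (Iic b) - q.real (Iic a) := fun q _ => by
      rw [← measureReal_sdiff (Iic_subset_Iic.2 hab.le) measurableSet_Iic, Iic_sdiff_Iic]
    change Tendsto (fun i => (m i).real (Ioc a b)) l (𝓝 (m₀.real (Ioc a b)))
    simp_rw [hd]
    exact (hIic b hb).sub (hIic a ha)
  have hweak : Tendsto (fun i => (M i).normalize) l (𝓝 M₀.normalize) := by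
    refine (isPiSystem_Ioc_mem {0}ᶜ {0}ᶜ).tendsto_probabilityMeasure_of_tendsto_of_mem ?_ ?_ ?_
    · rintro s ⟨a, _, b, _, _, rfl⟩
      exact measurableSet_Ioc
    · intro u hu x hx
      obtain ⟨ε, hε, hball⟩ := Metric.isOpen_iff.1 hu x hx
      rw [Real.ball_eq_Ioo] at hball
      obtain ⟨a, ha, ha0⟩ : ∃ a ∈ Ioo (x - ε) x, a ≠ 0 := by
        obtain ⟨a, ha⟩ := ((Ioo_infinite (by linarith : x - ε < x)).sdiff
          (finite_singleton (0 : ℝ))).nonempty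
        exact ⟨a, ha.1, ha.2⟩
      obtain ⟨b, hb, hb0⟩ : ∃ b ∈ Ioo x (x + ε), b ≠ 0 := by
        obtain ⟨b, hb⟩ := ((Ioo_infinite (by linarith : x < x + ε)).sdiff
          (finite_singleton (0 : ℝ))).nonempty
        exact ⟨b, hb.1, hb.2⟩
      exact ⟨Ioc a b, ⟨a, ha0, b, hb0, ha.2.trans hb.1, rfl⟩, Ioc_mem_nhds ha.2 hb.1,
        fun t ht => hball ⟨ha.1.trans ht.1, ht.2.trans_lt hb.2⟩⟩
    · rintro s ⟨a, ha, b, hb, hab, rfl⟩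
      rw [FiniteMeasure.normalize_eq_of_nonzero _ hM₀]
      refine ((hmass.inv₀ hmass0).mul (hIoc a b ha hb hab)).congr' ?_
      filter_upwards [hmass.eventually_ne hmass0] with i hi
      rw [FiniteMeasure.normalize_eq_of_nonzero _ ((FiniteMeasure.mass_nonzero_iff _).1 hi)]
  exact (FiniteMeasure.tendsto_iff_forall_integral_tendsto.1
    ((FiniteMeasure.tendsto_normalize_iff_tendsto hM₀).1 ⟨hweak, hmass⟩)) f

/-! ### Abelian half -/

lemma setOf_abs_mul_le {y : ℝ} (hy : 0 < y) (r : ℝ) :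
    {t : ℝ | |y * t| ≤ r} = Icc (-(r / y)) (r / y) := by
  ext t
  rw [mem_ofPred_eq, mem_Icc, ← abs_le, abs_mul, abs_of_pos hy, le_div_iff₀' hy]

section Abelian

variable {σ : Measure ℝ} {α : ℝ} {h : ℝ → ℝ}

lemma tendsto_measure_abs_mul_le (hh : IsSlowlyVarying h)
    (hT : Tendsto (fun y => σ.real (Icc (-y⁻¹) y⁻¹) / (y ^ (α - 2) * h y)) atTop
      (𝓝 (varianceConst α))) {r : ℝ} (hr : 0 < r) :
    Tendsto (fun y => σ.real {t | |y * t| ≤ r} / (y ^ (α - 2) * h y)) atTop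
      (𝓝 (varianceConst α * r ^ (2 - α))) := by
  have h1 := (hT.comp (tendsto_id.const_mul_atTop (inv_pos.2 hr))).mul
    ((hh.tendsto_div _ (inv_pos.2 hr)).mul_const (r ^ (2 - α)))
  rw [one_mul] at h1
  refine h1.congr' ?_
  filter_upwards [eventually_gt_atTop 0] with y hy
  have h3 := hh.pos y hy
  have h4 := hh.pos (r⁻¹ * y) (by positivity)
  simp only [Function.comp_apply, id_eq]
  rw [setOf_abs_mul_le hy, mul_inv, inv_inv, ← div_eq_mul_inv,
    Real.mul_rpow (by positivity) hy.le, Real.inv_rpow hr.le, ← Real.rpow_neg hr.le, neg_sub]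
  generalize h (r⁻¹ * y) = H at *
  have h5 : 0 < r ^ (2 - α) := by positivity
  have h6 : 0 < y ^ (α - 2) := by positivity
  field_simp

/-- The part of the image of `σ` under `t ↦ |y t|` in `[0, K]`. -/
noncomputable def foldedMeasure (σ : Measure ℝ) (y K : ℝ) : Measure ℝ :=
  (σ.restrict {t | |y * t| ≤ K}).map fun t => |y * t|

lemma measurableSet_abs_mul_le (y K : ℝ) : MeasurableSet {t : ℝ | |y * t| ≤ K} :=
  measurableSet_le (by fun_prop) measurable_const

lemma foldedMeasure_real_Iic (σ : Measure ℝ) (y K r : ℝ) :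
    (foldedMeasure σ y K).real (Iic r) = σ.real {t | |y * t| ≤ min r K} := by
  rw [measureReal_def, foldedMeasure, Measure.map_apply (by fun_prop) measurableSet_Iic,
    Measure.restrict_apply ((by fun_prop : Measurable fun t : ℝ => |y * t|) measurableSet_Iic),
    measureReal_def]
  congr 2
  ext t
  simp

lemma foldedMeasure_real_univ (σ : Measure ℝ) (y K : ℝ) :
    (foldedMeasure σ y K).real univ = σ.real {t | |y * t| ≤ K} := by
  rw [measureReal_def, foldedMeasure, Measure.map_apply (by fun_prop) MeasurableSet.univ]
  simp [measureReal_def]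

lemma integral_foldedMeasure (σ : Measure ℝ) (y K : ℝ) :
    ∫ u, fejer u ∂(foldedMeasure σ y K) = ∫ t in {t | |y * t| ≤ K}, fejer (y * t) ∂σ := by
  rw [foldedMeasure, integral_map (by fun_prop) (by fun_prop : Continuous _).aestronglyMeasurable]
  simp_rw [fejer_abs]

lemma modelMeasure_real_abs_le (hα : α ∈ Ioo (0 : ℝ) 2) {r : ℝ} (hr : 0 ≤ r) :
    (modelMeasure α).real {t | |1 * t| ≤ r} = varianceConst α * r ^ (2 - α) := by
  have := varianceConst_pos hα
  rw [setOf_abs_mul_le one_pos, div_one, measureReal_def, modelMeasure_Icc hα hr,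
    ENNReal.toReal_ofReal (by positivity)]

/-- `fejer` as a bounded continuous function. -/
noncomputable def fejerBounded : ℝ →ᵇ ℝ :=
  BoundedContinuousFunction.ofNormedAddCommGroup fejer continuous_fejer 1 fun u => by
    rw [Real.norm_of_nonneg (fejer_nonneg u)]
    exact fejer_le_one u

variable [IsFiniteMeasure σ]

/-- The distribution functions of the images of `σ` under `t ↦ |y t|` converge after division by `y
^ (α - 2) h y`. Absolute values are taken because the hypothesis sees only symmetric intervals, and
they are harmless as `fejer` is even; the cut at `K` keeps the limit measure finite. -/
lemma tendsto_setIntegral_fejer (hα : α ∈ Ioo (0 : ℝ) 2) (hh : IsSlowlyVarying h)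
    (hT : Tendsto (fun y => σ.real (Icc (-y⁻¹) y⁻¹) / (y ^ (α - 2) * h y)) atTop
      (𝓝 (varianceConst α))) {K : ℝ} (hK : 0 < K) :
    Tendsto (fun y => (∫ t in {t | |y * t| ≤ K}, fejer (y * t) ∂σ) / (y ^ (α - 2) * h y)) atTop
      (𝓝 (∫ u in Icc (-K) K, fejer u ∂(modelMeasure α))) := by
  have hC := varianceConst_pos hα
  have hW : IsFiniteMeasure (foldedMeasure (modelMeasure α) 1 K) := by
    have : IsFiniteMeasure ((modelMeasure α).restrict {t | |1 * t| ≤ K}) := by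
      refine isFiniteMeasure_restrict.2 ?_
      rw [setOf_abs_mul_le one_pos, div_one, modelMeasure_Icc hα hK.le]
      exact ENNReal.ofReal_ne_top
    unfold foldedMeasure
    infer_instance
  have hfin : ∀ y, IsFiniteMeasure (foldedMeasure σ y K) := fun y => by
    unfold foldedMeasure
    infer_instance
  let m : ℝ → Measure ℝ := fun y =>
    ENNReal.ofReal (y ^ (α - 2) * h y)⁻¹ • foldedMeasure σ y K
  have hm : ∀ y, IsFiniteMeasure (m y) := fun y =>
    Measure.smul_finite _ ENNReal.ofReal_ne_top
  have hN : ∀ y, 0 < y → 0 < y ^ (α - 2) * h y := fun y hy => mul_pos (by positivity) (hh.pos y hy)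
  have hmreal : ∀ y, 0 < y → ∀ s, (m y).real s = (foldedMeasure σ y K).real s /
      (y ^ (α - 2) * h y) := fun y hy s => by
    rw [measureReal_ennreal_smul_apply, ENNReal.toReal_ofReal (inv_pos.2 (hN y hy)).le,
      div_eq_inv_mul]
  have huniv : Tendsto (fun y => (m y).real univ) atTop
      (𝓝 ((foldedMeasure (modelMeasure α) 1 K).real univ)) := by
    rw [foldedMeasure_real_univ, modelMeasure_real_abs_le hα hK.le]
    refine (tendsto_measure_abs_mul_le hh hT hK).congr' ?_
    filter_upwards [eventually_gt_atTop 0] with y hy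
    rw [hmreal y hy, foldedMeasure_real_univ]
  have hIic : ∀ r ≠ 0, Tendsto (fun y => (m y).real (Iic r)) atTop
      (𝓝 ((foldedMeasure (modelMeasure α) 1 K).real (Iic r))) := by
    intro r hr
    rw [foldedMeasure_real_Iic]
    rcases hr.lt_or_gt with hr | hr
    · have hempty : ∀ y : ℝ, {t : ℝ | |y * t| ≤ min r K} = ∅ := fun y =>
        eq_empty_of_forall_notMem fun t (ht : |y * t| ≤ min r K) => by
          have := (abs_nonneg _).trans (ht.trans (min_le_left _ _))
          linarith
      rw [hempty, measureReal_empty]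
      refine tendsto_const_nhds.congr' ?_
      filter_upwards [eventually_gt_atTop 0] with y hy
      rw [hmreal y hy, foldedMeasure_real_Iic, hempty, measureReal_empty, zero_div]
    · have hmin : 0 < min r K := lt_min hr hK
      rw [modelMeasure_real_abs_le hα hmin.le]
      refine (tendsto_measure_abs_mul_le hh hT hmin).congr' ?_
      filter_upwards [eventually_gt_atTop 0] with y hy
      rw [hmreal y hy, foldedMeasure_real_Iic]
  have hne : foldedMeasure (modelMeasure α) 1 K ≠ 0 := by
    intro h0
    have h1 := foldedMeasure_real_univ (modelMeasure α) 1 K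
    rw [h0, modelMeasure_real_abs_le hα hK.le] at h1
    have : 0 < varianceConst α * K ^ (2 - α) := by positivity
    simp at h1
    rcases h1 with h1 | h1
    · exact hC.ne' h1
    · exact (Real.rpow_pos_of_pos hK _).ne' h1
  have key := tendsto_integral_of_tendsto_Iic hne huniv hIic fejerBounded
  change Tendsto (fun y => ∫ u, fejer u ∂(m y)) atTop
    (𝓝 (∫ u, fejer u ∂(foldedMeasure (modelMeasure α) 1 K))) at key
  rw [integral_foldedMeasure, setOf_abs_mul_le one_pos, div_one] at key
  simp_rw [one_mul] at key
  refine key.congr' ?_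
  filter_upwards [eventually_gt_atTop 0] with y hy
  rw [integral_smul_measure, integral_foldedMeasure, smul_eq_mul,
    ENNReal.toReal_ofReal (inv_pos.2 (hN y hy)).le, div_eq_inv_mul]

/-- For `v` beyond a threshold, the Potter bound with exponent `α / 2` replaces `h v` by `h y`.
Below the threshold the total mass suffices, since `y ^ (α / 2) h y ≥ 1` eventually. The remaining
power of `v` is what makes the tail integral in `setIntegral_fejer_tail_le` converge. -/
lemma exists_measure_Icc_le (hα : α ∈ Ioo (0 : ℝ) 2) (hh : IsSlowlyVarying h)
    (hT : Tendsto (fun y => σ.real (Icc (-y⁻¹) y⁻¹) / (y ^ (α - 2) * h y)) atTop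
      (𝓝 (varianceConst α))) :
    ∃ M > 0, ∀ᶠ y in atTop, ∀ v, 0 < v → v ≤ y →
      σ.real (Icc (-v⁻¹) v⁻¹) ≤ M * (y ^ (α / 2) * h y) * v ^ (α / 2 - 2) := by
  have hC := varianceConst_pos hα
  obtain ⟨X₁, hX₁, hpot⟩ := hh.exists_rpow_mul_le (half_pos hα.1)
  obtain ⟨X₂, hX₂⟩ := eventually_atTop.1
    (hT.eventually_le_const (by linarith : varianceConst α < 2 * varianceConst α))
  set X := max X₁ X₂
  have hX : 0 < X := hX₁.trans_le (le_max_left _ _)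
  set M₁ := σ.real univ * X ^ (2 - α / 2)
  have hM₁ : 0 ≤ M₁ := by positivity
  refine ⟨M₁ + 4 * varianceConst α, by positivity, ?_⟩
  filter_upwards [(hh.tendsto_rpow_mul_atTop (half_pos hα.1)).eventually_ge_atTop 1,
    eventually_ge_atTop X] with y hy hyX v hv hvy
  have hvpow : 0 < v ^ (α / 2 - 2) := by positivity
  rcases le_total v X with hvX | hvX
  · calc σ.real (Icc (-v⁻¹) v⁻¹) ≤ σ.real univ := measureReal_mono (subset_univ _)
      _ = σ.real univ * (v ^ (2 - α / 2) * v ^ (α / 2 - 2)) := by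
        rw [← Real.rpow_add hv]; simp
      _ ≤ σ.real univ * (X ^ (2 - α / 2) * v ^ (α / 2 - 2)) := by
        gcongr
        linarith [hα.2]
      _ = M₁ * 1 * v ^ (α / 2 - 2) := by ring
      _ ≤ _ := by
        gcongr
        linarith
  · have h1 := hX₂ v ((le_max_right _ _).trans hvX)
    have h2 := hpot v ((le_max_left _ _).trans hvX) y hvy
    have h3 := hh.pos v hv
    rw [div_le_iff₀ (by positivity)] at h1
    calc σ.real (Icc (-v⁻¹) v⁻¹) ≤ 2 * varianceConst α * (v ^ (α - 2) * h v) := h1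
      _ = 2 * varianceConst α * (v ^ (α / 2) * h v) * v ^ (α / 2 - 2) := by
        rw [show α - 2 = α / 2 + (α / 2 - 2) by ring, Real.rpow_add hv]
        ring
      _ ≤ 2 * varianceConst α * (2 * (y ^ (α / 2) * h y)) * v ^ (α / 2 - 2) := by gcongr
      _ = (4 * varianceConst α) * (y ^ (α / 2) * h y) * v ^ (α / 2 - 2) := by ring
      _ ≤ _ := by
        gcongr
        linarith

/-- Bound `fejer (y t)` by `4 / (y t)²` and apply the layer-cake formula to `1 / t²`, which is at
most `(y / K)²` on the tail. Its superlevel set at `s` lies in `[-1/√s, 1/√s]`, so `hb` with `v = √s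
≤ y` leaves the integral of `s ^ (α / 4 - 1)`, convergent at `0`. -/
lemma setIntegral_fejer_tail_le {A y K : ℝ} (hα : α ∈ Ioo (0 : ℝ) 2) (hy : 0 < y) (hK : 1 ≤ K)
    (hb : ∀ v, 0 < v → v ≤ y → σ.real (Icc (-v⁻¹) v⁻¹) ≤ A * v ^ (α / 2 - 2)) :
    ∫ t in {t | |y * t| ≤ K}ᶜ, fejer (y * t) ∂σ ≤
      4 / y ^ 2 * (A * (4 / α * (y / K) ^ (α / 2))) := by
  have hK0 : 0 < K := by linarith
  have hα0 := hα.1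
  set E : Set ℝ := {t | |y * t| ≤ K}ᶜ with hE
  have hEm : MeasurableSet E := (measurableSet_abs_mul_le y K).compl
  set B := (y / K) ^ 2 with hB
  have hB0 : 0 < B := by positivity
  let f : ℝ → ℝ := E.indicator fun t => (t ^ 2)⁻¹
  have hf0 : ∀ t, 0 ≤ f t := fun t => indicator_nonneg (fun t _ => by positivity) t
  have hsq : ∀ t ∈ E, B⁻¹ ≤ t ^ 2 := fun t ht => by
    have h1 : K < y * |t| := by
      have := not_le.1 (show ¬ |y * t| ≤ K from ht)
      rwa [abs_mul, abs_of_pos hy] at this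
    have h2 : K / y ≤ |t| := ((div_lt_iff₀' hy).2 h1).le
    rw [hB, ← inv_pow, inv_div, ← sq_abs t]
    exact pow_le_pow_left₀ (by positivity) h2 2
  have hfB : ∀ t, f t ≤ B := fun t => by
    refine indicator_le' (fun t ht => ?_) (fun _ _ => hB0.le) t
    exact inv_le_of_inv_le₀ hB0 (hsq t ht)
  have hfm : Measurable f := Measurable.indicator (by fun_prop) hEm
  have hfi : Integrable f σ := Integrable.of_bound hfm.aestronglyMeasurable B
    (ae_of_all _ fun t => by rw [Real.norm_of_nonneg (hf0 t)]; exact hfB t)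
  have h1 : ∫ t in E, fejer (y * t) ∂σ ≤ 4 / y ^ 2 * ∫ t, f t ∂σ := by
    rw [← integral_indicator hEm, ← integral_const_mul]
    refine integral_mono ?_ (hfi.const_mul _) fun t => ?_
    · refine Integrable.indicator (Integrable.of_bound (by fun_prop : Continuous _
        ).aestronglyMeasurable 1 (ae_of_all _ fun t => ?_)) hEm
      rw [Real.norm_of_nonneg (fejer_nonneg _)]
      exact fejer_le_one _
    · by_cases ht : t ∈ E
      · simp only [f, indicator_of_mem ht]
        have ht0 : y * t ≠ 0 := by
          intro h0
          refine ht ?_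
          rw [mem_ofPred_eq, h0, abs_zero]
          exact hK0.le
        refine (fejer_le_four_div_sq _ ht0).trans_eq ?_
        rw [mul_pow, div_mul_eq_div_div, div_eq_mul_inv _ (t ^ 2)]
      · simp [f, indicator_of_notMem ht]
  have hint : IntegrableOn (fun s : ℝ => A * s ^ (α / 4 - 1)) (Ioc 0 B) := by
    rw [← intervalIntegrable_iff_integrableOn_Ioc_of_le hB0.le]
    exact (intervalIntegral.intervalIntegrable_rpow' (by linarith)).const_mul _
  have h2 : ∫ t, f t ∂σ ≤ A * (4 / α * (y / K) ^ (α / 2)) := by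
    rw [hfi.integral_eq_integral_Ioc_meas_le (ae_of_all _ hf0) (ae_of_all _ hfB)]
    calc ∫ s in Ioc 0 B, σ.real {t | s ≤ f t} ≤ ∫ s in Ioc 0 B, A * s ^ (α / 4 - 1) := by
          refine integral_mono_of_nonneg (ae_of_all _ fun _ => measureReal_nonneg) hint ?_
          refine (ae_restrict_iff' measurableSet_Ioc).2 (ae_of_all _ fun s hs => ?_)
          have hs0 : 0 < √s := Real.sqrt_pos.2 hs.1
          have hsy : √s ≤ y := by
            rw [Real.sqrt_le_left hy.le]
            refine hs.2.trans (pow_le_pow_left₀ (by positivity) ?_ 2)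
            exact div_le_self hy.le hK
          have hsub : {t | s ≤ f t} ⊆ Icc (-(√s)⁻¹) (√s)⁻¹ := fun t ht => by
            rw [mem_Icc, ← abs_le]
            have htE : t ∈ E := by
              by_contra hnot
              have : s ≤ f t := ht
              simp only [f, indicator_of_notMem hnot] at this
              linarith [hs.1]
            have h3 : s ≤ (t ^ 2)⁻¹ := by
              have : s ≤ f t := ht
              simpa only [f, indicator_of_mem htE] using this
            have ht2 : 0 < t ^ 2 := (inv_pos.2 hB0).trans_le (hsq t htE)
            rw [← Real.sqrt_inv, ← Real.sqrt_sq_eq_abs]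
            exact Real.sqrt_le_sqrt (le_inv_of_le_inv₀ hs.1 h3)
          refine (measureReal_mono hsub).trans ((hb _ hs0 hsy).trans_eq ?_)
          rw [Real.sqrt_eq_rpow, ← Real.rpow_mul hs.1.le]
          congr 2
          ring
      _ = A * (4 / α * (y / K) ^ (α / 2)) := by
          rw [integral_const_mul, ← intervalIntegral.integral_of_le hB0.le,
            integral_rpow (Or.inl (by linarith)), sub_add_cancel,
            Real.zero_rpow (by positivity), hB, ← Real.rpow_two, ← Real.rpow_mul (by positivity),
            show 2 * (α / 4) = α / 2 by ring]
          field_simp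
          ring
  exact h1.trans (mul_le_mul_of_nonneg_left h2 (by positivity))

/-- The Abelian half: asymptotics of the measure at `0` yield asymptotics of the variances. -/
theorem tendsto_fejerVariance_of_tendsto_measure (hα : α ∈ Ioo (0 : ℝ) 2)
    (hh : IsSlowlyVarying h)
    (hT : Tendsto (fun y => σ.real (Icc (-y⁻¹) y⁻¹) / (y ^ (α - 2) * h y)) atTop
      (𝓝 (varianceConst α))) :
    Tendsto (fun y => fejerVariance σ y / (y ^ α * h y)) atTop (𝓝 1) := by
  have hα0 := hα.1
  obtain ⟨M, hM, hbound⟩ := exists_measure_Icc_le hα hh hT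
  have hmodel : Tendsto (fun K => ∫ u in Icc (-K) K, fejer u ∂(modelMeasure α)) atTop (𝓝 1) := by
    have hi := integrable_fejer_modelMeasure hα 1
    have hV := fejerVariance_modelMeasure hα 1
    simp only [one_pow, one_mul, fejerVariance, abs_one, Real.one_rpow] at hi hV
    rw [← hV]
    exact (aecover_Icc tendsto_neg_atTop_atBot tendsto_id).integral_tendsto_of_countably_generated hi
  have htail : Tendsto (fun K : ℝ => 16 * M / α * K ^ (-(α / 2))) atTop (𝓝 0) := by
    simpa using (tendsto_rpow_neg_atTop (half_pos hα0)).const_mul (16 * M / α)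
  rw [Metric.tendsto_nhds]
  intro ε hε
  -- `K` is fixed before `y`: it controls both the part of the model integral outside `[-K, K]` and
  -- the uniform tail bound, where `16 M / α` is the product of the constants `4`, `M` and `4 / α`
  -- of the two preceding lemmas.
  obtain ⟨K, hK1, hKm, hKt⟩ := ((eventually_ge_atTop 1).and
    (((Metric.tendsto_nhds.1 hmodel) (ε / 3) (by positivity)).and
      (htail.eventually_lt_const (by positivity : 0 < ε / 3)))).exists
  have hK0 : 0 < K := by linarith
  filter_upwards [hbound, eventually_gt_atTop 0,
    Metric.tendsto_nhds.1 (tendsto_setIntegral_fejer hα hh hT hK0) (ε / 3) (by positivity)]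
    with y hb hy hmain
  have hhy := hh.pos y hy
  have hfi : Integrable (fun t => fejer (y * t)) σ := by
    refine Integrable.of_bound (by fun_prop : Continuous _).aestronglyMeasurable 1
      (ae_of_all _ fun t => ?_)
    rw [Real.norm_of_nonneg (fejer_nonneg _)]
    exact fejer_le_one _
  have hN : 0 < y ^ (α - 2) * h y := by positivity
  have hya : y ^ α = y ^ 2 * y ^ (α - 2) := by
    rw [← Real.rpow_two, ← Real.rpow_add hy]
    congr 1
    ring
  have hsplit : fejerVariance σ y / (y ^ α * h y) =
      (∫ t in {t | |y * t| ≤ K}, fejer (y * t) ∂σ) / (y ^ (α - 2) * h y) +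
        (∫ t in {t | |y * t| ≤ K}ᶜ, fejer (y * t) ∂σ) / (y ^ (α - 2) * h y) := by
    rw [← add_div, integral_add_compl (measurableSet_abs_mul_le y K) hfi, fejerVariance,
      integral_const_mul, hya, mul_assoc, mul_div_mul_left _ _ (by positivity)]
  have h1 := setIntegral_fejer_tail_le hα hy hK1 hb
  have h2 : (∫ t in {t | |y * t| ≤ K}ᶜ, fejer (y * t) ∂σ) / (y ^ (α - 2) * h y) < ε / 3 := by
    refine lt_of_le_of_lt ?_ hKt
    rw [div_le_iff₀ hN]
    refine h1.trans_eq ?_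
    have h3 : y ^ (α / 2) * y ^ (α / 2) = y ^ 2 * y ^ (α - 2) := by
      rw [← Real.rpow_add hy, add_halves, hya]
    rw [Real.div_rpow hy.le hK0.le, Real.rpow_neg hK0.le]
    calc 4 / y ^ 2 * (M * (y ^ (α / 2) * h y) * (4 / α * (y ^ (α / 2) / K ^ (α / 2))))
        = 16 * M / α * (K ^ (α / 2))⁻¹ * h y * ((y ^ (α / 2) * y ^ (α / 2)) / y ^ 2) := by ring
      _ = _ := by
        rw [h3]
        field_simp
  have h3 : 0 ≤ (∫ t in {t | |y * t| ≤ K}ᶜ, fejer (y * t) ∂σ) / (y ^ (α - 2) * h y) :=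
    div_nonneg (integral_nonneg fun t => fejer_nonneg _) hN.le
  rw [hsplit]
  rw [Real.dist_eq, abs_lt] at *
  constructor <;> linarith [hmain.1, hmain.2, hKm.1, hKm.2]

end Abelian

/-! ### From integer to real arguments -/

/-- `y sinc (y t / 2)` equals `2 sin (y t / 2) / t`, and the sine is `1`-Lipschitz. The square of
this quantity is the integrand of `fejerVariance`. -/
lemma abs_mul_sinc_sub_le (y n t : ℝ) :
    |y * Real.sinc (y * t / 2) - n * Real.sinc (n * t / 2)| ≤ |y - n| := by
  rcases eq_or_ne t 0 with rfl | ht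
  · simp
  have key : ∀ a : ℝ, a * Real.sinc (a * t / 2) = 2 * Real.sin (a * t / 2) / t := fun a => by
    rcases eq_or_ne a 0 with rfl | ha
    · simp
    rw [Real.sinc_of_ne_zero (by positivity)]
    field_simp
  have h1 : |Real.sin (y * t / 2) - Real.sin (n * t / 2)| ≤ |y * t / 2 - n * t / 2| := by
    simpa [Real.dist_eq] using Real.lipschitzWith_sin.dist_le_mul (y * t / 2) (n * t / 2)
  rw [key, key, ← sub_div, ← mul_sub, abs_div, div_le_iff₀ (abs_pos.2 ht), ← abs_mul,
    abs_mul (2 : ℝ), abs_two]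
  rw [show y * t / 2 - n * t / 2 = (y - n) * t / 2 by ring, abs_div, abs_two] at h1
  linarith

/-- With `p`, `q` the signed roots of the integrands, `p² - q² = (p - q)² + 2 q (p - q)` and `2 |q|
≤ ε q² + 1/ε`. The additive error does not depend on `n`, hence is negligible once the variances
tend to infinity. -/
lemma abs_fejerVariance_sub_le (σ : Measure ℝ) [IsFiniteMeasure σ] {y n ε : ℝ} (hε : 0 < ε)
    (hyn : |y - n| ≤ 1) :
    |fejerVariance σ y - fejerVariance σ n| ≤
      ε * fejerVariance σ n + (1 + ε⁻¹) * σ.real univ := by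
  have hpt : ∀ t, |y ^ 2 * fejer (y * t) - n ^ 2 * fejer (n * t)| ≤
      ε * (n ^ 2 * fejer (n * t)) + (1 + ε⁻¹) := fun t => by
    have h1 := (abs_mul_sinc_sub_le y n t).trans hyn
    simp only [fejer, ← mul_pow]
    set p := y * Real.sinc (y * t / 2)
    set q := n * Real.sinc (n * t / 2)
    have h2 : 2 * |q| ≤ ε * q ^ 2 + ε⁻¹ := by
      have h3 : 0 ≤ ε⁻¹ * (ε * |q| - 1) ^ 2 := by positivity
      have h4 : ε⁻¹ * (ε * |q| - 1) ^ 2 = ε * q ^ 2 - 2 * |q| + ε⁻¹ := by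
        rw [← sq_abs q]
        field_simp
        ring
      linarith
    have h5 : p ^ 2 - q ^ 2 = (p - q) ^ 2 + 2 * q * (p - q) := by ring
    rw [h5]
    refine (abs_add_le _ _).trans ?_
    rw [abs_mul, abs_mul, abs_two, abs_of_nonneg (sq_nonneg _)]
    have h6 : (p - q) ^ 2 ≤ 1 := (sq_le_one_iff_abs_le_one _).2 h1
    have h7 : 2 * |q| * |p - q| ≤ 2 * |q| * 1 := by gcongr
    linarith
  unfold fejerVariance
  rw [← integral_sub (integrable_fejer σ y) (integrable_fejer σ n)]
  refine abs_integral_le_integral_abs.trans ?_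
  refine (integral_mono ((integrable_fejer σ y).sub (integrable_fejer σ n)).abs
    (((integrable_fejer σ n).const_mul ε).add (integrable_const _)) hpt).trans_eq ?_
  rw [integral_add' ((integrable_fejer σ n).const_mul ε) (integrable_const _), integral_const_mul ε,
    integral_const, smul_eq_mul, mul_comm (σ.real univ)]

lemma tendsto_fejerVariance_iff_nat (σ : Measure ℝ) [IsFiniteMeasure σ] {α : ℝ}
    (hα : 0 < α) {h : ℝ → ℝ} (hh : IsSlowlyVarying h) :
    Tendsto (fun y : ℝ => fejerVariance σ y / (y ^ α * h y)) atTop (𝓝 1) ↔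
      Tendsto (fun n : ℕ => fejerVariance σ n / ((n : ℝ) ^ α * h n)) atTop (𝓝 1) := by
  refine ⟨fun H => H.comp tendsto_natCast_atTop_atTop, fun H => ?_⟩
  have hfl : Tendsto (fun y : ℝ => ⌊y⌋₊) atTop atTop := tendsto_nat_floor_atTop
  have hN : Tendsto (fun n : ℕ => (n : ℝ) ^ α * h n) atTop atTop :=
    (hh.tendsto_rpow_mul_atTop hα).comp tendsto_natCast_atTop_atTop
  have hV : Tendsto (fun n : ℕ => fejerVariance σ n) atTop atTop := by
    refine (H.pos_mul_atTop one_pos hN).congr' ?_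
    filter_upwards [hN.eventually_gt_atTop 0] with n hn
    exact div_mul_cancel₀ _ hn.ne'
  have hratio : Tendsto (fun y : ℝ => fejerVariance σ y / fejerVariance σ (⌊y⌋₊ : ℝ)) atTop
      (𝓝 1) := by
    rw [Metric.tendsto_nhds]
    intro ε hε
    have hlim := (hV.comp hfl).const_div_atTop ((1 + (ε / 2)⁻¹) * σ.real univ)
    filter_upwards [hlim.eventually_lt_const (half_pos hε), (hV.comp hfl).eventually_gt_atTop 0,
      eventually_ge_atTop 0] with y h1 h2 hy
    simp only [Function.comp_apply] at h1 h2
    have h3 : |y - ⌊y⌋₊| ≤ 1 := by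
      rw [abs_of_nonneg (sub_nonneg.2 (Nat.floor_le hy))]
      linarith [Nat.lt_floor_add_one y]
    have h4 := abs_fejerVariance_sub_le σ (half_pos hε) h3
    rw [Real.dist_eq, div_sub_one h2.ne', abs_div, abs_of_pos h2]
    calc _ ≤ (ε / 2 * fejerVariance σ (⌊y⌋₊ : ℝ) + (1 + (ε / 2)⁻¹) * σ.real univ) /
          fejerVariance σ (⌊y⌋₊ : ℝ) := by gcongr
      _ = ε / 2 + (1 + (ε / 2)⁻¹) * σ.real univ / fejerVariance σ (⌊y⌋₊ : ℝ) := by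
        field_simp
      _ < ε := by linarith
  have hpow : Tendsto (fun y : ℝ => ((⌊y⌋₊ : ℝ) / y) ^ α) atTop (𝓝 1) := by
    simpa using (tendsto_nat_floor_div_atTop (R := ℝ)).rpow_const (p := α) (Or.inl one_ne_zero)
  have hprod := (hratio.mul (H.comp hfl)).mul (hpow.mul hh.tendsto_floor_div)
  simp only [mul_one] at hprod
  refine hprod.congr' ?_
  filter_upwards [(hV.comp hfl).eventually_gt_atTop 0, eventually_ge_atTop 1] with y h1 hy
  have hy0 : 0 < y := by linarith
  have h2 : 0 < (⌊y⌋₊ : ℝ) := by exact_mod_cast Nat.floor_pos.2 hy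
  have h3 := hh.pos _ h2
  have h4 := hh.pos _ hy0
  simp only [Function.comp_apply] at h1 ⊢
  rw [Real.div_rpow h2.le hy0.le]
  have h5 : 0 < (⌊y⌋₊ : ℝ) ^ α := by positivity
  have h6 : 0 < y ^ α := by positivity
  field_simp

/-! ### Cosine sums -/

/-- The double sum is `|∑ z ^ j|²` with `z = exp (i a)`, a geometric sum. The factor `1 - cos a`
stays on the left to avoid dividing where `z = 1`. -/
lemma one_sub_cos_mul_sum_cos (n : ℕ) (a : ℝ) :
    (1 - Real.cos a) * ∑ i ∈ Finset.Icc 1 n, ∑ j ∈ Finset.Icc 1 n,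
      Real.cos (((i : ℝ) - j) * a) = 1 - Real.cos (n * a) := by
  set z : ℂ := Complex.exp (a * Complex.I) with hz
  have hpow : ∀ k : ℕ, z ^ k = (Real.cos (k * a) : ℂ) + (Real.sin (k * a) : ℂ) * Complex.I :=
    fun k => by
      rw [hz, ← Complex.exp_nat_mul, ← mul_assoc, Complex.exp_mul_I]
      push_cast
      rfl
  have hnsq : ∀ k : ℕ, Complex.normSq (z ^ k - 1) = 2 * (1 - Real.cos (k * a)) := fun k => by
    rw [hpow, Complex.normSq_apply]
    simp only [Complex.sub_re, Complex.add_re, Complex.ofReal_re, Complex.mul_re, Complex.I_re,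
      Complex.ofReal_im, Complex.I_im, Complex.sub_im, Complex.add_im, Complex.mul_im,
      Complex.one_re, Complex.one_im]
    have := Real.sin_sq_add_cos_sq (k * a)
    ring_nf at this ⊢
    linarith
  have hz1 : Complex.normSq z = 1 := by
    rw [Complex.normSq_eq_norm_sq, hz, Complex.norm_exp_ofReal_mul_I, one_pow]
  have hgeom : ∀ n : ℕ, (z - 1) * ∑ j ∈ Finset.Icc 1 n, z ^ j = z * (z ^ n - 1) := fun n => by
    induction n with
    | zero => simp
    | succ n ih =>
      rw [Finset.sum_Icc_succ_top (by omega), mul_add, ih]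
      ring
  have hsum : Complex.normSq (∑ j ∈ Finset.Icc 1 n, z ^ j) =
      ∑ i ∈ Finset.Icc 1 n, ∑ j ∈ Finset.Icc 1 n, Real.cos (((i : ℝ) - j) * a) := by
    have hre : (∑ j ∈ Finset.Icc 1 n, z ^ j).re = ∑ j ∈ Finset.Icc 1 n, Real.cos (j * a) := by
      simp [hpow, -Complex.ofReal_cos, -Complex.ofReal_sin]
    have him : (∑ j ∈ Finset.Icc 1 n, z ^ j).im = ∑ j ∈ Finset.Icc 1 n, Real.sin (j * a) := by
      simp [hpow, -Complex.ofReal_cos, -Complex.ofReal_sin]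
    rw [Complex.normSq_apply, hre, him, Finset.sum_mul_sum, Finset.sum_mul_sum,
      ← Finset.sum_add_distrib]
    refine Finset.sum_congr rfl fun i _ => ?_
    rw [← Finset.sum_add_distrib]
    refine Finset.sum_congr rfl fun j _ => ?_
    rw [sub_mul, Real.cos_sub]
  have h1 := congrArg Complex.normSq (hgeom n)
  have h2 := hnsq 1
  rw [pow_one, Nat.cast_one, one_mul] at h2
  rw [Complex.normSq_mul, Complex.normSq_mul, hz1, hsum, hnsq, h2] at h1
  linarith

/-- Both sides are `(sin (n a / 2) / sin (a / 2))²`, the Fejér kernel of the circle without its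
factor `1 / n`. -/
lemma sq_mul_fejer_mul_weight (n : ℕ) {a : ℝ} (ha : |a| ≤ Real.pi) :
    (n : ℝ) ^ 2 * fejer (n * a) * fejerWeight a =
      ∑ i ∈ Finset.Icc 1 n, ∑ j ∈ Finset.Icc 1 n, Real.cos (((i : ℝ) - j) * a) := by
  rcases eq_or_ne a 0 with rfl | ha0
  · have h1 : fejerWeight 0 = 1 := by
      have := fejerWeight_mul_fejer ha
      rwa [fejer_zero, mul_one] at this
    simp [h1]
    ring
  have h1 : fejer a * ∑ i ∈ Finset.Icc 1 n, ∑ j ∈ Finset.Icc 1 n, Real.cos (((i : ℝ) - j) * a) =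
      (n : ℝ) ^ 2 * fejer (n * a) := by
    have h2 := one_sub_cos_mul_sum_cos n a
    have h3 := sq_mul_fejer a
    have h4 := sq_mul_fejer (n * a)
    have h5 : a ^ 2 ≠ 0 := pow_ne_zero 2 ha0
    refine mul_left_cancel₀ h5 ?_
    rw [← mul_assoc, h3, mul_assoc, h2, ← h4]
    ring
  rw [← h1, mul_right_comm, mul_comm (fejer a), fejerWeight_mul_fejer ha, one_mul]

/-! ### Folding a measure on `[0, 2π)` to `[-π, π]` -/

/-- The representative of `t ∈ [0, 2π)` modulo `2π` in `(-π, π]`. -/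
noncomputable def foldAngle (t : ℝ) : ℝ := if t ≤ Real.pi then t else t - 2 * Real.pi

lemma measurable_foldAngle : Measurable foldAngle :=
  Measurable.ite measurableSet_Iic measurable_id (measurable_id.sub_const _)

lemma abs_foldAngle_le {t : ℝ} (ht : t ∈ Ico 0 (2 * Real.pi)) : |foldAngle t| ≤ Real.pi := by
  unfold foldAngle
  split_ifs with h
  · rwa [abs_of_nonneg ht.1]
  · rw [abs_le]
    constructor <;> linarith [ht.2, Real.pi_pos]

lemma cos_int_mul_foldAngle (k : ℤ) (t : ℝ) : Real.cos (k * foldAngle t) = Real.cos (k * t) := by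
  unfold foldAngle
  split_ifs with h
  · rfl
  · rw [mul_sub, Real.cos_sub_int_mul_two_pi]

/-- The symmetrization of the image of `G` under `foldAngle`. -/
noncomputable def foldedSymm (G : Measure ℝ) : Measure ℝ :=
  (2 : ℝ≥0∞)⁻¹ • (G.map foldAngle + G.map fun t => -foldAngle t)

instance (G : Measure ℝ) [IsFiniteMeasure G] : IsFiniteMeasure (foldedSymm G) :=
  Measure.smul_finite _ (by simp)

lemma foldedSymm_map_neg (G : Measure ℝ) : (foldedSymm G).map Neg.neg = foldedSymm G := by
  have h1 := measurable_foldAngle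
  rw [foldedSymm, Measure.map_smul, Measure.map_add _ _ measurable_neg,
    Measure.map_map measurable_neg h1, Measure.map_map measurable_neg (by fun_prop), add_comm]
  congr 3
  ext t
  simp

lemma integral_foldedSymm (G : Measure ℝ) [IsFiniteMeasure G] {f : ℝ → ℝ} (hf : Continuous f)
    {B : ℝ} (hB : ∀ t, |f t| ≤ B) (heven : ∀ t, f (-t) = f t) :
    ∫ t, f t ∂(foldedSymm G) = ∫ t, f (foldAngle t) ∂G := by
  have h1 := measurable_foldAngle
  have hi : ∀ m : Measure ℝ, IsFiniteMeasure m → Integrable f m := fun m _ =>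
    Integrable.of_bound hf.aestronglyMeasurable B (ae_of_all _ hB)
  rw [foldedSymm, integral_smul_measure, integral_add_measure (hi _ inferInstance)
    (hi _ inferInstance), integral_map h1.aemeasurable hf.aestronglyMeasurable,
    integral_map (by fun_prop) hf.aestronglyMeasurable]
  simp_rw [heven]
  rw [ENNReal.toReal_inv, ENNReal.toReal_ofNat, smul_eq_mul]
  ring

section Circle

variable {G : Measure ℝ} [IsFiniteMeasure G]

/-- Up to a null set, `[-x, x]` pulls back under `foldAngle` to `[0, x] ∪ [2π - x, 2π)`. The second
piece has the mass of `(0, x]`, so a possible atom at `0` is counted only once. -/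
lemma foldedSymm_real_Icc (hcarr : G (Ico 0 (2 * Real.pi))ᶜ = 0)
    (hsymm : ∀ x, 0 < x → x < Real.pi →
      G.real (Ico (2 * Real.pi - x) (2 * Real.pi)) = G.real (Ioc 0 x))
    {x : ℝ} (hx : 0 < x) (hxπ : x < Real.pi) :
    (foldedSymm G).real (Icc (-x) x) = 2 * G.real (Icc 0 x) - G.real {0} := by
  have hπ := Real.pi_pos
  have h1 := measurable_foldAngle
  have h2 : ∀ t, -foldAngle t ∈ Icc (-x) x ↔ foldAngle t ∈ Icc (-x) x := fun t => by
    rw [mem_Icc, mem_Icc, ← abs_le, ← abs_le, abs_neg]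
  have h3 : (foldAngle ⁻¹' Icc (-x) x) =ᵐ[G] (Icc 0 x ∪ Ico (2 * Real.pi - x) (2 * Real.pi) :
      Set ℝ) := by
    have h4 : ∀ᵐ t ∂G, t ∈ Ico 0 (2 * Real.pi) := by
      rw [ae_iff]; exact hcarr
    refine eventuallyEq_set.2 ?_
    filter_upwards [h4] with t ht
    simp only [mem_preimage, mem_union, mem_Icc, mem_Ico, foldAngle]
    rw [mem_Ico] at ht
    constructor
    · intro h5
      split_ifs at h5 with h6
      · exact Or.inl ⟨ht.1, h5.2⟩
      · exact Or.inr ⟨by linarith [h5.1], ht.2⟩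
    · rintro (h5 | h5)
      · rw [if_pos (by linarith [h5.2])]
        exact ⟨by linarith [h5.1], h5.2⟩
      · rw [if_neg (by linarith [h5.1])]
        constructor <;> linarith [h5.1, h5.2]
  have h5 : G.real (foldAngle ⁻¹' Icc (-x) x) = 2 * G.real (Icc 0 x) - G.real {0} := by
    have h6 : Icc 0 x = {0} ∪ Ioc 0 x := by
      rw [singleton_union, Ioc_insert_left hx.le]
    have h7 : G.real (Icc 0 x) = G.real {0} + G.real (Ioc 0 x) := by
      rw [h6]
      exact measureReal_union (by simp) measurableSet_Ioc
    rw [measureReal_congr h3, measureReal_union _ measurableSet_Ico, hsymm x hx hxπ]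
    · linarith
    · exact disjoint_left.2 fun t ht ht' => by linarith [ht.2, ht'.1]
  have h6 : (fun t => -foldAngle t) ⁻¹' Icc (-x) x = foldAngle ⁻¹' Icc (-x) x := by
    ext t
    exact h2 t
  rw [← h5, foldedSymm, measureReal_ennreal_smul_apply, measureReal_add_apply,
    map_measureReal_apply h1 measurableSet_Icc,
    map_measureReal_apply (by fun_prop) measurableSet_Icc, h6, ENNReal.toReal_inv,
    ENNReal.toReal_ofNat]
  ring

/-- `foldedSymm G` with the density that turns the Fejér kernel of the circle into that of the
line. -/
noncomputable def weightedFold (G : Measure ℝ) : Measure ℝ :=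
  (foldedSymm G).withDensity fun t => ENNReal.ofReal (fejerWeight t)

lemma integral_weightedFold (G : Measure ℝ) (f : ℝ → ℝ) :
    ∫ t, f t ∂(weightedFold G) = ∫ t, f t * fejerWeight t ∂(foldedSymm G) := by
  rw [weightedFold, integral_withDensity_eq_integral_toReal_smul
    fejerWeight.continuous.measurable.ennreal_ofReal (ae_of_all _ fun _ => ENNReal.ofReal_lt_top)]
  refine integral_congr_ae (ae_of_all _ fun t => ?_)
  simp only [smul_eq_mul]
  rw [ENNReal.toReal_ofReal (fejerWeight_pos t).le, mul_comm]

instance : IsFiniteMeasure (weightedFold G) :=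
  isFiniteMeasure_withDensity_ofReal (fejerWeight.integrable _).2

lemma fejerWeight_neg (t : ℝ) : fejerWeight (-t) = fejerWeight t := by
  simp [fejerWeight_apply]

lemma weightedFold_map_neg (G : Measure ℝ) : (weightedFold G).map Neg.neg = weightedFold G := by
  have hm : Measurable fun t => ENNReal.ofReal (fejerWeight t) :=
    fejerWeight.continuous.measurable.ennreal_ofReal
  have hmp : MeasurePreserving Neg.neg (foldedSymm G) (foldedSymm G) :=
    ⟨measurable_neg, foldedSymm_map_neg G⟩
  ext s hs
  rw [Measure.map_apply measurable_neg hs, weightedFold, withDensity_apply _ (measurable_neg hs),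
    withDensity_apply _ hs, ← hmp.setLIntegral_comp_preimage hs hm]
  simp_rw [fejerWeight_neg]

/-- The integrand is even, so the symmetrization drops out, and folding does not affect cosines of
integer frequency. The latter restricts the identity to integers `n`. -/
lemma fejerVariance_weightedFold (hcarr : G (Ico 0 (2 * Real.pi))ᶜ = 0) (n : ℕ) :
    fejerVariance (weightedFold G) n =
      ∑ i ∈ Finset.Icc 1 n, ∑ j ∈ Finset.Icc 1 n, ∫ t, Real.cos (((i : ℝ) - j) * t) ∂G := by
  have hc := fejerWeight.continuous
  rw [fejerVariance, integral_weightedFold, integral_foldedSymm G (by fun_prop)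
    (B := (n : ℝ) ^ 2 * 1 * ‖fejerWeight‖)]
  · have hi : ∀ k : ℝ, Integrable (fun t => Real.cos (k * t)) G := fun k =>
      Integrable.of_bound (by fun_prop : Continuous _).aestronglyMeasurable 1
        (ae_of_all _ fun t => Real.abs_cos_le_one _)
    simp_rw [← integral_finsetSum (Finset.Icc 1 n) fun j _ => hi _]
    rw [← integral_finsetSum _ fun i _ => integrable_finsetSum _ fun j _ => hi _]
    have h4 : ∀ᵐ t ∂G, t ∈ Ico 0 (2 * Real.pi) := by
      rw [ae_iff]; exact hcarr
    refine integral_congr_ae ?_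
    filter_upwards [h4] with t ht
    rw [sq_mul_fejer_mul_weight n (abs_foldAngle_le ht)]
    refine Finset.sum_congr rfl fun i _ => Finset.sum_congr rfl fun j _ => ?_
    have := cos_int_mul_foldAngle ((i : ℤ) - j) t
    push_cast at this
    exact this
  · intro t
    rw [abs_mul, abs_mul, abs_of_nonneg (fejer_nonneg _), abs_of_nonneg (sq_nonneg (n : ℝ))]
    gcongr
    · exact fejer_le_one _
    · exact fejerWeight.norm_coe_le_norm t
  · intro t
    rw [mul_neg, fejer_neg, fejerWeight_neg]

/-- The density is continuous with value `1` at `0`, so its mean over shrinking intervals tends to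
`1`. Where the folded measure has no mass, so does the weighted one, and `r` is set to `1`. -/
lemma tendsto_weightedFold_ratio (G : Measure ℝ) [IsFiniteMeasure G] :
    ∃ r : ℝ → ℝ, Tendsto r atTop (𝓝 1) ∧ ∀ y, (weightedFold G).real (Icc (-y⁻¹) y⁻¹) =
      r y * (foldedSymm G).real (Icc (-y⁻¹) y⁻¹) := by
  classical
  have hreal : ∀ s, MeasurableSet s →
      (weightedFold G).real s = ∫ t in s, fejerWeight t ∂(foldedSymm G) := fun s hs => by
    rw [← integral_indicator_one hs, integral_weightedFold, ← integral_indicator hs]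
    refine integral_congr_ae (ae_of_all _ fun t => ?_)
    by_cases ht : t ∈ s <;> simp [ht]
  refine ⟨fun y => if (foldedSymm G).real (Icc (-y⁻¹) y⁻¹) = 0 then 1 else
    (weightedFold G).real (Icc (-y⁻¹) y⁻¹) / (foldedSymm G).real (Icc (-y⁻¹) y⁻¹), ?_, ?_⟩
  · have hw0 : fejerWeight 0 = 1 := by
      have := fejerWeight_mul_fejer (u := 0) (by simpa using Real.pi_pos.le)
      rwa [fejer_zero, mul_one] at this
    rw [Metric.tendsto_nhds]
    intro ε hε
    have hcont := Metric.tendsto_nhds.1 (fejerWeight.continuous.tendsto 0) (ε / 2) (half_pos hε)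
    rw [hw0] at hcont
    obtain ⟨δ, hδ, hball⟩ := Metric.eventually_nhds_iff.1 hcont
    filter_upwards [tendsto_inv_atTop_zero.eventually_lt_const hδ] with y hy
    split_ifs with h0
    · simpa using hε
    · have hpos : 0 < (foldedSymm G).real (Icc (-y⁻¹) y⁻¹) :=
        lt_of_le_of_ne measureReal_nonneg (Ne.symm h0)
      rw [Real.dist_eq, div_sub_one h0, abs_div, abs_of_pos hpos, div_lt_iff₀ hpos,
        hreal _ measurableSet_Icc]
      have h1 : (foldedSymm G).real (Icc (-y⁻¹) y⁻¹) =
          ∫ t in Icc (-y⁻¹) y⁻¹, (1 : ℝ) ∂(foldedSymm G) := by simp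
      have h2 : |∫ t in Icc (-y⁻¹) y⁻¹, (fejerWeight t - 1) ∂(foldedSymm G)| ≤
          ε / 2 * (foldedSymm G).real (Icc (-y⁻¹) y⁻¹) := by
        rw [← Real.norm_eq_abs]
        refine norm_setIntegral_le_of_norm_le_const
          (measure_lt_top (foldedSymm G) (Icc (-y⁻¹) y⁻¹)) fun t ht => ?_
        have h3 : |t| ≤ y⁻¹ := abs_le.2 ht
        have := hball (y := t) (by rw [Real.dist_eq, sub_zero]; exact h3.trans_lt hy)
        rw [Real.dist_eq] at this
        exact this.le
      rw [integral_sub (fejerWeight.integrable _) (integrable_const _), ← h1] at h2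
      nlinarith
  · intro y
    simp only
    split_ifs with h0
    · have : (weightedFold G) (Icc (-y⁻¹) y⁻¹) = 0 :=
        withDensity_absolutelyContinuous _ _ ((measureReal_eq_zero_iff).1 h0)
      rw [h0, measureReal_def, this]
      simp
    · exact (div_mul_cancel₀ _ h0).symm

/-- Asymptotics of quadratic cosine sums are equivalent to asymptotics of the distribution
function at `0`. -/
theorem tendsto_sum_cos_iff (hcarr : G (Ico 0 (2 * Real.pi))ᶜ = 0)
    (hsymm : ∀ x, 0 < x → x < Real.pi →
      G.real (Ico (2 * Real.pi - x) (2 * Real.pi)) = G.real (Ioc 0 x))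
    {α : ℝ} (hα : α ∈ Ioo (0 : ℝ) 2) {h : ℝ → ℝ} (hh : IsSlowlyVarying h) :
    Tendsto (fun n : ℕ => (∑ i ∈ Finset.Icc 1 n, ∑ j ∈ Finset.Icc 1 n,
        ∫ t, Real.cos (((i : ℝ) - j) * t) ∂G) / ((n : ℝ) ^ α * h n)) atTop (𝓝 1) ↔
      Tendsto (fun x : ℝ => G.real (Icc 0 x) /
        (1 / 2 * varianceConst α * x ^ (2 - α) * h (1 / x))) (𝓝[>] 0) (𝓝 1) := by
  have hC := varianceConst_pos hα
  have hα2 : 0 < 2 - α := by linarith [hα.2]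
  simp_rw [← fejerVariance_weightedFold hcarr]
  rw [← tendsto_fejerVariance_iff_nat _ hα.1 hh]
  have hstep1 : Tendsto (fun y : ℝ => fejerVariance (weightedFold G) y / (y ^ α * h y)) atTop
      (𝓝 1) ↔ Tendsto (fun y => (weightedFold G).real (Icc (-y⁻¹) y⁻¹) / (y ^ (α - 2) * h y)) atTop
      (𝓝 (varianceConst α)) :=
    ⟨tendsto_measure_of_tendsto_fejerVariance (weightedFold_map_neg G) hα hh,
      tendsto_fejerVariance_of_tendsto_measure hα hh⟩
  have hstep2 : Tendsto (fun y => (weightedFold G).real (Icc (-y⁻¹) y⁻¹) / (y ^ (α - 2) * h y)) atTop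
      (𝓝 (varianceConst α)) ↔ Tendsto (fun y => (foldedSymm G).real (Icc (-y⁻¹) y⁻¹) /
        (y ^ (α - 2) * h y)) atTop (𝓝 (varianceConst α)) := by
    obtain ⟨r, hr, hreq⟩ := tendsto_weightedFold_ratio G
    simp_rw [hreq]
    constructor
    · intro H
      have := (hr.inv₀ one_ne_zero).mul H
      rw [inv_one, one_mul] at this
      refine this.congr' ?_
      filter_upwards [hr.eventually_ne one_ne_zero] with y hy
      field_simp
    · intro H
      have := hr.mul H
      rw [one_mul] at this
      exact this.congr fun y => (mul_div_assoc _ _ _).symm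
  -- The normalization tends to `0`, as its inverse is `y ^ (2 - α)` times the slowly varying `1 /
  -- h`. By `hzero`, either asymptotic relation then excludes an atom at `0`, and the folded mass is
  -- exactly twice the one-sided mass.
  have hN0 : Tendsto (fun y => y ^ (α - 2) * h y) atTop (𝓝 0) := by
    have := (hh.inv.tendsto_rpow_mul_atTop hα2).inv_tendsto_atTop
    refine this.congr' ?_
    filter_upwards [eventually_gt_atTop 0] with y hy
    rw [Pi.inv_apply, mul_inv, inv_inv, ← Real.rpow_neg hy.le, neg_sub]
  have hpos : ∀ y, 0 < y → 0 < y ^ (α - 2) * h y := fun y hy =>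
    mul_pos (by positivity) (hh.pos y hy)
  have hle0 : ∀ y : ℝ, 0 < y → G.real {0} ≤ G.real (Icc 0 y⁻¹) := fun y hy =>
    measureReal_mono (singleton_subset_iff.2 ⟨le_rfl, (inv_pos.2 hy).le⟩)
  have hfold : ∀ᶠ y : ℝ in atTop, (foldedSymm G).real (Icc (-y⁻¹) y⁻¹) =
      2 * G.real (Icc 0 y⁻¹) - G.real {0} := by
    filter_upwards [eventually_gt_atTop 0,
      tendsto_inv_atTop_zero.eventually_lt_const Real.pi_pos] with y hy hy'
    exact foldedSymm_real_Icc hcarr hsymm (inv_pos.2 hy) hy'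
  have hzero : ∀ {u : ℝ → ℝ} {c : ℝ}, Tendsto (fun y => u y / (y ^ (α - 2) * h y)) atTop (𝓝 c) →
      (∀ᶠ y in atTop, G.real {0} ≤ u y) → G.real {0} = 0 := fun {u c} H hu => by
    have h1 := H.mul hN0
    rw [mul_zero] at h1
    refine le_antisymm (ge_of_tendsto h1 ?_) measureReal_nonneg
    filter_upwards [hu, eventually_gt_atTop 0] with y hy hy0
    rwa [div_mul_cancel₀ _ (hpos y hy0).ne']
  have hstep3 : Tendsto (fun y => (foldedSymm G).real (Icc (-y⁻¹) y⁻¹) / (y ^ (α - 2) * h y)) atTop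
      (𝓝 (varianceConst α)) ↔ Tendsto (fun y => G.real (Icc 0 y⁻¹) / (y ^ (α - 2) * h y)) atTop
      (𝓝 (1 / 2 * varianceConst α)) := by
    constructor
    · intro H
      have h0 : G.real {0} = 0 := hzero H (by
        filter_upwards [hfold, eventually_gt_atTop 0] with y hy hy0
        rw [hy]
        linarith [hle0 y hy0])
      refine (H.const_mul (1 / 2)).congr' ?_
      filter_upwards [hfold] with y hy
      rw [hy, h0]
      ring
    · intro H
      have h0 : G.real {0} = 0 := hzero H (by
        filter_upwards [eventually_gt_atTop 0] with y hy0
        exact hle0 y hy0)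
      have h1 := H.const_mul 2
      rw [show 2 * (1 / 2 * varianceConst α) = varianceConst α by ring] at h1
      refine h1.congr' ?_
      filter_upwards [hfold] with y hy
      rw [hy, h0]
      ring
  rw [hstep1, hstep2, hstep3, ← inv_atTop₀ (𝕜 := ℝ), ← Filter.map_inv, tendsto_map'_iff]
  have hc : 1 / 2 * varianceConst α ≠ 0 := by positivity
  have heq : ∀ᶠ y in atTop, ((fun x : ℝ => G.real (Icc 0 x) /
      (1 / 2 * varianceConst α * x ^ (2 - α) * h (1 / x))) ∘ Inv.inv) y =
      (1 / 2 * varianceConst α)⁻¹ * (G.real (Icc 0 y⁻¹) / (y ^ (α - 2) * h y)) := by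
    filter_upwards [eventually_gt_atTop 0] with y hy
    simp only [Function.comp_apply]
    rw [one_div y⁻¹, inv_inv, Real.inv_rpow hy.le, ← Real.rpow_neg hy.le, neg_sub, mul_assoc,
      ← div_div, div_right_comm, inv_mul_eq_div]
  rw [tendsto_congr' heq]
  constructor
  · intro H
    have := H.const_mul (1 / 2 * varianceConst α)⁻¹
    rwa [inv_mul_cancel₀ hc] at this
  · intro H
    have := H.const_mul (1 / 2 * varianceConst α)
    rw [mul_one] at this
    refine this.congr fun y => ?_
    rw [mul_inv_cancel_left₀ hc]

end Circle

/-! ### Moments of the spectral measure -/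

section Spectral

variable {H : Type*} [NormedAddCommGroup H] [InnerProductSpace ℂ H] [CompleteSpace H]

instance isFiniteMeasure_spectralMeasure (T : H →L[ℂ] H) (hT : IsStarNormal T) (g : H) :
    IsFiniteMeasure (spectralMeasure T hT g) := by
  unfold spectralMeasure
  infer_instance

/-- The functional defining the measure records only real parts; nothing is lost, because `f(T)` is
self-adjoint for real `f`. -/
lemma integral_spectralMeasure_ofReal (T : H →L[ℂ] H) (hT : IsStarNormal T) (g : H)
    {f : ℂ → ℝ} (hf : Continuous f) (φ : C(spectrum ℂ T, ℂ))
    (hφ : ∀ z : spectrum ℂ T, φ z = (f z : ℂ)) :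
    ⟪g, cfcHom hT φ g⟫_ℂ = ((∫ z, f z ∂(spectralMeasure T hT g) : ℝ) : ℂ) := by
  let F : C_c(spectrum ℂ T, ℝ) :=
    ⟨⟨fun z => f z, by fun_prop⟩, HasCompactSupport.of_compactSpace _⟩
  have hF : complexify F = φ := by
    ext z
    rw [hφ]
    rfl
  have h1 : ∫ z, f z ∂(spectralMeasure T hT g) = (⟪g, cfcHom hT φ g⟫_ℂ).re := by
    rw [spectralMeasure, integral_map measurable_subtype_coe.aemeasurable
      hf.aestronglyMeasurable]
    have h2 := RealRMK.integral_rieszMeasure (spectralFunctional T hT g) F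
    change ∫ z : spectrum ℂ T, f z ∂(RealRMK.rieszMeasure (spectralFunctional T hT g)) = (⟪g, cfcHom hT (complexify F) g⟫_ℂ).re at h2
    rw [h2, hF]
  have hstar : star φ = φ := by
    ext z
    rw [ContinuousMap.star_apply, hφ]
    exact Complex.conj_ofReal _
  have h3 : star (cfcHom hT φ) = cfcHom hT φ := by rw [← map_star, hstar]
  have h4 : conj ⟪g, cfcHom hT φ g⟫_ℂ = ⟪g, cfcHom hT φ g⟫_ℂ := by
    rw [inner_conj_symm, ← ContinuousLinearMap.adjoint_inner_right,
      ← ContinuousLinearMap.star_eq_adjoint, h3]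
  rw [h1]
  exact (Complex.conj_eq_iff_re.1 h4).symm

lemma spectralMeasure_compl_closedBall {T : H →L[ℂ] H} (hT : IsStarNormal T) (g : H)
    (hT1 : ‖T‖ ≤ 1) : spectralMeasure T hT g (Metric.closedBall 0 1)ᶜ = 0 := by
  rw [spectralMeasure, Measure.map_apply measurable_subtype_coe
    Metric.isClosed_closedBall.measurableSet.compl]
  have : (Subtype.val ⁻¹' (Metric.closedBall (0 : ℂ) 1)ᶜ : Set (spectrum ℂ T)) = ∅ := by
    refine eq_empty_of_forall_notMem fun z hz => hz ?_
    rw [mem_closedBall_zero_iff]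
    refine (spectrum.norm_le_norm_mul_of_mem z.2).trans ?_
    exact mul_le_one₀ hT1 (norm_nonneg _) ContinuousLinearMap.norm_id_le
  rw [this, measure_empty]

lemma integrable_of_continuous_of_closedBall {ν : Measure ℂ} [IsFiniteMeasure ν]
    (hν : ν (Metric.closedBall 0 1)ᶜ = 0) {E : Type*} [NormedAddCommGroup E]
    {f : ℂ → E} (hf : Continuous f) : Integrable f ν := by
  obtain ⟨B, hB⟩ := (isCompact_closedBall (0 : ℂ) 1).exists_bound_of_continuousOn hf.continuousOn
  have h1 : ∀ᵐ z ∂ν, z ∈ Metric.closedBall (0 : ℂ) 1 := by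
    rw [ae_iff]; exact hν
  refine Integrable.of_bound hf.aestronglyMeasurable B ?_
  filter_upwards [h1] with z hz using hB z hz

/-- The functional calculus turns `conj z ^ m * z ^ n` into `star T ^ m * T ^ n`. Mixed moments are
needed because the powers of `z` alone do not determine a measure on the disk. -/
lemma integral_conj_pow_mul_pow_spectralMeasure {T : H →L[ℂ] H} (hT : IsStarNormal T) (g : H)
    (hT1 : ‖T‖ ≤ 1) (m n : ℕ) :
    ∫ z, conj z ^ m * z ^ n ∂(spectralMeasure T hT g) = ⟪(T ^ m) g, (T ^ n) g⟫_ℂ := by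
  have hν := spectralMeasure_compl_closedBall hT g hT1
  let ι : C(spectrum ℂ T, ℂ) := ⟨fun z => z, by fun_prop⟩
  let φ : C(spectrum ℂ T, ℂ) := star ι ^ m * ι ^ n
  let f : ℂ → ℂ := fun z => conj z ^ m * z ^ n
  have hf : Continuous f := by fun_prop
  -- The spectral measure is defined by real test functions, so real and imaginary parts are treated
  -- separately.
  let φr : C(spectrum ℂ T, ℂ) := ⟨fun z => ((f z).re : ℂ), by fun_prop⟩
  let φi : C(spectrum ℂ T, ℂ) := ⟨fun z => ((f z).im : ℂ), by fun_prop⟩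
  have hφ : φ = φr + Complex.I • φi := by
    ext z
    change f z = ((f z).re : ℂ) + Complex.I * ((f z).im : ℂ)
    rw [mul_comm, Complex.re_add_im]
  have hι : cfcHom hT ι = T := cfcHom_id hT
  have h1 : cfcHom hT φ = star T ^ m * T ^ n := by
    rw [map_mul, map_pow, map_pow, map_star, hι]
  have h2 : ⟪g, cfcHom hT φ g⟫_ℂ = ⟪(T ^ m) g, (T ^ n) g⟫_ℂ := by
    rw [h1, ← star_pow, ContinuousLinearMap.star_eq_adjoint, mul_apply_eq_comp,
      ContinuousLinearMap.adjoint_inner_right]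
  have hfi := integrable_of_continuous_of_closedBall hν hf
  have h3 : ∫ z, f z ∂(spectralMeasure T hT g) =
      ((∫ z, (f z).re ∂(spectralMeasure T hT g) : ℝ) : ℂ) +
        ((∫ z, (f z).im ∂(spectralMeasure T hT g) : ℝ) : ℂ) * Complex.I :=
    (integral_re_add_im hfi).symm
  change ∫ z, f z ∂(spectralMeasure T hT g) = _
  rw [h3, ← h2, hφ, map_add, map_smul, add_apply,
    smul_apply, inner_add_right, inner_smul_right,
    integral_spectralMeasure_ofReal T hT g (by fun_prop : Continuous fun z => (f z).re) φr
      fun _ => rfl,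
    integral_spectralMeasure_ofReal T hT g (by fun_prop : Continuous fun z => (f z).im) φi
      fun _ => rfl, mul_comm Complex.I]

end Spectral

/-! ### A measure on the closed unit disk is determined by its moments -/

/-- The inclusion of the closed unit disk in the plane. -/
noncomputable def diskInclusion : Metric.closedBall (0 : ℂ) 1 →ᵇ ℂ :=
  BoundedContinuousFunction.mkOfCompact ⟨Subtype.val, continuous_subtype_val⟩

/-- The span of the monomials in `z` and its conjugate. -/
noncomputable def monomialSpan : Submodule ℂ (Metric.closedBall (0 : ℂ) 1 →ᵇ ℂ) :=
  Submodule.span ℂ (range fun p : ℕ × ℕ => star diskInclusion ^ p.1 * diskInclusion ^ p.2)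

/-- The polynomials in `z` and its conjugate as a star subalgebra. -/
noncomputable def monomialAlgebra : StarSubalgebra ℂ (Metric.closedBall (0 : ℂ) 1 →ᵇ ℂ) where
  carrier := monomialSpan
  add_mem' := fun ha hb => monomialSpan.add_mem ha hb
  algebraMap_mem' := fun r => by
    rw [Algebra.algebraMap_eq_smul_one]
    exact monomialSpan.smul_mem r (Submodule.subset_span ⟨(0, 0), by simp⟩)
  mul_mem' := fun {a b} ha hb => by
    have h : monomialSpan * monomialSpan ≤ monomialSpan := by
      rw [monomialSpan, Submodule.span_mul_span]
      refine Submodule.span_mono ?_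
      rintro _ ⟨_, ⟨p, rfl⟩, _, ⟨q, rfl⟩, rfl⟩
      refine ⟨(p.1 + q.1, p.2 + q.2), ?_⟩
      simp only [pow_add]
      ring
    exact h (Submodule.mul_mem_mul ha hb)
  star_mem' := fun {a} ha => by
    refine Submodule.span_induction (p := fun x _ => star x ∈ monomialSpan) ?_ ?_ ?_ ?_ ha
    · rintro _ ⟨p, rfl⟩
      refine Submodule.subset_span ⟨(p.2, p.1), ?_⟩
      simp only [star_mul', star_pow, star_star]
      ring
    · rw [star_zero]
      exact monomialSpan.zero_mem
    · intro x y _ _ hx hy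
      rw [star_add]
      exact monomialSpan.add_mem hx hy
    · intro c x _ hx
      rw [star_smul]
      exact monomialSpan.smul_mem _ hx

/-- Stone–Weierstrass: polynomials in `z` and its conjugate form a star algebra separating points,
hence determine a finite measure. The algebra is the linear span of the monomials, so linearity
reduces the claim to them. -/
lemma ext_of_moments_disk {m₁ m₂ : Measure (Metric.closedBall (0 : ℂ) 1)} [IsFiniteMeasure m₁]
    [IsFiniteMeasure m₂] (h : ∀ m n : ℕ, ∫ x, conj (x : ℂ) ^ m * (x : ℂ) ^ n ∂m₁ =
      ∫ x, conj (x : ℂ) ^ m * (x : ℂ) ^ n ∂m₂) : m₁ = m₂ := by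
  refine ext_of_forall_mem_subalgebra_integral_eq_of_polish (𝕜 := ℂ) (A := monomialAlgebra) ?_ ?_
  · intro x y hxy
    refine ⟨_, ⟨diskInclusion.toContinuousMapStarₐ ℂ, ⟨diskInclusion, ?_, rfl⟩, rfl⟩, ?_⟩
    · exact Submodule.subset_span ⟨(0, 1), by simp⟩
    · exact fun h0 => hxy (Subtype.ext h0)
  · intro f hf
    refine Submodule.span_induction
      (p := fun f _ => ∫ x, f x ∂m₁ = ∫ x, f x ∂m₂) ?_ ?_ ?_ ?_ hf
    · rintro _ ⟨p, rfl⟩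
      exact h p.1 p.2
    · simp
    · intro f g _ _ hf hg
      simp only [BoundedContinuousFunction.coe_add, Pi.add_apply]
      rw [integral_add (f.integrable _) (g.integrable _),
        integral_add (f.integrable _) (g.integrable _), hf, hg]
    · intro c f _ hf
      simp only [BoundedContinuousFunction.coe_smul]
      rw [integral_smul, integral_smul, hf]

lemma ext_of_moments {ν₁ ν₂ : Measure ℂ} [IsFiniteMeasure ν₁] [IsFiniteMeasure ν₂]
    (h₁ : ν₁ (Metric.closedBall 0 1)ᶜ = 0) (h₂ : ν₂ (Metric.closedBall 0 1)ᶜ = 0)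
    (h : ∀ m n : ℕ, ∫ z, conj z ^ m * z ^ n ∂ν₁ = ∫ z, conj z ^ m * z ^ n ∂ν₂) : ν₁ = ν₂ := by
  have he : MeasurableEmbedding (Subtype.val : Metric.closedBall (0 : ℂ) 1 → ℂ) :=
    MeasurableEmbedding.subtype_coe Metric.isClosed_closedBall.measurableSet
  have hmap : ∀ ν : Measure ℂ, ν (Metric.closedBall 0 1)ᶜ = 0 →
      (ν.comap (Subtype.val : Metric.closedBall (0 : ℂ) 1 → ℂ)).map Subtype.val = ν := fun ν hν => by
    rw [he.map_comap, Subtype.range_coe]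
    exact Measure.restrict_eq_self_of_ae_mem (by rw [ae_iff]; exact hν)
  have hfin : ∀ ν : Measure ℂ, IsFiniteMeasure ν →
      IsFiniteMeasure (ν.comap (Subtype.val : Metric.closedBall (0 : ℂ) 1 → ℂ)) := fun ν _ => by
    refine ⟨?_⟩
    rw [he.comap_apply]
    exact measure_lt_top _ _
  have := hfin ν₁ inferInstance
  have := hfin ν₂ inferInstance
  rw [← hmap ν₁ h₁, ← hmap ν₂ h₂]
  congr 1
  refine ext_of_moments_disk fun m n => ?_
  have hint : ∀ ν : Measure ℂ, ν (Metric.closedBall 0 1)ᶜ = 0 →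
      ∫ x : Metric.closedBall (0 : ℂ) 1, conj (x : ℂ) ^ m * (x : ℂ) ^ n ∂(ν.comap Subtype.val) =
        ∫ z, conj z ^ m * z ^ n ∂ν := fun ν hν => by
    conv_rhs => rw [← hmap ν hν]
    rw [he.integral_map]
  rw [hint ν₁ h₁, hint ν₂ h₂, h]

/-- Conjugating the measure conjugates its moments, which are real. -/
lemma map_conj_eq_of_moments {ν : Measure ℂ} [IsFiniteMeasure ν]
    (hν : ν (Metric.closedBall 0 1)ᶜ = 0)
    (h : ∀ m n : ℕ, (∫ z, conj z ^ m * z ^ n ∂ν).im = 0) :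
    ν.map conj = ν := by
  have hc : Measurable (conj : ℂ → ℂ) := Complex.continuous_conj.measurable
  refine ext_of_moments ?_ hν fun m n => ?_
  · rw [Measure.map_apply hc Metric.isClosed_closedBall.measurableSet.compl]
    convert hν using 2
    ext z
    simp
  · rw [integral_map hc.aemeasurable (by fun_prop : Continuous _).aestronglyMeasurable]
    have h1 : ∀ z : ℂ, conj (conj z) ^ m * conj z ^ n = conj (conj z ^ m * z ^ n) := fun z => by
      simp
    simp_rw [h1]
    rw [integral_conj]
    exact Complex.conj_eq_iff_im.2 (h m n)

/-! ### The Poisson kernel -/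

/-- This identifies the kernel in `spectralDensity` with the Poisson kernel at `conj z`. The
conjugation is invisible in the cosine coefficients, since `z ^ k` and its conjugate have the same
real part. -/
lemma norm_one_sub_mul_exp (z : ℂ) (t : ℝ) :
    ‖1 - z * Complex.exp (Complex.I * t)‖ = ‖Complex.exp (t * Complex.I) - conj z‖ := by
  have h1 : conj (Complex.exp (Complex.I * t)) * Complex.exp (t * Complex.I) = 1 := by
    rw [← Complex.exp_conj, ← Complex.exp_add]
    simp [mul_comm]
  rw [← Complex.norm_conj (1 - _), map_sub, map_one, map_mul]
  have h2 : Complex.exp (t * Complex.I) - conj z =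
      Complex.exp (t * Complex.I) * (1 - conj z * conj (Complex.exp (Complex.I * t))) := by
    linear_combination (conj z) * h1
  rw [h2, norm_mul, Complex.norm_exp_ofReal_mul_I, one_mul]

lemma norm_one_sub_mul_exp_pos {z : ℂ} (hz : ‖z‖ < 1) (t : ℝ) :
    0 < ‖1 - z * Complex.exp (Complex.I * t)‖ := by
  rw [norm_pos_iff, sub_ne_zero]
  intro h
  have h1 := congrArg norm h
  rw [norm_mul, mul_comm Complex.I, Complex.norm_exp_ofReal_mul_I, mul_one, norm_one] at h1
  linarith

lemma continuous_poisson {z : ℂ} (hz : ‖z‖ < 1) :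
    Continuous fun t : ℝ => (1 - ‖z‖ ^ 2) / ‖1 - z * Complex.exp (Complex.I * t)‖ ^ 2 :=
  continuous_const.div (by fun_prop) fun t => pow_ne_zero 2 (norm_one_sub_mul_exp_pos hz t).ne'

/-- The Poisson integral reproduces the holomorphic function `ζ ^ k` at `conj z`; take real parts.
-/
lemma intervalIntegral_poisson_mul_cos {z : ℂ} (hz : ‖z‖ < 1) (k : ℕ) :
    ∫ t in (0 : ℝ)..2 * Real.pi, (1 - ‖z‖ ^ 2) / ‖1 - z * Complex.exp (Complex.I * t)‖ ^ 2 *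
      Real.cos (k * t) = 2 * Real.pi * (z ^ k).re := by
  have hw : conj z ∈ Metric.ball (0 : ℂ) 1 := by simpa using hz
  have hf : DiffContOnCl ℂ (fun ζ : ℂ => ζ ^ k) (Metric.ball 0 1) :=
    (by fun_prop : Differentiable ℂ fun ζ : ℂ => ζ ^ k).diffContOnCl
  have h1 := hf.circleAverage_poissonKernel_smul' hw
  rw [Real.circleAverage_def] at h1
  have hre : ∀ t : ℝ, (Complex.exp (t * Complex.I) ^ k).re = Real.cos (k * t) := fun t => by
    rw [← Complex.exp_nat_mul, ← mul_assoc, ← Complex.ofReal_natCast, ← Complex.ofReal_mul,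
      Complex.exp_ofReal_mul_I_re]
  let F : ℝ → ℂ := fun t => ((1 - ‖z‖ ^ 2) / ‖1 - z * Complex.exp (Complex.I * t)‖ ^ 2 : ℝ) •
    Complex.exp (t * Complex.I) ^ k
  have h2 : ∫ t in (0 : ℝ)..2 * Real.pi, F t = (2 * Real.pi : ℝ) • conj z ^ k := by
    rw [← h1, smul_inv_smul₀ (by positivity)]
    refine intervalIntegral.integral_congr fun t _ => ?_
    simp only [F, norm_one_sub_mul_exp]
    simp [circleMap]
  have hFc : Continuous F := (continuous_poisson hz).smul (by fun_prop)
  have h3 := Complex.reCLM.intervalIntegral_comp_comm (hFc.intervalIntegrable (μ := volume) 0 (2 * Real.pi))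
  rw [h2] at h3
  have h4 : Complex.reCLM ((2 * Real.pi : ℝ) • conj z ^ k) = 2 * Real.pi * (z ^ k).re := by
    rw [Complex.reCLM_apply, Complex.smul_re, ← map_pow, Complex.conj_re, smul_eq_mul]
  rw [← h4, ← h3]
  refine intervalIntegral.integral_congr fun t _ => ?_
  simp only [F, Complex.reCLM_apply, Complex.smul_re, smul_eq_mul, hre]

/-- Adding `1` makes the cosine nonnegative, so that Tonelli's theorem applies in `[0, ∞]` before
`spectralDensity` is known to be integrable. -/
lemma lintegral_poisson {z : ℂ} (hz : ‖z‖ < 1) (k : ℕ) :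
    ∫⁻ t in Icc 0 (2 * Real.pi), ENNReal.ofReal (1 + Real.cos (k * t)) *
      (ENNReal.ofReal (1 / (2 * Real.pi)) *
        ENNReal.ofReal ((1 - ‖z‖ ^ 2) / ‖1 - z * Complex.exp (Complex.I * t)‖ ^ 2)) =
      ENNReal.ofReal (1 + (z ^ k).re) := by
  have hπ := Real.pi_pos
  have hK := continuous_poisson hz
  have hK0 : ∀ t : ℝ, 0 ≤ (1 - ‖z‖ ^ 2) / ‖1 - z * Complex.exp (Complex.I * t)‖ ^ 2 := fun t =>
    div_nonneg (by nlinarith [norm_nonneg z]) (sq_nonneg _)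
  set K : ℝ → ℝ := fun t => (1 - ‖z‖ ^ 2) / ‖1 - z * Complex.exp (Complex.I * t)‖ ^ 2
  have hc0 : ∀ t : ℝ, 0 ≤ 1 + Real.cos (k * t) := fun t => by linarith [Real.neg_one_le_cos (k * t)]
  have h1 : ∀ t, ENNReal.ofReal (1 + Real.cos (k * t)) * (ENNReal.ofReal (1 / (2 * Real.pi)) *
      ENNReal.ofReal (K t)) =
        ENNReal.ofReal (1 / (2 * Real.pi) * (K t * Real.cos ((0 : ℕ) * t) +
          K t * Real.cos (k * t))) := fun t => by
    rw [← ENNReal.ofReal_mul (by positivity), ← ENNReal.ofReal_mul (hc0 t)]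
    congr 1
    simp
    ring
  have hc : ∀ j : ℕ, Continuous fun t => K t * Real.cos (j * t) := fun j =>
    hK.mul (by fun_prop)
  change ∫⁻ t in Icc 0 (2 * Real.pi), ENNReal.ofReal (1 + Real.cos (k * t)) *
    (ENNReal.ofReal (1 / (2 * Real.pi)) * ENNReal.ofReal (K t)) = _
  simp_rw [h1]
  have hint : IntegrableOn (fun t => 1 / (2 * Real.pi) * (K t * Real.cos ((0 : ℕ) * t) +
      K t * Real.cos (k * t))) (Icc 0 (2 * Real.pi)) :=
    (continuous_const.mul ((hc 0).add (hc k))).integrableOn_Icc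
  rw [← ofReal_integral_eq_lintegral_ofReal hint]
  · congr 1
    rw [integral_const_mul, integral_Icc_eq_integral_Ioc,
      ← intervalIntegral.integral_of_le (by positivity),
      intervalIntegral.integral_add ((hc 0).intervalIntegrable _ _)
        ((hc k).intervalIntegrable _ _), intervalIntegral_poisson_mul_cos hz,
      intervalIntegral_poisson_mul_cos hz, pow_zero, Complex.one_re]
    field_simp
  · refine ae_of_all _ fun t => ?_
    have h2 := hK0 t
    have h3 := hc0 t
    have h4 : K t * Real.cos ((0 : ℕ) * t) + K t * Real.cos (k * t) =
        K t * (1 + Real.cos (k * t)) := by simp; ring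
    change 0 ≤ 1 / (2 * Real.pi) * (K t * Real.cos ((0 : ℕ) * t) + K t * Real.cos (k * t))
    rw [h4]
    have : 0 ≤ K t := h2
    positivity

/-! ### The spectral distribution -/

lemma measurable_poisson : Measurable fun p : ℝ × ℂ =>
    ENNReal.ofReal ((1 - ‖p.2‖ ^ 2) / ‖1 - p.2 * Complex.exp (Complex.I * p.1)‖ ^ 2) := by
  fun_prop

lemma measurable_spectralDensity (ν : Measure ℂ) [IsFiniteMeasure ν] :
    Measurable (spectralDensity ν) :=
  (measurable_poisson.lintegral_prod_right' (ν := ν.restrict {z : ℂ | ‖z‖ < 1})).const_mul _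

lemma measurableSet_norm_lt : MeasurableSet {z : ℂ | ‖z‖ < 1} :=
  measurableSet_lt measurable_norm measurable_const

lemma measurableSet_norm_eq : MeasurableSet {z : ℂ | ‖z‖ = 1} :=
  measurableSet_eq_fun measurable_norm measurable_const

lemma lintegral_spectralDensity (ν : Measure ℂ) [IsFiniteMeasure ν] (k : ℕ) :
    ∫⁻ t, ENNReal.ofReal (1 + Real.cos (k * t))
        ∂((volume.restrict (Icc 0 (2 * Real.pi))).withDensity (spectralDensity ν)) =
      ∫⁻ z in {z : ℂ | ‖z‖ < 1}, ENNReal.ofReal (1 + (z ^ k).re) ∂ν := by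
  have hm := measurable_poisson
  rw [lintegral_withDensity_eq_lintegral_mul _ (measurable_spectralDensity ν) (by fun_prop)]
  calc _ = ∫⁻ t in Icc 0 (2 * Real.pi), ∫⁻ z in {z : ℂ | ‖z‖ < 1},
        ENNReal.ofReal (1 + Real.cos (k * t)) * (ENNReal.ofReal (1 / (2 * Real.pi)) *
          ENNReal.ofReal ((1 - ‖z‖ ^ 2) / ‖1 - z * Complex.exp (Complex.I * t)‖ ^ 2)) ∂ν := by
        refine lintegral_congr fun t => ?_
        rw [lintegral_const_mul' _ _ ENNReal.ofReal_ne_top,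
          lintegral_const_mul' _ _ ENNReal.ofReal_ne_top, Pi.mul_apply, mul_comm]
        rfl
    _ = ∫⁻ z in {z : ℂ | ‖z‖ < 1}, (∫⁻ t in Icc 0 (2 * Real.pi),
        ENNReal.ofReal (1 + Real.cos (k * t)) * (ENNReal.ofReal (1 / (2 * Real.pi)) *
          ENNReal.ofReal ((1 - ‖z‖ ^ 2) / ‖1 - z * Complex.exp (Complex.I * t)‖ ^ 2))) ∂ν := by
        rw [lintegral_lintegral_swap]
        fun_prop
    _ = _ := setLIntegral_congr_fun measurableSet_norm_lt fun z hz => lintegral_poisson hz k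

instance isFiniteMeasure_spectralDensity (ν : Measure ℂ) [IsFiniteMeasure ν] : IsFiniteMeasure
    ((volume.restrict (Icc 0 (2 * Real.pi))).withDensity (spectralDensity ν)) := by
  -- At `k = 0` the integrand is the constant `2`, so the identity bounds twice the total mass.
  have h := lintegral_spectralDensity ν 0
  simp only [Nat.cast_zero, zero_mul, Real.cos_zero, pow_zero, Complex.one_re, lintegral_const] at h
  refine ⟨lt_of_mul_lt_mul_left' (a := ENNReal.ofReal (1 + 1)) ?_⟩
  rw [h, ENNReal.mul_top (by norm_num)]
  exact ENNReal.mul_lt_top ENNReal.ofReal_lt_top (measure_lt_top _ _)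

instance (ν : Measure ℂ) [IsFiniteMeasure ν] : IsFiniteMeasure (spectralDistribution ν) := by
  unfold spectralDistribution
  infer_instance

lemma one_add_re_pow_nonneg {z : ℂ} (hz : ‖z‖ ≤ 1) (k : ℕ) : 0 ≤ 1 + (z ^ k).re := by
  have h1 : |(z ^ k).re| ≤ 1 := (Complex.abs_re_le_norm _).trans (by
    rw [norm_pow]
    exact pow_le_one₀ (norm_nonneg _) hz)
  linarith [(abs_le.1 h1).1]

lemma integral_cos_spectralDensity (ν : Measure ℂ) [IsFiniteMeasure ν]
    (hν : ν (Metric.closedBall 0 1)ᶜ = 0) (k : ℕ) :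
    ∫ t, Real.cos (k * t)
        ∂((volume.restrict (Icc 0 (2 * Real.pi))).withDensity (spectralDensity ν)) =
      ∫ z in {z : ℂ | ‖z‖ < 1}, (z ^ k).re ∂ν := by
  set m := (volume.restrict (Icc 0 (2 * Real.pi))).withDensity (spectralDensity ν)
  have hfin : IsFiniteMeasure m := isFiniteMeasure_spectralDensity ν
  have hi : ∀ j : ℕ, Integrable (fun z : ℂ => (z ^ j).re) (ν.restrict {z : ℂ | ‖z‖ < 1}) :=
    fun j => (integrable_of_continuous_of_closedBall hν (by fun_prop)).restrict
  have hc : ∀ j : ℕ, Integrable (fun t => Real.cos (j * t)) m := fun j =>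
    Integrable.of_bound (by fun_prop : Continuous _).aestronglyMeasurable 1
      (ae_of_all _ fun t => Real.abs_cos_le_one _)
  have key : ∀ j : ℕ, ∫ t, (1 + Real.cos (j * t)) ∂m =
      ∫ z in {z : ℂ | ‖z‖ < 1}, (1 + (z ^ j).re) ∂ν := fun j => by
    rw [integral_eq_lintegral_of_nonneg_ae, integral_eq_lintegral_of_nonneg_ae,
      lintegral_spectralDensity]
    · exact (ae_restrict_iff' measurableSet_norm_lt).2
        (ae_of_all _ fun z (hz : ‖z‖ < 1) => one_add_re_pow_nonneg hz.le j)
    · exact (by fun_prop : Continuous _).aestronglyMeasurable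
    · exact ae_of_all _ fun t => by
        change 0 ≤ 1 + Real.cos (j * t)
        linarith [Real.neg_one_le_cos (j * t)]
    · exact (by fun_prop : Continuous _).aestronglyMeasurable
  -- The case `k = 0` equates the total masses and so removes the auxiliary `1`.
  have h0 := key 0
  have hk := key k
  rw [integral_add (integrable_const _) (hc _), integral_add (integrable_const _) (hi _)] at h0 hk
  simp only [Nat.cast_zero, zero_mul, Real.cos_zero, pow_zero, Complex.one_re] at h0
  linarith

lemma angle_nonneg (z : ℂ) : 0 ≤ angle z := by
  unfold angle
  split_ifs with h
  · exact h
  · linarith [Complex.neg_pi_lt_arg z, Real.pi_pos]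

lemma angle_lt (z : ℂ) : angle z < 2 * Real.pi := by
  unfold angle
  split_ifs with h
  · linarith [Complex.arg_le_pi z, Real.pi_pos]
  · linarith

lemma cos_nat_mul_angle {z : ℂ} (hz : ‖z‖ = 1) (k : ℕ) :
    Real.cos (k * angle z) = (z ^ k).re := by
  have h1 : Real.cos (k * angle z) = Real.cos (k * z.arg) := by
    unfold angle
    split_ifs with h
    · rfl
    · rw [mul_add, Real.cos_add_nat_mul_two_pi]
  have h2 : z = Complex.exp (z.arg * Complex.I) := by
    conv_lhs => rw [← Complex.norm_mul_exp_arg_mul_I z, hz, Complex.ofReal_one, one_mul]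
  rw [h1]
  conv_rhs => rw [h2]
  rw [← Complex.exp_nat_mul, ← mul_assoc, ← Complex.ofReal_natCast, ← Complex.ofReal_mul,
    Complex.exp_ofReal_mul_I_re]

lemma integral_cos_spectralDistribution (ν : Measure ℂ) [IsFiniteMeasure ν]
    (hν : ν (Metric.closedBall 0 1)ᶜ = 0) (k : ℕ) :
    ∫ t, Real.cos (k * t) ∂(spectralDistribution ν) = ∫ z, (z ^ k).re ∂ν := by
  have hc : ∀ (m : Measure ℝ) [IsFiniteMeasure m], Integrable (fun t => Real.cos (k * t)) m :=
    fun m _ => Integrable.of_bound (by fun_prop : Continuous _).aestronglyMeasurable 1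
      (ae_of_all _ fun t => Real.abs_cos_le_one _)
  have hi : Integrable (fun z : ℂ => (z ^ k).re) ν :=
    integrable_of_continuous_of_closedBall hν (by fun_prop)
  have h1 : ∀ᵐ z ∂ν, z ∈ {z : ℂ | ‖z‖ = 1} ∪ {z : ℂ | ‖z‖ < 1} := by
    have : ∀ᵐ z ∂ν, z ∈ Metric.closedBall (0 : ℂ) 1 := by
      rw [ae_iff]; exact hν
    filter_upwards [this] with z hz
    rw [mem_closedBall_zero_iff] at hz
    exact hz.eq_or_lt
  rw [spectralDistribution, integral_add_measure (hc _) (hc _), integral_cos_spectralDensity ν hν,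
    integral_map measurable_angle.aemeasurable (by fun_prop : Continuous _).aestronglyMeasurable,
    setIntegral_congr_fun measurableSet_norm_eq fun z hz => cos_nat_mul_angle hz k,
    ← setIntegral_union _ measurableSet_norm_lt hi.integrableOn hi.integrableOn,
    Measure.restrict_eq_self_of_ae_mem h1]
  exact disjoint_left.2 fun z (hz : ‖z‖ = 1) (hz' : ‖z‖ < 1) => hz'.ne hz

lemma spectralDistribution_compl_Ico (ν : Measure ℂ) [IsFiniteMeasure ν] :
    spectralDistribution ν (Ico 0 (2 * Real.pi))ᶜ = 0 := by
  rw [spectralDistribution, Measure.add_apply,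
    Measure.map_apply measurable_angle measurableSet_Ico.compl]
  have h1 : angle ⁻¹' (Ico 0 (2 * Real.pi))ᶜ = ∅ :=
    eq_empty_of_forall_notMem fun z hz => hz ⟨angle_nonneg z, angle_lt z⟩
  rw [h1, measure_empty, zero_add]
  refine withDensity_absolutelyContinuous _ _ ?_
  rw [← Measure.restrict_congr_set Ico_ae_eq_Icc, Measure.restrict_apply measurableSet_Ico.compl,
    compl_inter_self, measure_empty]

/-! ### Symmetry of the spectral distribution -/

/-- Conjugation sends the angle `t` to `2π - t`, except at `t = 0`, which the half-open intervals
avoid. -/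
lemma angle_conj_mem_iff {z : ℂ} {x : ℝ} (hx : 0 < x) (hxπ : x < Real.pi) :
    angle (conj z) ∈ Ioc 0 x ↔ angle z ∈ Ico (2 * Real.pi - x) (2 * Real.pi) := by
  have hπ := Real.pi_pos
  have h1 := Complex.neg_pi_lt_arg z
  have h2 := Complex.arg_le_pi z
  unfold angle
  rw [Complex.arg_conj, mem_Ioc, mem_Ico]
  split_ifs <;> constructor <;> intro h <;> constructor <;> linarith [h.1, h.2]

lemma spectralDensity_two_pi_sub {ν : Measure ℂ} (hν : ν.map conj = ν) (t : ℝ) :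
    spectralDensity ν (2 * Real.pi - t) = spectralDensity ν t := by
  have hc : Measurable (conj : ℂ → ℂ) := Complex.continuous_conj.measurable
  have hmp : MeasurePreserving (conj : ℂ → ℂ) ν ν := ⟨hc, hν⟩
  unfold spectralDensity
  congr 1
  rw [← hmp.setLIntegral_comp_preimage measurableSet_norm_lt (by fun_prop)]
  have h1 : (conj : ℂ → ℂ) ⁻¹' {z : ℂ | ‖z‖ < 1} = {z : ℂ | ‖z‖ < 1} := by
    ext z
    simp
  rw [h1]
  refine lintegral_congr fun z => ?_
  have h2 : Complex.exp (Complex.I * ((2 * Real.pi - t : ℝ) : ℂ)) =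
      conj (Complex.exp (Complex.I * t)) := by
    rw [← Complex.exp_conj]
    push_cast
    rw [mul_sub, Complex.exp_sub, mul_comm Complex.I (2 * _), Complex.exp_two_pi_mul_I, one_div,
      ← Complex.exp_neg]
    simp
  have h3 : 1 - conj z * conj (Complex.exp (Complex.I * t)) =
      conj (1 - z * Complex.exp (Complex.I * t)) := by simp
  rw [h2, h3, Complex.norm_conj, Complex.norm_conj]

lemma spectralDistribution_symm {ν : Measure ℂ} [IsFiniteMeasure ν] (hν : ν.map conj = ν) {x : ℝ}
    (hx : 0 < x) (hxπ : x < Real.pi) :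
    (spectralDistribution ν).real (Ico (2 * Real.pi - x) (2 * Real.pi)) =
      (spectralDistribution ν).real (Ioc 0 x) := by
  have hc : Measurable (conj : ℂ → ℂ) := Complex.continuous_conj.measurable
  have hπ := Real.pi_pos
  rw [measureReal_def, measureReal_def]
  congr 1
  rw [spectralDistribution, Measure.add_apply, Measure.add_apply]
  congr 1
  · rw [Measure.map_apply measurable_angle measurableSet_Ico,
      Measure.map_apply measurable_angle measurableSet_Ioc,
      Measure.restrict_apply (measurable_angle measurableSet_Ico),
      Measure.restrict_apply (measurable_angle measurableSet_Ioc)]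
    conv_rhs => rw [← hν]
    rw [Measure.map_apply hc ((measurable_angle measurableSet_Ioc).inter measurableSet_norm_eq)]
    congr 1
    ext z
    simp only [mem_inter_iff, mem_preimage, mem_ofPred_eq, Complex.norm_conj]
    rw [angle_conj_mem_iff hx hxπ]
  · have hm := measurable_spectralDensity ν
    rw [withDensity_apply _ measurableSet_Ico, withDensity_apply _ measurableSet_Ioc,
      Measure.restrict_restrict measurableSet_Ico, Measure.restrict_restrict measurableSet_Ioc,
      inter_eq_left.2, inter_eq_left.2]
    · rw [← (Measure.measurePreserving_sub_left volume (2 * Real.pi)).setLIntegral_comp_preimage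
        measurableSet_Ioc hm]
      simp_rw [spectralDensity_two_pi_sub hν]
      congr 2
      ext t
      simp only [mem_preimage, mem_Ioc, mem_Ico]
      constructor <;> intro h <;> constructor <;> linarith [h.1, h.2]
    · exact fun t ht => ⟨ht.1.le, by linarith [ht.2]⟩
    · exact fun t ht => ⟨by linarith [ht.1], ht.2.le⟩

/-! ### The transition operator -/

section Operator

variable {S : Type*} [MeasurableSpace S]

lemma norm_transitionOperator_le (P : Kernel S S) [IsMarkovKernel P] (π : Measure S)
    [IsProbabilityMeasure π] (hP : P.Invariant π) : ‖transitionOperator P π hP‖ ≤ 1 :=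
  ContinuousLinearMap.opNorm_le_bound _ zero_le_one fun f =>
    (kernelOperator P π hP).le_of_opNorm_le (LinearMap.mkContinuous_norm_le _ zero_le_one _) f

lemma coe_transitionOperator_pow (P : Kernel S S) [IsMarkovKernel P] (π : Measure S)
    [IsProbabilityMeasure π] (hP : P.Invariant π) (n : ℕ) (f : L20 π) :
    ((transitionOperator P π hP ^ n) f : Lp ℂ 2 π) = (kernelOperator P π hP ^ n) f := by
  induction n with
  | zero => rfl
  | succ n ih =>
    rw [pow_succ', pow_succ', mul_apply_eq_comp, mul_apply_eq_comp, ← ih]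
    rfl

lemma im_kernelOperator_pow (P : Kernel S S) [IsMarkovKernel P] (π : Measure S)
    (hP : P.Invariant π) {f : Lp ℂ 2 π} (hf : ∀ᵐ x ∂π, (f x).im = 0) (n : ℕ) :
    ∀ᵐ x ∂π, ((kernelOperator P π hP ^ n) f x).im = 0 := by
  induction n with
  | zero => exact hf
  | succ n ih =>
    rw [pow_succ', mul_apply_eq_comp]
    filter_upwards [coeFn_kernelOperator P π hP ((kernelOperator P π hP ^ n) f),
      ae_ae_of_invariant hP ih] with x hx hx'
    have h1 : ∫ s, (kernelOperator P π hP ^ n) f s ∂(P x) =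
        ∫ s, (((kernelOperator P π hP ^ n) f s).re : ℂ) ∂(P x) :=
      integral_congr_ae (hx'.mono fun s hs => Complex.ext rfl (by simpa using hs))
    rw [hx, h1, integral_complex_ofReal, Complex.ofReal_im]

lemma im_inner_eq_zero {π : Measure S} {f u : Lp ℂ 2 π} (hf : ∀ᵐ x ∂π, (f x).im = 0)
    (hu : ∀ᵐ x ∂π, (u x).im = 0) : (⟪f, u⟫_ℂ).im = 0 := by
  rw [L2.inner_def]
  have h1 : ∫ x, ⟪f x, u x⟫_ℂ ∂π = ∫ x, (((f x).re * (u x).re : ℝ) : ℂ) ∂π := by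
    refine integral_congr_ae ?_
    filter_upwards [hf, hu] with x h1 h2
    rw [RCLike.inner_apply]
    apply Complex.ext <;> simp [h1, h2, mul_comm]
  rw [h1, integral_complex_ofReal, Complex.ofReal_im]

/-- The kernel maps real functions to real functions. Here the reality of `g` enters; it yields the
symmetry of the spectral measure. -/
lemma im_inner_transitionOperator_pow (P : Kernel S S) [IsMarkovKernel P] (π : Measure S)
    [IsProbabilityMeasure π] (hP : P.Invariant π) {g : S → ℝ} (hg : MemLp g 2 π)
    (hg0 : ∫ x, g x ∂π = 0) (m n : ℕ) :
    (⟪(transitionOperator P π hP ^ m) (toL20 π g hg hg0),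
      (transitionOperator P π hP ^ n) (toL20 π g hg hg0)⟫_ℂ).im = 0 := by
  have h : ∀ᵐ x ∂π, ((toL20 π g hg hg0 : Lp ℂ 2 π) x).im = 0 := by
    filter_upwards [MemLp.coeFn_toLp (hg.ofReal (K := ℂ))] with x hx
    exact (congrArg Complex.im hx).trans (Complex.ofReal_im _)
  rw [Submodule.coe_inner, coe_transitionOperator_pow, coe_transitionOperator_pow]
  exact im_inner_eq_zero (im_kernelOperator_pow P π hP h m) (im_kernelOperator_pow P π hP h n)

end Operator

/-! ### Covariances of the chain -/

namespace IsStationaryMarkovChain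

variable {Ω S : Type*} [MeasurableSpace Ω] [MeasurableSpace S] {μ : Measure Ω}
  {Q : Kernel S S} {ξ : ℤ → Ω → S}

lemma map_eq_marginal (hξ : IsStationaryMarkovChain μ Q ξ) (i : ℤ) :
    μ.map (ξ i) = marginal μ ξ := by
  have hstep : ∀ k : ℤ, μ.map (ξ (k + 1)) = μ.map (ξ k) := fun k => by
    have := congrArg (fun m : Measure (ℤ → S) => m.map (fun x => x k)) hξ.stationary
    change (Measure.map _ _).map _ = (Measure.map _ _).map _ at this
    rw [Measure.map_map (measurable_pi_apply k) (measurable_pi_lambda _ fun n => hξ.measurable _),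
      Measure.map_map (measurable_pi_apply k) (measurable_pi_lambda _ hξ.measurable)] at this
    exact this
  induction i with
  | zero => rfl
  | succ i ih => rw [hstep, ih]
  | pred i ih => rw [← ih, ← hstep, sub_add_cancel]

lemma measurePreserving (hξ : IsStationaryMarkovChain μ Q ξ) (i : ℤ) :
    MeasurePreserving (ξ i) μ (marginal μ ξ) :=
  ⟨hξ.measurable i, hξ.map_eq_marginal i⟩

lemma memLp_comp (hξ : IsStationaryMarkovChain μ Q ξ) {E : Type*} [NormedAddCommGroup E]
    {f : S → E} (hf : MemLp f 2 (marginal μ ξ)) (i : ℤ) : MemLp (fun ω => f (ξ i ω)) 2 μ :=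
  hf.comp_measurePreserving (hξ.measurePreserving i)

lemma integrable_conj_mul (hξ : IsStationaryMarkovChain μ Q ξ) (f u : Lp ℂ 2 (marginal μ ξ))
    (i j : ℤ) : Integrable (fun ω => conj (f (ξ i ω)) * u (ξ j ω)) μ :=
  (hξ.memLp_comp (Lp.memLp f) i).star.integrable_mul (hξ.memLp_comp (Lp.memLp u) j)

variable [IsProbabilityMeasure μ] [IsMarkovKernel Q]

/-- The Markov property as an identity of joint laws, checked on rectangles, because an event in
terms of `ξ i` and `ξ n` belongs to the past of `n`. The earlier coordinate `ξ i` is kept so that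
single steps can be iterated. -/
lemma map_prodMk_succ (hξ : IsStationaryMarkovChain μ Q ξ) {i n : ℤ} (hin : i ≤ n) :
    μ.map (fun ω => ((ξ i ω, ξ n ω), ξ (n + 1) ω)) =
      μ.map (fun ω => (ξ i ω, ξ n ω)) ⊗ₘ Q.prodMkLeft S := by
  have hp : Measurable fun ω => (ξ i ω, ξ n ω) := (hξ.measurable i).prodMk (hξ.measurable n)
  have hle : (⨆ i ≤ n, MeasurableSpace.comap (ξ i) inferInstance) ≤
      (inferInstance : MeasurableSpace Ω) := iSup₂_le fun i _ => (hξ.measurable i).comap_le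
  have hpast : ∀ j ≤ n, Measurable[⨆ i ≤ n, MeasurableSpace.comap (ξ i) inferInstance] (ξ j) :=
    fun j hj => Measurable.mono (comap_measurable (ξ j))
      (le_iSup₂_of_le (f := fun i (_ : i ≤ n) => MeasurableSpace.comap (ξ i) inferInstance)
        j hj le_rfl) le_rfl
  have hprob := Measure.isProbabilityMeasure_map (μ := μ) hp.aemeasurable
  have hprob3 := Measure.isProbabilityMeasure_map (μ := μ)
    (hp.prodMk (hξ.measurable (n + 1))).aemeasurable
  refine Measure.ext_prod fun {A B} hA hB => ?_
  have hAm : MeasurableSet[⨆ i ≤ n, MeasurableSpace.comap (ξ i) inferInstance]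
      ((fun ω => (ξ i ω, ξ n ω)) ⁻¹' A) := ((hpast i hin).prodMk (hpast n le_rfl)) hA
  have hBm : MeasurableSet (ξ (n + 1) ⁻¹' B) := hξ.measurable _ hB
  rw [Measure.map_apply (hp.prodMk (hξ.measurable _)) (hA.prod hB),
    Measure.compProd_apply_prod hA hB, setLIntegral_map hA ((Q.prodMkLeft S).measurable_coe hB) hp]
  simp only [Kernel.prodMkLeft_apply]
  have h1 := setIntegral_condExp hle ((integrable_const (1 : ℝ)).indicator hBm) hAm (μ := μ)
  rw [setIntegral_congr_ae (hle _ hAm) ((hξ.markov n B hB).mono fun ω h _ => h),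
    setIntegral_indicator hBm, setIntegral_const, smul_eq_mul, mul_one] at h1
  have h2 : Measurable fun ω => Q (ξ n ω) B := (Q.measurable_coe hB).comp (hξ.measurable n)
  have h3 : ∫⁻ ω in (fun ω => (ξ i ω, ξ n ω)) ⁻¹' A, Q (ξ n ω) B ∂μ ≠ ∞ := by
    refine ne_top_of_le_ne_top (measure_ne_top μ ((fun ω => (ξ i ω, ξ n ω)) ⁻¹' A)) ?_
    calc _ ≤ ∫⁻ ω in (fun ω => (ξ i ω, ξ n ω)) ⁻¹' A, 1 ∂μ := lintegral_mono fun ω => prob_le_one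
      _ = _ := by simp
  refine (ENNReal.toReal_eq_toReal_iff' (measure_ne_top _ _) h3).1 ?_
  rw [← integral_toReal h2.aemeasurable (ae_of_all _ fun ω => measure_lt_top _ _)]
  exact h1.symm

/-- Integrating out `ξ (n + 1)` given `ξ i` and `ξ n` replaces `u` by its image under the kernel;
iteration down to time `i` gives `integral_conj_mul`. -/
lemma integral_conj_mul_succ (hξ : IsStationaryMarkovChain μ Q ξ)
    (f u : Lp ℂ 2 (marginal μ ξ)) {i n : ℤ} (hin : i ≤ n) :
    ∫ ω, conj (f (ξ i ω)) * u (ξ (n + 1) ω) ∂μ =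
      ∫ ω, conj (f (ξ i ω)) * kernelOperator Q (marginal μ ξ) hξ.invariant u (ξ n ω) ∂μ := by
  have hf := (Lp.stronglyMeasurable f).measurable
  have hu := (Lp.stronglyMeasurable u).measurable
  have hp : Measurable fun ω => (ξ i ω, ξ n ω) := (hξ.measurable i).prodMk (hξ.measurable n)
  have hp3 := hp.prodMk (hξ.measurable (n + 1))
  have hF : Measurable fun p : (S × S) × S => conj (f p.1.1) * u p.2 := by
    have := Complex.continuous_conj.measurable
    fun_prop
  have hprob := Measure.isProbabilityMeasure_map (μ := μ) hp.aemeasurable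
  have h1 : ∫ ω, conj (f (ξ i ω)) * u (ξ (n + 1) ω) ∂μ =
      ∫ p, conj (f p.1.1) * u p.2 ∂(μ.map fun ω => ((ξ i ω, ξ n ω), ξ (n + 1) ω)) :=
    (integral_map hp3.aemeasurable hF.aestronglyMeasurable).symm
  have hint : Integrable (fun p : (S × S) × S => conj (f p.1.1) * u p.2)
      (μ.map fun ω => ((ξ i ω, ξ n ω), ξ (n + 1) ω)) :=
    (integrable_map_measure hF.aestronglyMeasurable hp3.aemeasurable).2
      (hξ.integrable_conj_mul f u i (n + 1))
  rw [hξ.map_prodMk_succ hin] at h1 hint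
  rw [h1, Measure.integral_compProd hint]
  simp only [Kernel.prodMkLeft_apply, integral_const_mul]
  have hG : Measurable fun p : S × S => conj (f p.1) * ∫ s, u s ∂(Q p.2) := by
    have h2 := ((Lp.stronglyMeasurable u).integral_kernel (κ := Q)).measurable
    exact (Complex.continuous_conj.measurable.comp (hf.comp measurable_fst)).mul
      (h2.comp measurable_snd)
  rw [integral_map hp.aemeasurable hG.aestronglyMeasurable]
  refine integral_congr_ae ?_
  filter_upwards [(hξ.measurePreserving n).quasiMeasurePreserving.ae
    (coeFn_kernelOperator Q (marginal μ ξ) hξ.invariant u)] with ω hω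
  rw [hω]

lemma integral_conj_mul (hξ : IsStationaryMarkovChain μ Q ξ)
    (f u : Lp ℂ 2 (marginal μ ξ)) (i : ℤ) (m : ℕ) :
    ∫ ω, conj (f (ξ i ω)) * u (ξ (i + m) ω) ∂μ =
      ⟪f, (kernelOperator Q (marginal μ ξ) hξ.invariant ^ m) u⟫_ℂ := by
  induction m generalizing u with
  | zero =>
    have hf := (Lp.stronglyMeasurable f).measurable
    have hu := (Lp.stronglyMeasurable u).measurable
    have hF : Measurable fun s => conj (f s) * u s := by
      have := Complex.continuous_conj.measurable
      fun_prop
    have h := integral_map (μ := μ) (hξ.measurable i).aemeasurable hF.aestronglyMeasurable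
    rw [hξ.map_eq_marginal i] at h
    rw [pow_zero, one_apply_eq_self, L2.inner_def, Nat.cast_zero, add_zero, ← h]
    simp [RCLike.inner_apply, mul_comm]
  | succ m ih =>
    rw [Nat.cast_succ, ← add_assoc, hξ.integral_conj_mul_succ f u (by omega), ih, pow_succ,
      mul_apply_eq_comp]

lemma covariance_eq_inner (hξ : IsStationaryMarkovChain μ Q ξ) {g : S → ℝ}
    (hg : MemLp g 2 (marginal μ ξ)) (hg0 : ∫ x, g x ∂(marginal μ ξ) = 0) (i : ℤ) (m : ℕ) :
    haveI := hξ.isProbabilityMeasure_marginal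
    cov[fun ω => g (ξ i ω), fun ω => g (ξ (i + m) ω); μ] =
      (⟪toL20 (marginal μ ξ) g hg hg0, (hξ.operator ^ m) (toL20 (marginal μ ξ) g hg hg0)⟫_ℂ).re := by
  have := hξ.isProbabilityMeasure_marginal
  have h0 : ∀ j, ∫ ω, g (ξ j ω) ∂μ = 0 := fun j => by
    rw [← hg0, ← hξ.map_eq_marginal j]
    refine (integral_map (hξ.measurable j).aemeasurable ?_).symm
    rw [hξ.map_eq_marginal j]
    exact hg.1
  rw [covariance_eq_sub (hξ.memLp_comp hg _) (hξ.memLp_comp hg _), h0, zero_mul, sub_zero]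
  rw [Submodule.coe_inner, operator, coe_transitionOperator_pow,
    ← hξ.integral_conj_mul _ _ i m]
  have h1 : ∀ j, ∀ᵐ ω ∂μ, (toL20 (marginal μ ξ) g hg hg0 : Lp ℂ 2 (marginal μ ξ)) (ξ j ω) =
      (g (ξ j ω) : ℂ) := fun j =>
    (hξ.measurePreserving j).quasiMeasurePreserving.ae (MemLp.coeFn_toLp (hg.ofReal (K := ℂ)))
  have h2 : ∫ ω, conj ((toL20 (marginal μ ξ) g hg hg0 : Lp ℂ 2 (marginal μ ξ)) (ξ i ω)) *
      (toL20 (marginal μ ξ) g hg hg0 : Lp ℂ 2 (marginal μ ξ)) (ξ (i + m) ω) ∂μ =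
      ∫ ω, ((g (ξ i ω) * g (ξ (i + m) ω) : ℝ) : ℂ) ∂μ := by
    refine integral_congr_ae ?_
    filter_upwards [h1 i, h1 (i + m)] with ω h3 h4
    rw [h3, h4, Complex.conj_ofReal, Complex.ofReal_mul]
  rw [h2, integral_complex_ofReal, Complex.ofReal_re]
  rfl

variable (hξ : IsStationaryMarkovChain μ Q ξ) (hQ : hξ.IsNormal) {g : S → ℝ}
  (hg : MemLp g 2 (marginal μ ξ)) (hg0 : ∫ x, g x ∂(marginal μ ξ) = 0)

lemma isFiniteMeasure_transitionSpectralMeasure :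
    IsFiniteMeasure (hξ.transitionSpectralMeasure hQ g hg hg0) := by
  have := hξ.isProbabilityMeasure_marginal
  exact isFiniteMeasure_spectralMeasure _ hQ _

lemma transitionSpectralMeasure_compl_closedBall :
    hξ.transitionSpectralMeasure hQ g hg hg0 (Metric.closedBall 0 1)ᶜ = 0 :=
  haveI := hξ.isProbabilityMeasure_marginal
  spectralMeasure_compl_closedBall hQ _ (norm_transitionOperator_le _ _ _)

lemma integral_conj_pow_mul_pow_transitionSpectralMeasure (m n : ℕ) :
    haveI := hξ.isProbabilityMeasure_marginal
    ∫ z, conj z ^ m * z ^ n ∂(hξ.transitionSpectralMeasure hQ g hg hg0) =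
      ⟪(hξ.operator ^ m) (toL20 (marginal μ ξ) g hg hg0),
        (hξ.operator ^ n) (toL20 (marginal μ ξ) g hg hg0)⟫_ℂ :=
  haveI := hξ.isProbabilityMeasure_marginal
  integral_conj_pow_mul_pow_spectralMeasure hQ _ (norm_transitionOperator_le _ _ _) m n

lemma map_conj_transitionSpectralMeasure :
    (hξ.transitionSpectralMeasure hQ g hg hg0).map conj =
      hξ.transitionSpectralMeasure hQ g hg hg0 := by
  have := hξ.isProbabilityMeasure_marginal
  have := hξ.isFiniteMeasure_transitionSpectralMeasure hQ hg hg0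
  refine map_conj_eq_of_moments (hξ.transitionSpectralMeasure_compl_closedBall hQ hg hg0)
    fun m n => ?_
  rw [integral_conj_pow_mul_pow_transitionSpectralMeasure]
  exact im_inner_transitionOperator_pow _ _ _ hg hg0 m n

lemma covariance_eq_integral_cos (i j : ℤ) :
    cov[fun ω => g (ξ i ω), fun ω => g (ξ j ω); μ] =
      ∫ t, Real.cos (((i : ℝ) - j) * t)
        ∂(spectralDistribution (hξ.transitionSpectralMeasure hQ g hg hg0)) := by
  have := hξ.isProbabilityMeasure_marginal
  have := hξ.isFiniteMeasure_transitionSpectralMeasure hQ hg hg0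
  have hν := hξ.transitionSpectralMeasure_compl_closedBall hQ hg hg0
  have key : ∀ (i : ℤ) (m : ℕ), cov[fun ω => g (ξ i ω), fun ω => g (ξ (i + m) ω); μ] =
      ∫ t, Real.cos (m * t)
        ∂(spectralDistribution (hξ.transitionSpectralMeasure hQ g hg hg0)) := fun i m => by
    rw [hξ.covariance_eq_inner hg hg0, integral_cos_spectralDistribution _ hν]
    have h1 := hξ.integral_conj_pow_mul_pow_transitionSpectralMeasure hQ hg hg0 0 m
    simp only [pow_zero, one_mul] at h1
    have h2 : Integrable (fun z : ℂ => z ^ m) (hξ.transitionSpectralMeasure hQ g hg hg0) :=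
      integrable_of_continuous_of_closedBall hν (by fun_prop)
    rw [show ∫ z, (z ^ m).re ∂(hξ.transitionSpectralMeasure hQ g hg hg0) =
      (∫ z, z ^ m ∂(hξ.transitionSpectralMeasure hQ g hg hg0)).re from
        integral_re (𝕜 := ℂ) h2, h1]
    rfl
  rcases le_total i j with hij | hij
  · obtain ⟨m, rfl⟩ := Int.le.dest hij
    rw [key]
    refine integral_congr_ae (ae_of_all _ fun t => ?_)
    change Real.cos _ = Real.cos _
    rw [← Real.cos_neg]
    congr 1
    push_cast
    ring
  · obtain ⟨m, rfl⟩ := Int.le.dest hij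
    rw [covariance_comm, key]
    refine integral_congr_ae (ae_of_all _ fun t => ?_)
    change Real.cos _ = Real.cos _
    congr 1
    push_cast
    ring

lemma variance_partialSum (n : ℕ) :
    Var[partialSum ξ g n; μ] = ∑ i ∈ Finset.Icc 1 n, ∑ j ∈ Finset.Icc 1 n,
      ∫ t, Real.cos (((i : ℝ) - j) * t)
        ∂(spectralDistribution (hξ.transitionSpectralMeasure hQ g hg hg0)) := by
  unfold partialSum
  rw [variance_fun_sum' (X := fun (i : ℕ) ω => g (ξ i ω)) fun i _ => hξ.memLp_comp hg i]
  refine Finset.sum_congr rfl fun i _ => Finset.sum_congr rfl fun j _ => ?_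
  rw [hξ.covariance_eq_integral_cos hQ hg hg0]
  simp

end IsStationaryMarkovChain

end NormalChain

theorem mainTheorem9 {Ω S : Type*} [MeasurableSpace Ω] [MeasurableSpace S]
    (μ : Measure Ω) [IsProbabilityMeasure μ] (Q : Kernel S S) [IsMarkovKernel Q]
    (ξ : ℤ → Ω → S) (hξ : NormalChain.IsStationaryMarkovChain μ Q ξ) (hQ : hξ.IsNormal)
    (g : S → ℝ) (hg : MemLp g 2 (NormalChain.marginal μ ξ))
    (hg0 : ∫ x, g x ∂(NormalChain.marginal μ ξ) = 0)
    (α : ℝ) (hα : α ∈ Ioo (0 : ℝ) 2) (h : ℝ → ℝ) (hh : NormalChain.IsSlowlyVarying h) :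
    Tendsto (fun n : ℕ => Var[NormalChain.partialSum ξ g n; μ] / ((n : ℝ) ^ α * h n))
        atTop (𝓝 1) ↔
      Tendsto (fun x : ℝ =>
          NormalChain.spectralDistributionFunction
              (hξ.transitionSpectralMeasure hQ g hg hg0) x /
            (1 / 2 * NormalChain.varianceConst α * x ^ (2 - α) * h (1 / x)))
        (𝓝[>] 0) (𝓝 1) := by
  have := hξ.isFiniteMeasure_transitionSpectralMeasure hQ hg hg0
  simp_rw [hξ.variance_partialSum hQ hg hg0]
  exact NormalChain.tendsto_sum_cos_iff (NormalChain.spectralDistribution_compl_Ico _)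
    (fun _ hx hxπ => NormalChain.spectralDistribution_symm
      (hξ.map_conj_transitionSpectralMeasure hQ hg hg0) hx hxπ) hα hh
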